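/- Let $K$ be a field of characteristic $0$ (e.g. $K=\mathbb C$) and $N\ge 1$. Let $\mathfrak{sp}(N)$ be the symplectic Lie algebra of rank $N$, i.e. the $2N\times 2N$ block matrices $\begin{pmatrix}A&B\\ C&-A^{T}\end{pmatrix}$ with $B,C$ symmetric. Let $e_{ij}$ be the $N\times N$ matrix units, and for $1\le i,j\le N$ let $E_{i+j}$ be the element with $A=C=0$, $B=e_{ij}+e_{ji}$; $F_{i+j}$ the element with $A=B=0$, $C=e_{ij}+e_{ji}$ ($i=j$ allowed); for $i<j$ let $E_{i-j}$ and $F_{i-j}$ be the elements with $B=C=0$ and $A=e_{ij}$, resp. $A=e_{ji}$; and let $H_{ii}$ be the element with $B=C=0$, $A=\frac12e_{ii}$. Let $U=U(\mathfrak{sp}(N))$ with its primitive coproduct $\Delta$ and counit $\varepsilon$, both extended $\xi$-adically to $U[[\xi]]$, where $\xi$ is a central formal parameter; tensor products are $\xi$-adically completed, so that $U[[\xi]]\otimes U[[\xi]]$ stands for $(U\otimes U)[[\xi]]$. Put $X^{(0)}=X$ for all these generators $X$. For $k=1,\dots,N$ let $\sigma_k=\ln\bigl(1+\xi E^{(k-1)}_{k+k}\bigr)$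 and define recursively, for $i,j>k$, $$E^{(k)}_{i+j}=E^{(k-1)}_{i+j}-\xi E^{(k-1)}_{k+i}E^{(k-1)}_{k+j}e^{-\sigma_k},\qquad F^{(k)}_{i+j}=F^{(k-1)}_{i+j}-\xi E^{(k-1)}_{k-i}E^{(k-1)}_{k-j}$$ ($i=j$ allowed), $E^{(k)}_{i-j}=E^{(k-1)}_{i-j}$, $F^{(k)}_{i-j}=F^{(k-1)}_{i-j}$ $(i<j)$, $H^{(k)}_{ii}=H^{(k-1)}_{ii}$. Define the extended jordanian twists and their products $$\mathcal F_{\mathcal E_k}=\Bigl(\prod^{\leftarrow}_{i>k}\exp\bigl\{\xi E^{(k-1)}_{k-i}\otimes E^{(k-1)}_{k+i}e^{-\frac12\sigma_k}\bigr\}\Bigr)\exp\{H_{kk}\otimes\sigma_k\},\qquad \mathcal F_k=\mathcal F_{\mathcal E_k}\cdots\mathcal F_{\mathcal E_1},\quad \mathcal F_0=1\otimes1,$$ where $i$ decreases from left to right, and $\Delta_k(a)=\mathcal F_k\,\Delta(a)\,\mathcal F_k^{-1}$. (The paper's formulas without $\xi$ are recovered by the rescaling $\xi E_{i+j}\to E_{i+j}$,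 $\xi^{-1}F_{i+j}\to F_{i+j}$, which preserves the commutation relations.) Then: 1. (Reproduction of the costructure.) For every $1\le k\le N$ and all $k<i<j\le N$ (resp. $k<i\le N$), writing $X$ for $X^{(k-1)}$ and $\sigma$ for $\sigma_k$ on the right-hand sides, $$\begin{aligned} \Delta_k(E^{(k-1)}_{i+i})&=E_{i+i}\otimes1+1\otimes E_{i+i}+2\xi E_{k+i}\otimes E_{k+i}e^{-\frac12\sigma}+\xi^2E_{k+k}\otimes E_{k+i}^2e^{-\sigma},\\ \Delta_k(E^{(k-1)}_{i+j})&=E_{i+j}\otimes1+1\otimes E_{i+j}+\xi E_{k+i}\otimes E_{k+j}e^{-\frac12\sigma}+\xi E_{k+j}\otimes E_{k+i}e^{-\frac12\sigma}+\xi^2E_{k+k}\otimes E_{k+i}E_{k+j}e^{-\sigma},\\ \Delta_k(F^{(k-1)}_{i+i})&=F_{i+i}\otimes1+1\otimes F_{i+i}+2\xi E_{k-i}\otimes E_{k-i}e^{-\frac12\sigma}-\xi^2E_{k-i}^2\otimes E_{k+k}e^{-\sigma},\\ \Delta_k(F^{(k-1)}_{i+j})&=F_{i+j}\otimes1+1\otimes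 F_{i+j}+\xi E_{k-i}\otimes E_{k-j}e^{-\frac12\sigma}+\xi E_{k-j}\otimes E_{k-i}e^{-\frac12\sigma}-\xi^2E_{k-i}E_{k-j}\otimes E_{k+k}e^{-\sigma}, \end{aligned}$$ and $E^{(k-1)}_{i-j}$, $F^{(k-1)}_{i-j}$, $H^{(k-1)}_{ii}$ are primitive for $\Delta_k$. 2. (Primitive copies.) For every $0\le k\le N$ there is a Lie algebra homomorphism $\varphi_k:\mathfrak{sp}(N-k)\to U[[\xi]]$ that sends the generators $E_{i\pm j},F_{i\pm j},E_{i+i},F_{i+i},H_{ii}$ of $\mathfrak{sp}(N-k)$ to the elements $X^{(k)}$ with indices shifted by $k$; all elements of its image are primitive for $\Delta_k$, and the induced $\xi$-adically continuous algebra map $U(\mathfrak{sp}(N-k))[[\xi]]\to U[[\xi]]$ is injective. For $k<N$ the image of the map for $k+1$ is contained in the image of the map for $k$. 3. (Twist equation.) For every $0\le k\le N$, in particular for the full chain $\mathcal F=\mathcal F_N$, $\mathcal F_k$ is invertible and $$(\mathcal F_k)_{12}(\Delta\otimes\mathrm{id})\mathcal F_k=(\mathcal F_k)_{23}(\mathrm{id}\otimes\Delta)\mathcal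 F_k,\qquad(\varepsilon\otimes\mathrm{id})\mathcal F_k=(\mathrm{id}\otimes\varepsilon)\mathcal F_k=1.$$ 4. (Carrier.) Let $\mathbf N^+$ (resp. $\mathbf B^+$) be the Lie subalgebra of $\mathfrak{sp}(N)$ generated by the $E_{i+j}$ $(i\le j)$ and $E_{i-j}$ $(i<j)$ (resp. by these and the $H_{ii}$). Among the Lie subalgebras $L\subseteq\mathfrak{sp}(N)$ with $\mathcal F\in(U(L)\otimes U(L))[[\xi]]$ there is a least one, the carrier of $\mathcal F$, and it equals $\mathbf B^+$. In particular the chain is full (its carrier contains $\mathbf N^+$), and it is proper: $\mathcal F\notin(U(M)\otimes U(M))[[\xi]]$ for every Lie subalgebra $M\subseteq\mathfrak{sp}(N)$ isomorphic to $\mathfrak{sl}(N)$. -/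

import Mathlib

open scoped TensorProduct PowerSeries

/- Associative algebras are Lie algebras through the commutator bracket. -/
attribute [local instance 100] LieRing.ofAssociativeRing

noncomputable section

namespace SpChain

/-! ### Formal exponential and logarithm over a noncommutative algebra

`A⟦X⟧` is the algebra of formal power series in a central deformation parameter `X` with
coefficients in the (noncommutative) `K`-algebra `A`. -/

section Formal

variable (K : Type*) [Field K] {A : Type*} [Ring A] [Algebra K A]

/-- `exp a = ∑ₖ aᵏ / k!`, for `a` without constant term (then `aᵏ` only contributes to the
coefficients of order at least `k`, so that each coefficient is a finite sum). -/
def fexp (a : A⟦X⟧) : A⟦X⟧ :=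
  PowerSeries.mk fun n =>
    ∑ k ∈ Finset.range (n + 1), ((k.factorial : K)⁻¹) • PowerSeries.coeff n (a ^ k)

/-- `ln (1 + a) = ∑_{k ≥ 1} (-1)^(k+1) aᵏ / k`, for `a` without constant term. -/
def flogOneAdd (a : A⟦X⟧) : A⟦X⟧ :=
  PowerSeries.mk fun n =>
    ∑ k ∈ Finset.Icc 1 n, ((-1) ^ (k + 1) * (k : K)⁻¹) • PowerSeries.coeff n (a ^ k)

/-- The `K⟦X⟧`-linear, `X`-adically continuous extension `A⟦X⟧ → B⟦X⟧` of an algebra map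
`A → B⟦X⟧`, that is `∑ₘ aₘ Xᵐ ↦ ∑ₘ f(aₘ) Xᵐ`. -/
def extendSeries {K : Type*} [Field K] {A B : Type*} [Ring A] [Algebra K A] [Ring B] [Algebra K B]
    (f : A →ₐ[K] B⟦X⟧) (a : A⟦X⟧) : B⟦X⟧ :=
  PowerSeries.mk fun n =>
    ∑ p ∈ Finset.HasAntidiagonal.antidiagonal n, PowerSeries.coeff p.2 (f (PowerSeries.coeff p.1 a))

/-- `a ⊗ b` in the completed tensor square `(A ⊗ A)⟦X⟧` of `A⟦X⟧` over `K⟦X⟧`. -/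
def tens (a b : A⟦X⟧) : (A ⊗[K] A)⟦X⟧ :=
  PowerSeries.map (Algebra.TensorProduct.includeLeft : A →ₐ[K] A ⊗[K] A).toRingHom a *
    PowerSeries.map (Algebra.TensorProduct.includeRight : A →ₐ[K] A ⊗[K] A).toRingHom b

end Formal

/-! ### The primitive Hopf structure of `U(g)` and its twists -/

section Twist

variable (K : Type*) [Field K] (g : Type*) [LieRing g] [LieAlgebra K g]

/-- The universal enveloping algebra `U(g)`. -/
abbrev U : Type _ := UniversalEnvelopingAlgebra K g

/-- The primitive comultiplication `x ↦ x ⊗ 1 + 1 ⊗ x` on the Lie algebra. -/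
def primLie : g →ₗ⁅K⁆ (U K g ⊗[K] U K g) where
  toFun x := UniversalEnvelopingAlgebra.ι K x ⊗ₜ[K] 1 + 1 ⊗ₜ[K] UniversalEnvelopingAlgebra.ι K x
  map_add' x y := by
    simp only [map_add, TensorProduct.add_tmul, TensorProduct.tmul_add]; abel
  map_smul' c x := by
    simp only [map_smul, TensorProduct.smul_tmul', TensorProduct.tmul_smul, smul_add,
      RingHom.id_apply]
  map_lie' {x y} := by
    simp only [LieHom.map_lie, LieRing.of_associative_ring_bracket, add_mul, mul_add,
      Algebra.TensorProduct.tmul_mul_tmul, one_mul, mul_one, TensorProduct.sub_tmul,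
      TensorProduct.tmul_sub]
    abel

/-- The primitive comultiplication `Δ : U(g) → U(g) ⊗ U(g)`. -/
def comul : U K g →ₐ[K] (U K g ⊗[K] U K g) :=
  UniversalEnvelopingAlgebra.lift K (primLie K g)

/-- The counit `ε : U(g) → K`, with `ε(x) = 0` for `x` in `g`. -/
def counit : U K g →ₐ[K] K :=
  UniversalEnvelopingAlgebra.lift K (0 : g →ₗ⁅K⁆ K)

/-- `F` is a twisting element for `U(g)` with its primitive Hopf structure: it is invertible,
`F₁₂ (Δ ⊗ id)(F) = F₂₃ (id ⊗ Δ)(F)` and `(ε ⊗ id)(F) = (id ⊗ ε)(F) = 1`. -/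
structure IsTwist (F : (U K g ⊗[K] U K g)⟦X⟧) : Prop where
  isUnit : IsUnit F
  cocycle :
    PowerSeries.map (Algebra.TensorProduct.includeLeft :
        (U K g ⊗[K] U K g) →ₐ[K] (U K g ⊗[K] U K g) ⊗[K] U K g).toRingHom F *
      PowerSeries.map
        (Algebra.TensorProduct.map (comul K g) (AlgHom.id K (U K g))).toRingHom F =
    PowerSeries.map
        ((Algebra.TensorProduct.assoc K K K (U K g) (U K g) (U K g)).symm.toAlgHom.comp
          (Algebra.TensorProduct.includeRight :
            (U K g ⊗[K] U K g) →ₐ[K] U K g ⊗[K] (U K g ⊗[K] U K g))).toRingHom F *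
      PowerSeries.map
        ((Algebra.TensorProduct.assoc K K K (U K g) (U K g) (U K g)).symm.toAlgHom.comp
          (Algebra.TensorProduct.map (AlgHom.id K (U K g)) (comul K g))).toRingHom F
  counit_left :
    PowerSeries.map ((Algebra.TensorProduct.lid K (U K g)).toAlgHom.comp
      (Algebra.TensorProduct.map (counit K g) (AlgHom.id K (U K g)))).toRingHom F = 1
  counit_right :
    PowerSeries.map ((Algebra.TensorProduct.rid K K (U K g)).toAlgHom.comp
      (Algebra.TensorProduct.map (AlgHom.id K (U K g)) (counit K g))).toRingHom F = 1

/-- The twisted comultiplication `Δ_F(a) = F Δ(a) F⁻¹` on `U(g)⟦X⟧` (used for invertible `F`). -/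
def twistedComul (F : (U K g ⊗[K] U K g)⟦X⟧) (a : (U K g)⟦X⟧) : (U K g ⊗[K] U K g)⟦X⟧ :=
  F * PowerSeries.map (comul K g).toRingHom a * Ring.inverse F

variable {K g}

/-- `a` is primitive for `Δ_F`. -/
def IsPrimitiveFor (F : (U K g ⊗[K] U K g)⟦X⟧) (a : (U K g)⟦X⟧) : Prop :=
  twistedComul K g F a = tens K a 1 + tens K 1 a

/-- `F` is defined over the Lie subalgebra `L`: all its coefficients lie in (the image of)
`U(L) ⊗ U(L)`. -/
def IsDefinedOver (F : (U K g ⊗[K] U K g)⟦X⟧) (L : LieSubalgebra K g) : Prop :=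
  ∀ n : ℕ, PowerSeries.coeff n F ∈
    (Algebra.TensorProduct.map
      (UniversalEnvelopingAlgebra.lift K ((UniversalEnvelopingAlgebra.ι K).comp L.incl))
      (UniversalEnvelopingAlgebra.lift K ((UniversalEnvelopingAlgebra.ι K).comp L.incl)) :
        (U K L ⊗[K] U K L) →ₐ[K] (U K g ⊗[K] U K g)).range

/-- The carrier of `F`: the least Lie subalgebra over which `F` is defined. -/
def IsCarrier (F : (U K g ⊗[K] U K g)⟦X⟧) (L : LieSubalgebra K g) : Prop :=
  IsLeast {M : LieSubalgebra K g | IsDefinedOver F M} L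

end Twist

/-! ### Generators of `sp(N)`

`sp K N` consists of the `2N × 2N` block matrices `(A, B; C, -Aᵀ)` with `B` and `C` symmetric. -/

section Sp

/-- The symplectic Lie algebra of rank `N`. -/
abbrev sp (K : Type*) [Field K] (N : ℕ) :
    LieSubalgebra K (Matrix (Fin N ⊕ Fin N) (Fin N ⊕ Fin N) K) :=
  LieAlgebra.Symplectic.sp (Fin N) K

variable (K : Type*) [Field K] {N : ℕ}

lemma fromBlocks_mem_sp (A B C : Matrix (Fin N) (Fin N) K)
    (hB : B.transpose = B) (hC : C.transpose = C) :
    Matrix.fromBlocks A B C (-A.transpose) ∈ sp K N := by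
  change _ ∈ skewAdjointMatricesSubmodule _
  rw [mem_skewAdjointMatricesSubmodule]
  simp [Matrix.IsSkewAdjoint, Matrix.IsAdjointPair, Matrix.J, Matrix.fromBlocks_transpose,
    Matrix.fromBlocks_multiply, Matrix.fromBlocks_neg, hB, hC]

/-- The root vector `E_{i+j}` of the root `e_i + e_j`; `i = j` is allowed and gives `E_{i+i}`. -/
def rootEplus (i j : Fin N) : sp K N :=
  ⟨Matrix.fromBlocks 0 (Matrix.single i j 1 + Matrix.single j i 1) 0 (-Matrix.transpose 0),
    fromBlocks_mem_sp K _ _ _ (by simp [add_comm]) (by simp)⟩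

/-- The root vector `F_{i+j}` of the root `-e_i - e_j`; `i = j` is allowed and gives `F_{i+i}`. -/
def rootFplus (i j : Fin N) : sp K N :=
  ⟨Matrix.fromBlocks 0 0 (Matrix.single i j 1 + Matrix.single j i 1) (-Matrix.transpose 0),
    fromBlocks_mem_sp K _ _ _ (by simp) (by simp [add_comm])⟩

/-- For `i ≠ j`, the root vector of the root `e_i - e_j`. It is `E_{i-j}` for `i < j`, and it is
`F_{j-i}` for `j < i`. -/
def rootMinus (i j : Fin N) : sp K N :=
  ⟨Matrix.fromBlocks (Matrix.single i j 1) 0 0 (-(Matrix.single i j 1).transpose),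
    fromBlocks_mem_sp K _ _ _ (by simp) (by simp)⟩

/-- The Cartan generator `H_{ii}`, normalized by `[H_{ii}, E_{i+i}] = E_{i+i}`. -/
def cartan (i : Fin N) : sp K N :=
  ⟨Matrix.fromBlocks (Matrix.single i i (1 / 2)) 0 0 (-(Matrix.single i i (1 / 2)).transpose),
    fromBlocks_mem_sp K _ _ _ (by simp) (by simp)⟩

/-- The set of positive root vectors `E_{i+j}` (`i ≤ j`) and `E_{i-j}` (`i < j`). -/
def posRootVectors (N : ℕ) : Set (sp K N) :=
  {x | (∃ i j : Fin N, i ≤ j ∧ x = rootEplus K i j) ∨ ∃ i j : Fin N, i < j ∧ x = rootMinus K i j}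

/-- The maximal nilpotent subalgebra `N⁺(sp(N))`. -/
def nilPlus (N : ℕ) : LieSubalgebra K (sp K N) :=
  LieSubalgebra.lieSpan K (sp K N) (posRootVectors K N)

/-- The Borel subalgebra `B⁺(sp(N))`. -/
def borelPlus (N : ℕ) : LieSubalgebra K (sp K N) :=
  LieSubalgebra.lieSpan K (sp K N) (posRootVectors K N ∪ Set.range (cartan K))

/-- A twist is full if its carrier contains `N⁺(sp(N))`. -/
def IsFull (F : (U K (sp K N) ⊗[K] U K (sp K N))⟦X⟧) : Prop :=
  ∃ L : LieSubalgebra K (sp K N), IsCarrier F L ∧ nilPlus K N ≤ L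

/-- A twist is proper for `sp(N)` if it does not come from an `sl(N)`-subalgebra. -/
def IsProper (F : (U K (sp K N) ⊗[K] U K (sp K N))⟦X⟧) : Prop :=
  ∀ M : LieSubalgebra K (sp K N),
    Nonempty (M ≃ₗ⁅K⁆ LieAlgebra.SpecialLinear.sl (Fin N) K) → ¬ IsDefinedOver F M

end Sp

/-! ### The successively modified generators and the chain

The positive root vectors of the roots `e_i + e_j` enter the twists as `X • E_{i+j}`. This is the
result of the rescaling `E_{i+j} ↦ X E_{i+j}`, `F_{i+j} ↦ X⁻¹ F_{i+j}`, which preserves all the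
commutation relations and makes sense of `ln (1 + E_{i+i})`. -/

/-- A family of elements of an algebra indexed like the generators of `sp(N)`: `Ep i j` for
`E_{i+j}`, `Fp i j` for `F_{i+j}`, `Em i j` for `E_{i-j}` (`i < j`) or `F_{j-i}` (`j < i`), and
`H i` for `H_{ii}`. -/
structure Gens (N : ℕ) (A : Type*) where
  Ep : Fin N → Fin N → A
  Fp : Fin N → Fin N → A
  Em : Fin N → Fin N → A
  H : Fin N → A

section Chain

variable (K : Type*) [Field K] (N : ℕ)

/-- The element of `U(sp(N))⟦X⟧` given by an element of `sp(N)`. -/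
def emb (x : sp K N) : (U K (sp K N))⟦X⟧ :=
  PowerSeries.C (UniversalEnvelopingAlgebra.ι K x)

/-- The unmodified generators of `sp(N)`. -/
def gens₀ : Gens N (U K (sp K N))⟦X⟧ where
  Ep i j := emb K N (rootEplus K i j)
  Fp i j := emb K N (rootFplus K i j)
  Em i j := emb K N (rootMinus K i j)
  H i := emb K N (cartan K i)

variable {N}

/-- `σ_{k+k} = ln (1 + X E_{k+k})`. -/
def sigma {A : Type*} [Ring A] [Algebra K A] (G : Gens N A⟦X⟧) (k : Fin N) : A⟦X⟧ :=
  flogOneAdd K (PowerSeries.X * G.Ep k k)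

/-- `exp (c σ_{k+k})`. -/
def expSigma {A : Type*} [Ring A] [Algebra K A] (G : Gens N A⟦X⟧) (k : Fin N) (c : K) : A⟦X⟧ :=
  fexp K (c • sigma K G k)

/-- The nonlinear change of generators attached to the index `k`. Only the new generators with
indices `i, j > k` are meaningful (and used later on). -/
def modify {A : Type*} [Ring A] [Algebra K A] (G : Gens N A⟦X⟧) (k : Fin N) : Gens N A⟦X⟧ where
  Ep i j := G.Ep i j - PowerSeries.X * (G.Ep k i * G.Ep k j * expSigma K G k (-1))
  Fp i j := G.Fp i j - PowerSeries.X * (G.Em k i * G.Em k j)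
  Em i j := G.Em i j
  H i := G.H i

variable (N) in
/-- The generators after `k` modifications, attached successively to the indices `0, …, k - 1`.
They are used for indices `i, j ≥ k`. -/
def gens : ℕ → Gens N (U K (sp K N))⟦X⟧
  | 0 => gens₀ K N
  | k + 1 => if h : k < N then modify K (gens k) ⟨k, h⟩ else gens k

/-- The extended jordanian twist with initial generator `E_{k+k}`,
`∏_{i > k} exp (X E_{k-i} ⊗ E_{k+i} e^{-σ/2}) · exp (H_{kk} ⊗ σ)` with `σ = σ_{k+k}`, where `i`
decreases from left to right. -/
def extJordanian {A : Type*} [Ring A] [Algebra K A] (G : Gens N A⟦X⟧) (k : Fin N) :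
    (A ⊗[K] A)⟦X⟧ :=
  (((List.finRange N).filter (fun i => k < i)).reverse.map fun i =>
      fexp K (PowerSeries.X * tens K (G.Em k i) (G.Ep k i * expSigma K G k (-1 / 2)))).prod *
    fexp K (tens K (G.H k) (sigma K G k))

variable (N) in
/-- The product of the first `k` links; the link with index `j` is the extended jordanian twist
on the `j` times modified generators, and later links stand to the left. -/
def chain : ℕ → (U K (sp K N) ⊗[K] U K (sp K N))⟦X⟧
  | 0 => 1
  | k + 1 => if h : k < N then extJordanian K (gens K N k) ⟨k, h⟩ * chain k else chain k

/-- The index `k + i` of `sp(N)` that corresponds to the index `i` of `sp(N - k)`. -/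
def shift (k : ℕ) (i : Fin (N - k)) : Fin N := ⟨k + i, by omega⟩

/-- The costructure of the step with index `k`: the coproducts, for the twist `F`, of the
generators `G` with indices `i, j > k`. -/
structure HasStepCostructure (F : (U K (sp K N) ⊗[K] U K (sp K N))⟦X⟧)
    (G : Gens N (U K (sp K N))⟦X⟧) (k : Fin N) : Prop where
  Ep_diag : ∀ i, k < i →
    twistedComul K (sp K N) F (G.Ep i i) =
      tens K (G.Ep i i) 1 + tens K 1 (G.Ep i i)
      + 2 * (PowerSeries.X * tens K (G.Ep k i) (G.Ep k i * expSigma K G k (-1 / 2)))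
      + PowerSeries.X ^ 2 * tens K (G.Ep k k) (G.Ep k i ^ 2 * expSigma K G k (-1))
  Ep_off : ∀ i j, k < i → i < j →
    twistedComul K (sp K N) F (G.Ep i j) =
      tens K (G.Ep i j) 1 + tens K 1 (G.Ep i j)
      + PowerSeries.X * tens K (G.Ep k i) (G.Ep k j * expSigma K G k (-1 / 2))
      + PowerSeries.X * tens K (G.Ep k j) (G.Ep k i * expSigma K G k (-1 / 2))
      + PowerSeries.X ^ 2 * tens K (G.Ep k k) (G.Ep k i * G.Ep k j * expSigma K G k (-1))
  Fp_diag : ∀ i, k < i →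
    twistedComul K (sp K N) F (G.Fp i i) =
      tens K (G.Fp i i) 1 + tens K 1 (G.Fp i i)
      + 2 * (PowerSeries.X * tens K (G.Em k i) (G.Em k i * expSigma K G k (-1 / 2)))
      - PowerSeries.X ^ 2 * tens K (G.Em k i ^ 2) (G.Ep k k * expSigma K G k (-1))
  Fp_off : ∀ i j, k < i → i < j →
    twistedComul K (sp K N) F (G.Fp i j) =
      tens K (G.Fp i j) 1 + tens K 1 (G.Fp i j)
      + PowerSeries.X * tens K (G.Em k i) (G.Em k j * expSigma K G k (-1 / 2))
      + PowerSeries.X * tens K (G.Em k j) (G.Em k i * expSigma K G k (-1 / 2))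
      - PowerSeries.X ^ 2 * tens K (G.Em k i * G.Em k j) (G.Ep k k * expSigma K G k (-1))
  Em_prim : ∀ i j, k < i → k < j → i ≠ j → IsPrimitiveFor F (G.Em i j)
  H_prim : ∀ i, k < i → IsPrimitiveFor F (G.H i)

end Chain

end SpChain

end

noncomputable section

namespace SpChain

/-! ### Evaluation of commutative power series at noncommutative topologically nilpotent elements -/

section SeriesEval

open PowerSeries

/-! The chain is built by a step that reproduces its own hypotheses. Suppose that `F` makes a family
`G` with the `sp` relations primitive, and let `o` be an index of the family, with σ = ln(1 +
ξE_{o+o}). Conjugation by exp(H ⊗ σ) multiplies c ⊗ 1 by 1 ⊗ e^{rσ} when c has weight r under H, and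
conjugation by the exponential of the extension terms is a series that stops after the second
bracket (`fexp_mul_of_lie`). Hence the coproducts after a further link are explicit (the lemmas
`link_mul_Ep`, `link_mul_Fp`, `link_mul_M` and their companions). The generators with indices other
than o fail to be primitive exactly by the cross terms in the coproducts of E_{o+i}E_{o+j}e^{-σ} and
E_{o-i}E_{o-j}. Subtracting these products restores primitivity (`IsPrimitiveFamily.modify`), and by
(1 + ξE_{o+o})e^{-σ} = 1 the corrected elements satisfy the `sp` relations again
(`IsSpFamily.modify`). Induction over the links gives the costructure and the primitive copies.

The twist equation is carried along the same induction (`TripleLegs.IsCocycle.link_mul`). The first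
legs of a link are F-primitive, so F₁₂ moves past (Δ ⊗ id) of the link at the price of splitting the
first leg; the second legs have known coproducts under the product of the link and F. What is left
is an identity between exponentials in three legs, `link_mul_fexp`, which follows from two
exchanges.

Injectivity on enveloping algebras is obtained without a Poincaré–Birkhoff–Witt basis.
Multiplication after Δ acts as 2^n in filtration degree n up to lower terms, so in characteristic
zero primitive elements have degree at most one (`exists_ι_of_primitive`). An injective Lie map into
primitive elements then stays injective on the enveloping algebra, by induction on the degree
(`lift_injective`). Modulo ξ the modified generators are ordinary root vectors, which reduces the
copies of U(sp(N-k)) to this case.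

For the carrier, the coefficient of ξ in the full chain is a sum of tensors H_{ii} ⊗ E_{i+i} and
E_{i-j} ⊗ E_{i+j}, with linearly independent elements on either side. A subalgebra over which the
chain is defined must therefore contain all of them, and they generate the Borel subalgebra
(`borelPlus_le_of_isDefinedOver`). Properness follows by counting dimensions.

All exponentials and logarithms are values of one-variable series at elements divisible by ξ, and
identities between them are checked modulo every power of ξ. -/

lemma ext_of_X_pow_dvd {A : Type*} [Ring A] {a b : A⟦X⟧} (h : ∀ n, (X : A⟦X⟧) ^ n ∣ a - b) :
    a = b := by
  ext n
  have := X_pow_dvd_iff.1 (h (n + 1)) n (Nat.lt_succ_self n)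
  rwa [map_sub, sub_eq_zero] at this

lemma X_pow_dvd_mul_left {A : Type*} [Ring A] {a : A⟦X⟧} {n : ℕ} (h : (X : A⟦X⟧) ^ n ∣ a)
    (b : A⟦X⟧) : (X : A⟦X⟧) ^ n ∣ b * a := by
  obtain ⟨c, rfl⟩ := h
  exact ⟨b * c, by rw [← mul_assoc, (commute_X_pow b n).eq, mul_assoc]⟩

lemma X_pow_dvd_pow {A : Type*} [Ring A] {a : A⟦X⟧} (h : (X : A⟦X⟧) ∣ a) (n : ℕ) :
    (X : A⟦X⟧) ^ n ∣ a ^ n := by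
  obtain ⟨c, rfl⟩ := h
  exact ⟨c ^ n, by rw [((commute_X c).symm).mul_pow]⟩

variable {K : Type*} [Field K] {A B : Type*} [Ring A] [Algebra K A] [Ring B] [Algebra K B]

lemma X_dvd_smul {a : A⟦X⟧} (h : (X : A⟦X⟧) ∣ a) (c : K) : (X : A⟦X⟧) ∣ c • a := by
  obtain ⟨b, rfl⟩ := h
  exact ⟨c • b, by rw [mul_smul_comm]⟩

/-- The value at `a` of the power series `f`, for `a` without constant term. -/
def seriesEval (a : A⟦X⟧) (f : K⟦X⟧) : A⟦X⟧ :=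
  PowerSeries.mk fun n => ∑ k ∈ Finset.range (n + 1), coeff k f • coeff n (a ^ k)

lemma aeval_trunc (a : A⟦X⟧) (f : K⟦X⟧) (n : ℕ) :
    Polynomial.aeval a (trunc n f) = ∑ k ∈ Finset.range n, coeff k f • a ^ k := by
  rcases n with _ | n
  · simp
  · rw [Polynomial.aeval_eq_sum_range' (natDegree_trunc_lt f n)]
    refine Finset.sum_congr rfl fun k hk => ?_
    rw [coeff_trunc, if_pos (Finset.mem_range.1 hk)]

/-- Since a^k is divisible by X^k, only the powers below n matter modulo X^n. Every property of
`seriesEval` is reduced through this to a statement about polynomials in a. -/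
lemma X_pow_dvd_seriesEval_sub {a : A⟦X⟧} (h : (X : A⟦X⟧) ∣ a) (f : K⟦X⟧) (n : ℕ) :
    (X : A⟦X⟧) ^ n ∣ seriesEval a f - Polynomial.aeval a (trunc n f) := by
  rw [X_pow_dvd_iff]
  intro m hm
  have h0 : ∀ k, m < k → coeff m (a ^ k) = 0 := fun k hk =>
    X_pow_dvd_iff.1 (X_pow_dvd_pow h k) m hk
  rw [map_sub, sub_eq_zero, seriesEval, coeff_mk, aeval_trunc, map_sum,
    Finset.sum_subset (s₂ := Finset.range n) (Finset.range_subset_range.2 (by omega : m + 1 ≤ n))]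
  · exact Finset.sum_congr rfl fun k _ => by rw [coeff_smul]
  · intro k _ hk
    rw [h0 k (by simpa using hk), smul_zero]

lemma X_pow_dvd_aeval {a : A⟦X⟧} (h : (X : A⟦X⟧) ∣ a) {n : ℕ} {p : Polynomial K}
    (hp : Polynomial.X ^ n ∣ p) : (X : A⟦X⟧) ^ n ∣ Polynomial.aeval a p := by
  obtain ⟨q, rfl⟩ := hp
  rw [map_mul, map_pow, Polynomial.aeval_X]
  exact Dvd.dvd.mul_right (X_pow_dvd_pow h n) _

lemma seriesEval_mul {a : A⟦X⟧} (h : (X : A⟦X⟧) ∣ a) (f g : K⟦X⟧) :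
    seriesEval a (f * g) = seriesEval a f * seriesEval a g := by
  refine ext_of_X_pow_dvd fun n => ?_
  have h1 := X_pow_dvd_seriesEval_sub h (f * g) n
  have h2 := X_pow_dvd_seriesEval_sub h f n
  have h3 := X_pow_dvd_seriesEval_sub h g n
  have h4 : (X : A⟦X⟧) ^ n ∣
      Polynomial.aeval a (trunc n (f * g) - trunc n f * trunc n g) := by
    refine X_pow_dvd_aeval h (Polynomial.X_pow_dvd_iff.2 fun d hd => ?_)
    rw [Polynomial.coeff_sub, coeff_trunc, if_pos hd, coeff_mul, Polynomial.coeff_mul, sub_eq_zero]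
    refine Finset.sum_congr rfl fun p hp => ?_
    have := Finset.HasAntidiagonal.mem_antidiagonal.1 hp
    rw [coeff_trunc, coeff_trunc, if_pos (by omega), if_pos (by omega)]
  rw [map_sub, map_mul (Polynomial.aeval a)] at h4
  have e : seriesEval a (f * g) - seriesEval a f * seriesEval a g =
      (seriesEval a (f * g) - Polynomial.aeval a (trunc n (f * g)))
      + (Polynomial.aeval a (trunc n (f * g)) -
        Polynomial.aeval a (trunc n f) * Polynomial.aeval a (trunc n g))
      - ((seriesEval a f - Polynomial.aeval a (trunc n f)) * seriesEval a g
        + Polynomial.aeval a (trunc n f) * (seriesEval a g - Polynomial.aeval a (trunc n g))) := by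
    noncomm_ring
  rw [e]
  exact dvd_sub (dvd_add h1 h4) (dvd_add (h2.mul_right _) (X_pow_dvd_mul_left h3 _))

/-- Evaluation at `a` as an algebra homomorphism. -/
def seriesEvalHom (a : A⟦X⟧) (h : (X : A⟦X⟧) ∣ a) : K⟦X⟧ →ₐ[K] A⟦X⟧ :=
  AlgHom.ofLinearMap
    { toFun := seriesEval a
      map_add' := fun f g => by
        ext n; simp [seriesEval, add_smul, Finset.sum_add_distrib]
      map_smul' := fun c f => by
        ext n; simp [seriesEval, mul_smul, Finset.smul_sum] }
    (by
      ext n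
      simp only [LinearMap.coe_mk, AddHom.coe_mk, seriesEval, coeff_mk, coeff_one, ite_smul,
        one_smul, zero_smul]
      simp [coeff_one])
    (fun f g => seriesEval_mul h f g)

lemma seriesEvalHom_apply (a : A⟦X⟧) (h : (X : A⟦X⟧) ∣ a) (f : K⟦X⟧) :
    seriesEvalHom a h f = seriesEval a f := rfl

lemma seriesEval_X {a : A⟦X⟧} (h : (X : A⟦X⟧) ∣ a) : seriesEval a (X : K⟦X⟧) = a := by
  ext n
  rcases n with _ | n
  · have := X_dvd_iff.1 h
    simp [seriesEval, this]
  · simp [seriesEval, coeff_X]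

lemma X_dvd_map {Ψ : A⟦X⟧ →ₐ[K] B⟦X⟧} (hΨ : (X : B⟦X⟧) ∣ Ψ X) {a : A⟦X⟧} {n : ℕ}
    (h : (X : A⟦X⟧) ^ n ∣ a) : (X : B⟦X⟧) ^ n ∣ Ψ a := by
  obtain ⟨b, rfl⟩ := h
  rw [map_mul, map_pow]
  exact (X_pow_dvd_pow hΨ n).mul_right _

/-- The hypothesis on Ψ is continuity in algebraic form: it makes Ψ respect divisibility by X^n.
With Ψ an evaluation map this becomes substitution of one series into another, so that identities in
one variable transfer to noncommutative elements. -/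
lemma map_seriesEval {Ψ : A⟦X⟧ →ₐ[K] B⟦X⟧} (hΨ : (X : B⟦X⟧) ∣ Ψ X) {a : A⟦X⟧}
    (h : (X : A⟦X⟧) ∣ a) (f : K⟦X⟧) : Ψ (seriesEval a f) = seriesEval (Ψ a) f := by
  refine ext_of_X_pow_dvd fun n => ?_
  have h1 := X_dvd_map hΨ (X_pow_dvd_seriesEval_sub h f n)
  have h' : (X : B⟦X⟧) ∣ Ψ a := by simpa using X_dvd_map hΨ (n := 1) (by simpa using h)
  have h2 := X_pow_dvd_seriesEval_sub h' f n
  rw [map_sub, ← Polynomial.aeval_algHom_apply] at h1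
  simpa using dvd_sub h1 h2

/-- Conjugation passes from a to its powers, hence to series. In the form g a = b g no inverse of g
has to be carried around. -/
lemma semiconjBy_seriesEval {g a b : A⟦X⟧} (ha : (X : A⟦X⟧) ∣ a) (hb : (X : A⟦X⟧) ∣ b)
    (h : SemiconjBy g a b) (f : K⟦X⟧) : SemiconjBy g (seriesEval a f) (seriesEval b f) := by
  refine ext_of_X_pow_dvd fun n => ?_
  have key : SemiconjBy g (Polynomial.aeval a (trunc n f)) (Polynomial.aeval b (trunc n f)) := by
    induction trunc n f using Polynomial.induction_on' with
    | add p q hp hq => rw [map_add, map_add]; exact hp.add_right hq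
    | monomial k c =>
      rw [Polynomial.aeval_monomial, Polynomial.aeval_monomial]
      exact SemiconjBy.mul_right (Algebra.commute_algebraMap_right c g) (h.pow_right k)
  have e : g * seriesEval a f - seriesEval b f * g =
      g * (seriesEval a f - Polynomial.aeval a (trunc n f)) -
        (seriesEval b f - Polynomial.aeval b (trunc n f)) * g := by
    rw [mul_sub, sub_mul, key.eq]; abel
  rw [e]
  exact dvd_sub (X_pow_dvd_mul_left (X_pow_dvd_seriesEval_sub ha f n) _)
    ((X_pow_dvd_seriesEval_sub hb f n).mul_right _)

variable (K) in
/-- The exponential series. -/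
def expSeries : K⟦X⟧ := PowerSeries.mk fun k => ((k.factorial : K)⁻¹)

variable (K) in
/-- The logarithmic series `ln (1 + t)`. -/
def logSeries : K⟦X⟧ := PowerSeries.mk fun k => (-1) ^ (k + 1) * (k : K)⁻¹

lemma fexp_eq_seriesEval (a : A⟦X⟧) : fexp K a = seriesEval a (expSeries K) := by
  ext n; simp [fexp, seriesEval, expSeries]

lemma flogOneAdd_eq_seriesEval (a : A⟦X⟧) : flogOneAdd K a = seriesEval a (logSeries K) := by
  ext n
  rw [flogOneAdd, seriesEval, coeff_mk, coeff_mk, Finset.sum_range_succ', ← Finset.sum_image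
    (s := Finset.range n) (g := fun k => k + 1) (f := fun k => coeff k (logSeries K) •
      coeff n (a ^ k)) (by intro x _ y _; simp)]
  have : (Finset.range n).image (fun k => k + 1) = Finset.Icc 1 n := by
    ext k; simp only [Finset.mem_image, Finset.mem_range, Finset.mem_Icc]
    exact ⟨by rintro ⟨x, hx, rfl⟩; omega, fun h => ⟨k - 1, by omega, by omega⟩⟩
  rw [this]
  simp [logSeries]

lemma derivative_seriesEval {a : K⟦X⟧} (h : (X : K⟦X⟧) ∣ a) (f : K⟦X⟧) :
    d⁄dX K (seriesEval a f) = seriesEval a (d⁄dX K f) * d⁄dX K a := by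
  refine ext_of_X_pow_dvd fun n => ?_
  -- Differentiation lowers the order in X by one, hence the truncation at n + 1.
  have h1 := X_pow_dvd_seriesEval_sub h f (n + 1)
  have h2 := X_pow_dvd_seriesEval_sub h (d⁄dX K f) n
  have h3 : (X : K⟦X⟧) ^ n ∣
      d⁄dX K (seriesEval a f - Polynomial.aeval a (trunc (n + 1) f)) := by
    rw [X_pow_dvd_iff] at h1 ⊢
    intro m hm
    rw [coeff_derivative, h1 _ (by omega), zero_mul]
  rw [map_sub, Derivation.map_aeval, ← trunc_derivative, smul_eq_mul] at h3
  have e := dvd_sub h3 (h2.mul_right (d⁄dX K a))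
  ring_nf at e ⊢
  exact e

lemma derivative_expSeries [CharZero K] : d⁄dX K (expSeries K) = expSeries K := by
  ext n
  rw [coeff_derivative, expSeries, coeff_mk, coeff_mk, Nat.factorial_succ]
  have : ((n : K) + 1) ≠ 0 := by exact_mod_cast n.succ_ne_zero
  push_cast
  rw [mul_inv]
  field_simp

lemma one_add_X_mul_derivative_logSeries [CharZero K] : (1 + X) * d⁄dX K (logSeries K) = 1 := by
  have hc : ∀ n, coeff n (d⁄dX K (logSeries K)) = (-1) ^ n := by
    intro n
    have : ((n : K) + 1) ≠ 0 := by exact_mod_cast n.succ_ne_zero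
    rw [coeff_derivative, logSeries, coeff_mk]
    push_cast
    field_simp
    ring
  ext n
  rcases n with _ | n
  · rw [add_mul, one_mul, map_add, hc, coeff_zero_X_mul]; simp
  · rw [add_mul, one_mul, map_add, coeff_succ_X_mul, hc, hc, coeff_one, if_neg (by omega)]
    ring

lemma X_dvd_logSeries : (X : K⟦X⟧) ∣ logSeries K := by
  -- The constant coefficient contains the inverse of 0, which is 0 by convention.
  rw [X_dvd_iff]; simp [logSeries]

lemma X_dvd_expSeries_sub_one : (X : K⟦X⟧) ∣ expSeries K - 1 := by
  rw [X_dvd_iff]; simp [expSeries]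

lemma constantCoeff_seriesEval (a : A⟦X⟧) (f : K⟦X⟧) :
    constantCoeff (seriesEval a f) = constantCoeff f • (1 : A) := by
  rw [← coeff_zero_eq_constantCoeff_apply]; simp [seriesEval]

/-- Let y be the left side and u the derivative of the logarithm. Then y' = y u and u' = -u², so y u
has derivative zero and constant term one. Multiplying y u = 1 by 1 + X = 1/u gives y. -/
lemma seriesEval_log_exp [CharZero K] : seriesEval (logSeries K) (expSeries K) = 1 + X := by
  set y := seriesEval (logSeries K) (expSeries K) with hy
  have dy : d⁄dX K y = y * d⁄dX K (logSeries K) := by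
    rw [hy, derivative_seriesEval X_dvd_logSeries, derivative_expSeries]
  have hl := one_add_X_mul_derivative_logSeries (K := K)
  set u := d⁄dX K (logSeries K) with hu
  have du : d⁄dX K u = - u ^ 2 := by
    have h := congrArg (d⁄dX K) hl
    rw [Derivation.leibniz, map_add, derivative_one, derivative_X, zero_add, smul_eq_mul,
      smul_eq_mul, mul_one] at h
    have : u * ((1 + X) * d⁄dX K u + u) = 0 := by rw [h]; simp
    linear_combination this - (d⁄dX K u) * hl
  have : y * u = 1 := by
    refine derivative.ext ?_ ?_
    · rw [Derivation.leibniz, dy, du, smul_eq_mul, smul_eq_mul, derivative_one]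
      ring
    · have h0 : constantCoeff u = 1 := by
        have := congrArg constantCoeff hl
        simpa using this
      rw [map_mul, h0, hy, constantCoeff_seriesEval]
      simp [expSeries]
  linear_combination (1 + X) * this - y * hl

lemma seriesEval_exp_log [CharZero K] : seriesEval (expSeries K - 1) (logSeries K) = X := by
  refine derivative.ext ?_ ?_
  · rw [derivative_seriesEval X_dvd_expSeries_sub_one, map_sub, derivative_expSeries,
      derivative_one, sub_zero, derivative_X]
    have h := congrArg (seriesEvalHom (expSeries K - 1) X_dvd_expSeries_sub_one)
      (one_add_X_mul_derivative_logSeries (K := K))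
    rw [map_mul, map_add, map_one, seriesEvalHom_apply, seriesEvalHom_apply,
      seriesEval_X X_dvd_expSeries_sub_one] at h
    linear_combination h
  · rw [constantCoeff_seriesEval]
    simp [logSeries]

lemma X_dvd_seriesEval {a : A⟦X⟧} {f : K⟦X⟧} (h : (X : K⟦X⟧) ∣ f) :
    (X : A⟦X⟧) ∣ seriesEval a f := by
  rw [X_dvd_iff, constantCoeff_seriesEval, X_dvd_iff.1 h, zero_smul]

/-! ### The formal exponential and logarithm -/

lemma X_dvd_flogOneAdd (a : A⟦X⟧) : (X : A⟦X⟧) ∣ flogOneAdd K a := by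
  rw [flogOneAdd_eq_seriesEval]; exact X_dvd_seriesEval X_dvd_logSeries

lemma map_fexp {Ψ : A⟦X⟧ →ₐ[K] B⟦X⟧} (hΨ : Ψ X = X) {a : A⟦X⟧} (h : (X : A⟦X⟧) ∣ a) :
    Ψ (fexp K a) = fexp K (Ψ a) := by
  rw [fexp_eq_seriesEval, fexp_eq_seriesEval, map_seriesEval (by rw [hΨ]) h]

lemma map_flogOneAdd {Ψ : A⟦X⟧ →ₐ[K] B⟦X⟧} (hΨ : Ψ X = X) {a : A⟦X⟧} (h : (X : A⟦X⟧) ∣ a) :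
    Ψ (flogOneAdd K a) = flogOneAdd K (Ψ a) := by
  rw [flogOneAdd_eq_seriesEval, flogOneAdd_eq_seriesEval, map_seriesEval (by rw [hΨ]) h]

lemma semiconjBy_fexp {g a b : A⟦X⟧} (ha : (X : A⟦X⟧) ∣ a) (hb : (X : A⟦X⟧) ∣ b)
    (h : SemiconjBy g a b) : SemiconjBy g (fexp K a) (fexp K b) := by
  rw [fexp_eq_seriesEval, fexp_eq_seriesEval]; exact semiconjBy_seriesEval ha hb h _

lemma semiconjBy_flogOneAdd {g a b : A⟦X⟧} (ha : (X : A⟦X⟧) ∣ a) (hb : (X : A⟦X⟧) ∣ b)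
    (h : SemiconjBy g a b) : SemiconjBy g (flogOneAdd K a) (flogOneAdd K b) := by
  rw [flogOneAdd_eq_seriesEval, flogOneAdd_eq_seriesEval]; exact semiconjBy_seriesEval ha hb h _

lemma fexp_flogOneAdd [CharZero K] {a : A⟦X⟧} (h : (X : A⟦X⟧) ∣ a) : fexp K (flogOneAdd K a) = 1 + a := by
  have := map_seriesEval (Ψ := seriesEvalHom a h) (by rw [seriesEvalHom_apply, seriesEval_X h]; exact h)
    X_dvd_logSeries (expSeries K)
  rw [fexp_eq_seriesEval, flogOneAdd_eq_seriesEval, ← seriesEvalHom_apply a h, ← this,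
    seriesEval_log_exp, map_add, map_one, seriesEvalHom_apply, seriesEval_X h]

lemma flogOneAdd_fexp_sub_one [CharZero K] {a : A⟦X⟧} (h : (X : A⟦X⟧) ∣ a) :
    flogOneAdd K (fexp K a - 1) = a := by
  have := map_seriesEval (Ψ := seriesEvalHom a h) (by rw [seriesEvalHom_apply, seriesEval_X h]; exact h)
    X_dvd_expSeries_sub_one (logSeries K)
  rw [map_sub, map_one] at this
  rw [fexp_eq_seriesEval, flogOneAdd_eq_seriesEval, ← seriesEvalHom_apply a h, ← this,
    seriesEval_exp_log, seriesEvalHom_apply, seriesEval_X h]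

lemma fexp_zero : fexp K (0 : A⟦X⟧) = 1 := by
  have h : (X : A⟦X⟧) ∣ 0 := dvd_zero _
  ext n
  rw [fexp, coeff_mk, Finset.sum_range_succ']
  simp

lemma X_pow_dvd_fexp_sub {a : A⟦X⟧} (h : (X : A⟦X⟧) ∣ a) (n : ℕ) :
    (X : A⟦X⟧) ^ n ∣ fexp K a - ∑ k ∈ Finset.range n, ((k.factorial : K)⁻¹) • a ^ k := by
  have := X_pow_dvd_seriesEval_sub h (expSeries K) n
  rw [← fexp_eq_seriesEval] at this
  rw [aeval_trunc] at this
  simpa [expSeries] using this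

lemma fexp_add [CharZero K] {a b : A⟦X⟧} (ha : (X : A⟦X⟧) ∣ a) (hb : (X : A⟦X⟧) ∣ b) (h : Commute a b) :
    fexp K (a + b) = fexp K a * fexp K b := by
  refine ext_of_X_pow_dvd fun n => ?_
  set p : A⟦X⟧ → A⟦X⟧ := fun a => ∑ k ∈ Finset.range n, ((k.factorial : K)⁻¹) • a ^ k with hp
  have h1 : (X : A⟦X⟧) ^ n ∣ fexp K (a + b) - p (a + b) := X_pow_dvd_fexp_sub (dvd_add ha hb) n
  have h2 : (X : A⟦X⟧) ^ n ∣ fexp K a - p a := X_pow_dvd_fexp_sub ha n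
  have h3 : (X : A⟦X⟧) ^ n ∣ fexp K b - p b := X_pow_dvd_fexp_sub hb n
  -- The product of truncations is a sum over the square i, j < n. Its part with i + j < n is the
  -- truncation for a + b by the binomial theorem; the rest consists of multiples of a^i b^j with i
  -- + j ≥ n.
  have h4 : (X : A⟦X⟧) ^ n ∣ p a * p b - p (a + b) := by
    set f : ℕ × ℕ → A⟦X⟧ := fun q =>
      ((q.1.factorial : K)⁻¹ * (q.2.factorial : K)⁻¹) • (a ^ q.1 * b ^ q.2) with hf
    have e1 : p a * p b = ∑ q ∈ Finset.range n ×ˢ Finset.range n, f q := by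
      rw [hp, Finset.sum_mul_sum, Finset.sum_product]
      simp only [hf, smul_mul_smul_comm]
    have e2 : p (a + b) = ∑ q ∈ (Finset.range n ×ˢ Finset.range n).filter
        (fun q => q.1 + q.2 < n), f q := by
      rw [← Finset.sum_fiberwise_of_maps_to (t := Finset.range n) (g := fun q => q.1 + q.2)
        (by intro q hq; simpa using (Finset.mem_filter.1 hq).2)]
      refine Finset.sum_congr rfl fun k hk => ?_
      rw [h.add_pow', Finset.smul_sum]
      have hk := Finset.mem_range.1 hk
      have : ((Finset.range n ×ˢ Finset.range n).filter (fun q => q.1 + q.2 < n)).filter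
          (fun q => q.1 + q.2 = k) = Finset.HasAntidiagonal.antidiagonal k := by
        ext ⟨i, j⟩
        simp only [Finset.mem_filter, Finset.mem_product, Finset.mem_range,
          Finset.HasAntidiagonal.mem_antidiagonal]
        omega
      rw [this]
      refine Finset.sum_congr rfl fun q hq => ?_
      have hq := Finset.HasAntidiagonal.mem_antidiagonal.1 hq
      rw [hf, ← Nat.cast_smul_eq_nsmul K, smul_smul]
      congr 1
      subst hq
      have := Nat.add_choose_mul_factorial_mul_factorial q.1 q.2
      have h1 : (q.1.factorial : K) ≠ 0 := by exact_mod_cast q.1.factorial_ne_zero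
      have h2 : (q.2.factorial : K) ≠ 0 := by exact_mod_cast q.2.factorial_ne_zero
      have h3 : ((q.1 + q.2).factorial : K) ≠ 0 := by exact_mod_cast (q.1 + q.2).factorial_ne_zero
      field_simp
      rw [Nat.choose_symm_add]
      exact_mod_cast this
    rw [e1, e2, ← Finset.sum_filter_add_sum_filter_not _ (fun q => q.1 + q.2 < n),
      add_sub_cancel_left]
    refine Finset.dvd_sum fun q hq => ?_
    have hq := (Finset.mem_filter.1 hq).2
    obtain ⟨c, hc⟩ := X_pow_dvd_pow ha q.1
    obtain ⟨d, hd⟩ := X_pow_dvd_pow hb q.2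
    refine Dvd.dvd.trans (pow_dvd_pow _ (not_lt.1 hq))
      ⟨((q.1.factorial : K)⁻¹ * (q.2.factorial : K)⁻¹) • (c * d), ?_⟩
    rw [hf]
    simp only
    rw [hc, hd, mul_smul_comm, pow_add]
    congr 1
    rw [mul_assoc, mul_assoc, ← mul_assoc c, (commute_X_pow c q.2).eq, mul_assoc]
  have e : fexp K (a + b) - fexp K a * fexp K b =
      (fexp K (a + b) - p (a + b)) - (p a * p b - p (a + b))
        - ((fexp K a - p a) * fexp K b + p a * (fexp K b - p b)) := by noncomm_ring
  rw [e]
  exact dvd_sub (dvd_sub h1 h4) (dvd_add (h2.mul_right _) (X_pow_dvd_mul_left h3 _))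

lemma isUnit_fexp [CharZero K] {a : A⟦X⟧} (h : (X : A⟦X⟧) ∣ a) : IsUnit (fexp K a) := by
  refine ⟨⟨fexp K a, fexp K (-a), ?_, ?_⟩, rfl⟩
  · rw [← fexp_add h ((dvd_neg).2 h) (Commute.neg_right (Commute.refl a)), add_neg_cancel,
      fexp_zero]
  · rw [← fexp_add ((dvd_neg).2 h) h (Commute.neg_left (Commute.refl a)), neg_add_cancel,
      fexp_zero]

/-- Conjugation of `z` by `exp a` when the iterated commutators of `a` and `z` are `w`, `2 v`, `0`. -/
lemma fexp_mul_of_lie [CharZero K] {a z w v : A⟦X⟧} (ha : (X : A⟦X⟧) ∣ a) (hz : a * z = z * a + w)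
    (hw : a * w = w * a + 2 * v) (hv : Commute a v) :
    fexp K a * z = (z + w + v) * fexp K a := by
  set p : ℕ → A⟦X⟧ := fun n => ∑ k ∈ Finset.range n, ((k.factorial : K)⁻¹) • a ^ k with hp
  -- With m = n + 2 the coefficients are m and m(m - 1): the 2 in `hw` cancels the 1/2 of the
  -- binomial coefficient. Division by m! then shifts the truncation order by one for w and by two
  -- for v, as recorded in `hS`.
  have hpow : ∀ n : ℕ, a ^ (n + 2) * z = z * a ^ (n + 2) + (n + 2 : K) • (w * a ^ (n + 1))
      + ((n + 2 : K) * (n + 1)) • (v * a ^ n) := by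
    have hw' : ∀ n : ℕ, a ^ (n + 1) * w = w * a ^ (n + 1) + (2 * (n + 1) : K) • (v * a ^ n) := by
      intro n
      induction n with
      | zero => simp [hw, two_smul, two_mul]
      | succ n ih =>
        rw [pow_succ' a (n + 1), mul_assoc, ih, mul_add, mul_smul_comm, ← mul_assoc, hw,
          ← mul_assoc a v, hv.eq, add_mul, mul_assoc w, ← pow_succ', mul_assoc v a, ← pow_succ',
          two_mul, add_mul]
        push_cast
        module
    intro n
    induction n with
    | zero =>
      rw [pow_succ', pow_one, mul_assoc, hz, mul_add, ← mul_assoc, hz, hw]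
      simp only [Nat.cast_zero, zero_add, pow_zero, mul_one, add_mul, mul_assoc]
      rw [two_mul]
      module
    | succ n ih =>
      rw [pow_succ a (n + 2), mul_assoc, hz, mul_add, hw' (n + 1), ← mul_assoc, ih]
      simp only [add_mul, smul_mul_assoc, mul_assoc, ← pow_succ]
      push_cast
      module
  have hS : ∀ n : ℕ, p (n + 2) * z = z * p (n + 2) + w * p (n + 1) + v * p n := by
    intro n
    induction n with
    | zero => simp [hp, Finset.sum_range_succ, add_mul, mul_add, hz, add_assoc]
    | succ n ih =>
      have e : ∀ n, p (n + 1) = p n + ((n.factorial : K)⁻¹) • a ^ n := fun n =>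
        Finset.sum_range_succ _ _
      rw [e (n + 2), add_mul, ih, smul_mul_assoc, hpow, e (n + 1), e n]
      have h1 : ((n : K) + 1) ≠ 0 := by exact_mod_cast n.succ_ne_zero
      have h2 : ((n : K) + 2) ≠ 0 := by exact_mod_cast (n + 1).succ_ne_zero
      have h3 : (n.factorial : K) ≠ 0 := by exact_mod_cast n.factorial_ne_zero
      have f2 : (((n + 2).factorial : K)⁻¹) = ((n + 2 : K)⁻¹ * (n + 1 : K)⁻¹) *
          (n.factorial : K)⁻¹ := by
        rw [Nat.factorial_succ, Nat.factorial_succ]; push_cast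
        rw [mul_inv, mul_inv]; ring
      have f1 : (((n + 1).factorial : K)⁻¹) = (n + 1 : K)⁻¹ * (n.factorial : K)⁻¹ := by
        rw [Nat.factorial_succ]; push_cast
        rw [mul_inv]
      rw [f2, f1]
      simp only [smul_add, mul_add z, mul_add w, mul_add v, mul_smul_comm, smul_smul]
      have c1 : ((n + 2 : K)⁻¹ * (n + 1 : K)⁻¹) * (n.factorial : K)⁻¹ * (n + 2) =
          (n + 1 : K)⁻¹ * (n.factorial : K)⁻¹ := by field_simp
      have c2 : ((n + 2 : K)⁻¹ * (n + 1 : K)⁻¹) * (n.factorial : K)⁻¹ * ((n + 2) * (n + 1)) =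
          (n.factorial : K)⁻¹ := by field_simp
      rw [c1, c2]
      abel
  refine ext_of_X_pow_dvd fun n => ?_
  have d0 : (X : A⟦X⟧) ^ n ∣ fexp K a - p n := X_pow_dvd_fexp_sub ha n
  have d1 : (X : A⟦X⟧) ^ n ∣ fexp K a - p (n + 1) :=
    (pow_dvd_pow _ (by omega)).trans (X_pow_dvd_fexp_sub ha (n + 1))
  have d2 : (X : A⟦X⟧) ^ n ∣ fexp K a - p (n + 2) :=
    (pow_dvd_pow _ (by omega)).trans (X_pow_dvd_fexp_sub ha (n + 2))
  have e : fexp K a * z - (z + w + v) * fexp K a =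
      (fexp K a - p (n + 2)) * z - z * (fexp K a - p (n + 2)) - w * (fexp K a - p (n + 1))
        - v * (fexp K a - p n) := by
    have := hS n
    simp only [sub_mul, mul_sub, add_mul, this]
    abel
  rw [e]
  exact dvd_sub (dvd_sub (dvd_sub (d2.mul_right _) (X_pow_dvd_mul_left d2 _))
    (X_pow_dvd_mul_left d1 _)) (X_pow_dvd_mul_left d0 _)

lemma fexp_list_sum [CharZero K] {ι : Type*} (l : List ι) (t : ι → A⟦X⟧) (ht : ∀ i, (X : A⟦X⟧) ∣ t i)
    (hc : ∀ i ∈ l, ∀ j ∈ l, Commute (t i) (t j)) :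
    (l.map fun i => fexp K (t i)).prod = fexp K (l.map t).sum := by
  induction l with
  | nil => simp [fexp_zero]
  | cons i l ih =>
    have hd : (X : A⟦X⟧) ∣ (l.map t).sum := List.dvd_sum (by
      intro x hx; obtain ⟨j, _, rfl⟩ := List.mem_map.1 hx; exact ht j)
    rw [List.map_cons, List.prod_cons, ih (fun i hi j hj => hc i (List.mem_cons_of_mem _ hi) j
      (List.mem_cons_of_mem _ hj)), List.map_cons, List.sum_cons, fexp_add (ht i) hd]
    refine Commute.list_sum_right _ _ fun x hx => ?_
    obtain ⟨j, hj, rfl⟩ := List.mem_map.1 hx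
    exact hc i List.mem_cons_self j (List.mem_cons_of_mem _ hj)

end SeriesEval

/-! ### The standard filtration of `U(g)`, primitive elements and injectivity -/

section Enveloping

open UniversalEnvelopingAlgebra

variable {K : Type*} [Field K] {g : Type*} [LieRing g] [LieAlgebra K g]

lemma comul_ι (x : g) : comul K g (ι K x) = ι K x ⊗ₜ[K] 1 + 1 ⊗ₜ[K] ι K x := by
  rw [comul, lift_ι_apply]; rfl

lemma counit_ι (x : g) : counit K g (ι K x) = 0 := by
  rw [counit, lift_ι_apply]; rfl

instance : Nontrivial (U K g) := (counit K g).toRingHom.domain_nontrivial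

/-- By the universal property, the identity of U(g) factors through the subalgebra generated by g.
-/
lemma mem_adjoin_range_ι (u : U K g) : u ∈ Algebra.adjoin K (Set.range (ι K : g → U K g)) := by
  let S := Algebra.adjoin K (Set.range (ι K : g → U K g))
  let j : g →ₗ⁅K⁆ S :=
    { toFun := fun x => ⟨ι K x, Algebra.subset_adjoin ⟨x, rfl⟩⟩
      map_add' := fun x y => Subtype.ext (by simp)
      map_smul' := fun c x => Subtype.ext (by simp)
      map_lie' := fun {x y} => Subtype.ext (LieHom.map_lie (ι K) x y) }
  have h : S.val.comp (lift K j) = AlgHom.id K (U K g) := by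
    ext x
    simp [j]
  have := DFunLike.congr_fun h u
  simp only [AlgHom.coe_comp, Function.comp_apply, AlgHom.coe_id, id_eq] at this
  rw [← this]
  exact (lift K j u).2

variable (K g) in
/-- The elements of filtration degree at most one. -/
def degLeOne : Submodule K (U K g) := 1 ⊔ LinearMap.range (ι K : g →ₗ⁅K⁆ U K g).toLinearMap

lemma one_le_degLeOne : (1 : Submodule K (U K g)) ≤ degLeOne K g := le_sup_left

lemma ι_mem_degLeOne (x : g) : ι K x ∈ degLeOne K g :=
  Submodule.mem_sup_right ⟨x, rfl⟩

lemma mem_degLeOne {u : U K g} (h : u ∈ degLeOne K g) :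
    ∃ (c : K) (x : g), u = c • (1 : U K g) + ι K x := by
  obtain ⟨a, ha, b, ⟨x, rfl⟩, rfl⟩ := Submodule.mem_sup.1 h
  obtain ⟨c, rfl⟩ := Submodule.mem_one.1 ha
  exact ⟨c, x, by rw [Algebra.algebraMap_eq_smul_one]; rfl⟩

lemma degLeOne_pow_mono {m n : ℕ} (h : m ≤ n) : degLeOne K g ^ m ≤ degLeOne K g ^ n :=
  pow_le_pow_right' one_le_degLeOne h

lemma ι_mul_mem {n : ℕ} {u : U K g} (x : g) (h : u ∈ degLeOne K g ^ n) :
    ι K x * u ∈ degLeOne K g ^ (n + 1) := by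
  rw [pow_succ']; exact Submodule.mul_mem_mul (ι_mem_degLeOne x) h

lemma one_mem_degLeOne_pow (n : ℕ) : (1 : U K g) ∈ degLeOne K g ^ n :=
  degLeOne_pow_mono (Nat.zero_le n) (by rw [pow_zero]; exact Submodule.one_le.1 le_rfl)

lemma exists_mem_degLeOne_pow (u : U K g) : ∃ n, u ∈ degLeOne K g ^ n := by
  induction mem_adjoin_range_ι u using Algebra.adjoin_induction with
  | mem x hx =>
    obtain ⟨y, rfl⟩ := hx
    exact ⟨1, by rw [pow_one]; exact ι_mem_degLeOne y⟩
  | algebraMap r =>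
    exact ⟨0, by rw [pow_zero]; exact Submodule.mem_one.2 ⟨r, rfl⟩⟩
  | add x y _ _ hx hy =>
    obtain ⟨m, hm⟩ := hx
    obtain ⟨n, hn⟩ := hy
    exact ⟨max m n, add_mem (degLeOne_pow_mono (le_max_left _ _) hm)
      (degLeOne_pow_mono (le_max_right _ _) hn)⟩
  | mul x y _ _ hx hy =>
    obtain ⟨m, hm⟩ := hx
    obtain ⟨n, hn⟩ := hy
    exact ⟨m + n, by rw [pow_add]; exact Submodule.mul_mem_mul hm hn⟩

/-- Induction over the filtration degree. -/
lemma degLeOne_pow_induction {p : ℕ → U K g → Prop}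
    (zero : ∀ c : K, p 0 (c • (1 : U K g)))
    (add : ∀ n u v, p n u → p n v → p n (u + v))
    (smul : ∀ n (c : K) u, p n u → p (n + 1) (c • u))
    (mul : ∀ n (x : g) u, u ∈ degLeOne K g ^ n → p n u → p (n + 1) (ι K x * u))
    {n : ℕ} {u : U K g} (h : u ∈ degLeOne K g ^ n) : p n u := by
  induction n generalizing u with
  | zero =>
    rw [pow_zero] at h
    obtain ⟨c, rfl⟩ := Submodule.mem_one.1 h
    rw [Algebra.algebraMap_eq_smul_one]
    exact zero c
  | succ n ih =>
    rw [pow_succ'] at h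
    induction h using Submodule.mul_induction_on' with
    | mem_mul_mem w hw v hv =>
      obtain ⟨c, x, rfl⟩ := mem_degLeOne hw
      rw [add_mul, smul_mul_assoc, one_mul]
      exact add _ _ _ (smul _ _ _ (ih hv)) (mul _ _ _ hv (ih hv))
    | add a _ b _ ha hb => exact add _ _ _ ha hb

/-- The commutator with x is a derivation that preserves g, so it does not raise the degree, whereas
multiplication by x raises it by one. -/
lemma lie_ι_mem {n : ℕ} {u : U K g} (h : u ∈ degLeOne K g ^ n) (x : g) :
    u * ι K x - ι K x * u ∈ degLeOne K g ^ n := by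
  refine degLeOne_pow_induction (p := fun n u => u * ι K x - ι K x * u ∈ degLeOne K g ^ n) ?_ ?_ ?_ ?_ h
  · intro c
    simp
  · intro n u v hu hv
    have : (u + v) * ι K x - ι K x * (u + v) = (u * ι K x - ι K x * u) + (v * ι K x - ι K x * v) := by
      noncomm_ring
    rw [this]; exact add_mem hu hv
  · intro n c u hu
    have : (c • u) * ι K x - ι K x * (c • u) = c • (u * ι K x - ι K x * u) := by
      rw [smul_mul_assoc, mul_smul_comm, smul_sub]
    rw [this]; exact Submodule.smul_mem _ _ (degLeOne_pow_mono (Nat.le_succ n) hu)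
  · intro n y u hm hu
    have : ι K y * u * ι K x - ι K x * (ι K y * u) =
        ι K y * (u * ι K x - ι K x * u) + ι K ⁅y, x⁆ * u := by
      rw [LieHom.map_lie, LieRing.of_associative_ring_bracket]; noncomm_ring
    rw [this]; exact add_mem (ι_mul_mem _ hu) (ι_mul_mem _ hm)

variable (K g) in
/-- The tensors of total filtration degree at most `n`. -/
def tensorDegLe (n : ℕ) : Submodule K (U K g ⊗[K] U K g) :=
  Submodule.span K {t | ∃ i j, i + j ≤ n ∧ ∃ a ∈ degLeOne K g ^ i, ∃ b ∈ degLeOne K g ^ j,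
    t = a ⊗ₜ[K] b}

lemma tensorDegLe_mono {m n : ℕ} (h : m ≤ n) : tensorDegLe K g m ≤ tensorDegLe K g n :=
  Submodule.span_mono fun _ ⟨i, j, hij, r⟩ => ⟨i, j, hij.trans h, r⟩

lemma comul_ι_mul_mem_tensorDegLe {n : ℕ} {t : U K g ⊗[K] U K g} (x : g)
    (h : t ∈ tensorDegLe K g n) : comul K g (ι K x) * t ∈ tensorDegLe K g (n + 1) := by
  induction h using Submodule.span_induction with
  | mem t h =>
    obtain ⟨i, j, hij, a, ha, b, hb, rfl⟩ := h
    rw [comul_ι, add_mul, Algebra.TensorProduct.tmul_mul_tmul,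
      Algebra.TensorProduct.tmul_mul_tmul, one_mul, one_mul]
    exact add_mem
      (Submodule.subset_span ⟨i + 1, j, by omega, _, ι_mul_mem x ha, _, hb, rfl⟩)
      (Submodule.subset_span ⟨i, j + 1, by omega, _, ha, _, ι_mul_mem x hb, rfl⟩)
  | zero => rw [mul_zero]; exact zero_mem _
  | add s t _ _ hs ht => rw [mul_add]; exact add_mem hs ht
  | smul c t _ ht => rw [mul_smul_comm]; exact Submodule.smul_mem _ _ ht

lemma comul_mem_tensorDegLe {n : ℕ} {u : U K g} (h : u ∈ degLeOne K g ^ n) :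
    comul K g u ∈ tensorDegLe K g n := by
  refine degLeOne_pow_induction (p := fun n u => comul K g u ∈ tensorDegLe K g n) ?_ ?_ ?_ ?_ h
  · intro c
    rw [map_smul, map_one]
    exact Submodule.smul_mem _ _ (Submodule.subset_span
      ⟨0, 0, by omega, 1, one_mem_degLeOne_pow 0, 1, one_mem_degLeOne_pow 0, rfl⟩)
  · intro n u v hu hv
    rw [map_add]; exact add_mem hu hv
  · intro n c u hu
    rw [map_smul]; exact Submodule.smul_mem _ _ (tensorDegLe_mono (Nat.le_succ n) hu)
  · intro n x u _ hu
    rw [map_mul]; exact comul_ι_mul_mem_tensorDegLe x hu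

/-- The map `a ⊗ b ↦ (a x - x a) b`. -/
def commMul (x : g) : U K g ⊗[K] U K g →ₗ[K] U K g :=
  LinearMap.mul' K (U K g) ∘ₗ
    TensorProduct.map (LinearMap.mulRight K (ι K x) - LinearMap.mulLeft K (ι K x)) LinearMap.id

lemma commMul_mem {n : ℕ} {t : U K g ⊗[K] U K g} (x : g) (h : t ∈ tensorDegLe K g n) :
    commMul x t ∈ degLeOne K g ^ n := by
  induction h using Submodule.span_induction with
  | mem t h =>
    obtain ⟨i, j, hij, a, ha, b, hb, rfl⟩ := h
    have := Submodule.mul_mem_mul (lie_ι_mem ha x) hb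
    rw [← pow_add] at this
    simpa [commMul] using degLeOne_pow_mono hij this
  | zero => rw [map_zero]; exact zero_mem _
  | add s t _ _ hs ht => rw [map_add]; exact add_mem hs ht
  | smul c t _ ht => rw [map_smul]; exact Submodule.smul_mem _ _ ht

/-- The factor x may enter either leg. In the second leg it has to be moved to the left past the
first one, which costs a commutator of no higher degree than t. -/
lemma mul'_comul_ι_mul (x : g) (t : U K g ⊗[K] U K g) :
    LinearMap.mul' K (U K g) (comul K g (ι K x) * t) =
      (2 : K) • (ι K x * LinearMap.mul' K (U K g) t) + commMul x t := by
  induction t using TensorProduct.induction_on with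
  | zero => simp
  | tmul a b =>
    simp only [comul_ι, add_mul, Algebra.TensorProduct.tmul_mul_tmul, map_add,
      LinearMap.mul'_apply, commMul, LinearMap.comp_apply, TensorProduct.map_tmul,
      LinearMap.sub_apply, LinearMap.mulRight_apply, LinearMap.mulLeft_apply, LinearMap.id_apply,
      two_smul, one_mul]
    noncomm_ring
  | add s t hs ht => rw [mul_add, map_add, hs, ht, map_add, map_add, mul_add, smul_add]; abel

/-- In a product of n elements of g each factor can go to either of two legs, and multiplying back
gives the same product up to reordering, that is up to lower degree. A primitive element is
multiplied by 2 instead, which limits its degree. -/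
lemma mul'_comul_sub_mem {n : ℕ} {u : U K g} (h : u ∈ degLeOne K g ^ n) :
    LinearMap.mul' K (U K g) (comul K g u) - (2 ^ n : K) • u ∈ degLeOne K g ^ (n - 1) := by
  have aux : ∀ {n : ℕ} {u : U K g}, u ∈ degLeOne K g ^ n →
      LinearMap.mul' K (U K g) (comul K g u) - (2 ^ n : K) • u ∈ degLeOne K g ^ (n - 1) →
      LinearMap.mul' K (U K g) (comul K g u) ∈ degLeOne K g ^ n := fun {n} {u} hm h => by
    simpa using add_mem (degLeOne_pow_mono (Nat.sub_le _ 1) h) (Submodule.smul_mem _ (2 ^ n : K) hm)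
  have key : u ∈ degLeOne K g ^ n ∧
      LinearMap.mul' K (U K g) (comul K g u) - (2 ^ n : K) • u ∈ degLeOne K g ^ (n - 1) := by
    refine degLeOne_pow_induction (p := fun n u => u ∈ degLeOne K g ^ n ∧
      LinearMap.mul' K (U K g) (comul K g u) - (2 ^ n : K) • u ∈ degLeOne K g ^ (n - 1)) ?_ ?_ ?_ ?_ h
    · intro c
      refine ⟨Submodule.smul_mem _ _ (one_mem_degLeOne_pow 0), ?_⟩
      simp [Algebra.TensorProduct.one_def]
    · intro n u v hu hv
      refine ⟨add_mem hu.1 hv.1, ?_⟩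
      rw [map_add, map_add, smul_add, add_sub_add_comm]
      exact add_mem hu.2 hv.2
    · intro n c u hu
      refine ⟨Submodule.smul_mem _ _ (degLeOne_pow_mono (Nat.le_succ n) hu.1), ?_⟩
      rw [map_smul, map_smul]
      exact sub_mem (Submodule.smul_mem _ _ (aux hu.1 hu.2))
        (Submodule.smul_mem _ _ (Submodule.smul_mem _ _ hu.1))
    · intro n x u hm hu
      refine ⟨ι_mul_mem x hm, ?_⟩
      have e : LinearMap.mul' K (U K g) (comul K g (ι K x * u)) - (2 ^ (n + 1) : K) • (ι K x * u) =
          (2 : K) • (ι K x * (LinearMap.mul' K (U K g) (comul K g u) - (2 ^ n : K) • u))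
            + commMul x (comul K g u) := by
        rw [map_mul, mul'_comul_ι_mul, mul_sub, smul_sub, mul_smul_comm, smul_smul, ← pow_succ']
        abel
      rw [e]
      refine add_mem (Submodule.smul_mem _ _ ?_) (commMul_mem x (comul_mem_tensorDegLe hm))
      -- For n = 0 the truncated difference n - 1 is again 0 and the induction hypothesis is too
      -- weak; but for scalars the difference vanishes exactly.
      rcases n with _ | n
      · have h0 := hm
        rw [pow_zero] at h0
        obtain ⟨c, rfl⟩ := Submodule.mem_one.1 h0
        rw [Algebra.algebraMap_eq_smul_one]
        simp [Algebra.TensorProduct.one_def]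
      · exact ι_mul_mem x hu.2
  exact key.2

/-- Friedrichs' theorem: the primitive elements of `U(g)` in characteristic zero. -/
lemma exists_ι_of_primitive [CharZero K] {u : U K g}
    (h : comul K g u = u ⊗ₜ[K] 1 + 1 ⊗ₜ[K] u) : ∃ x : g, u = ι K x := by
  obtain ⟨n, hn⟩ := exists_mem_degLeOne_pow u
  have hm : LinearMap.mul' K (U K g) (comul K g u) = (2 : K) • u := by
    rw [h]; simp [two_smul]
  -- Multiplication after Δ acts on u exactly as 2 and, up to lower degree, as a power of 2 with
  -- exponent at least two. The two numbers differ in characteristic zero, so the degree of u can be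
  -- lowered until it is one.
  have key : ∀ n, u ∈ degLeOne K g ^ n → u ∈ degLeOne K g := by
    intro n
    induction n with
    | zero => exact fun h => by simpa using degLeOne_pow_mono (Nat.zero_le 1) h
    | succ n ih =>
      intro h
      rcases n with _ | n
      · simpa using h
      · refine ih ?_
        have := mul'_comul_sub_mem h
        rw [hm, ← sub_smul] at this
        have hne : (2 - 2 ^ (n + 1 + 1) : K) ≠ 0 := by
          have : (2 : ℕ) < 2 ^ (n + 1 + 1) := by
            calc 2 = 2 ^ 1 := rfl
              _ < 2 ^ (n + 1 + 1) := Nat.pow_lt_pow_right (by norm_num) (by omega)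
          have h2 : ((2 : ℕ) : K) ≠ ((2 ^ (n + 1 + 1) : ℕ) : K) := by exact_mod_cast this.ne
          push_cast at h2
          exact sub_ne_zero.2 h2
        have h3 := Submodule.smul_mem _ (2 - 2 ^ (n + 1 + 1) : K)⁻¹ this
        rwa [smul_smul, inv_mul_cancel₀ hne, one_smul] at h3
  obtain ⟨c, x, rfl⟩ := mem_degLeOne (key n hn)
  refine ⟨x, ?_⟩
  -- On c + x multiplication after Δ gives c + 2x, whereas primitivity asks for 2c + 2x.
  have : c • (1 : U K g) = 0 := by
    have e : LinearMap.mul' K (U K g) (comul K g (c • (1 : U K g) + ι K x)) =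
        c • (1 : U K g) + (2 : K) • ι K x := by
      rw [map_add, map_add, comul_ι]; simp [Algebra.TensorProduct.one_def, two_smul]
    rw [e, smul_add, two_smul K (c • (1 : U K g))] at hm
    simpa using hm
  rw [this, zero_add]

variable (K g) in
/-- The tensor square of the elements of filtration degree at most `n`. -/
def tensorSqDegLe (n : ℕ) : Submodule K (U K g ⊗[K] U K g) :=
  LinearMap.range (TensorProduct.map (degLeOne K g ^ n).subtype (degLeOne K g ^ n).subtype)

lemma tmul_mem_tensorSqDegLe {n : ℕ} {a b : U K g} (ha : a ∈ degLeOne K g ^ n)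
    (hb : b ∈ degLeOne K g ^ n) : a ⊗ₜ[K] b ∈ tensorSqDegLe K g n :=
  ⟨(⟨a, ha⟩ : ↥(degLeOne K g ^ n)) ⊗ₜ[K] (⟨b, hb⟩ : ↥(degLeOne K g ^ n)), by simp⟩

lemma tensorSqDegLe_induction {n : ℕ} {p : U K g ⊗[K] U K g → Prop}
    (tmul : ∀ a ∈ degLeOne K g ^ n, ∀ b ∈ degLeOne K g ^ n, p (a ⊗ₜ[K] b))
    (zero : p 0) (add : ∀ s t, p s → p t → p (s + t)) {t : U K g ⊗[K] U K g}
    (h : t ∈ tensorSqDegLe K g n) : p t := by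
  obtain ⟨s, rfl⟩ := h
  induction s using TensorProduct.induction_on with
  | zero => rw [map_zero]; exact zero
  | tmul a b => rw [TensorProduct.map_tmul]; exact tmul _ a.2 _ b.2
  | add s t hs ht => rw [map_add]; exact add _ _ hs ht

lemma tensorSqDegLe_mono {m n : ℕ} (h : m ≤ n) : tensorSqDegLe K g m ≤ tensorSqDegLe K g n :=
  fun _ ht => tensorSqDegLe_induction
    (fun _ ha _ hb => tmul_mem_tensorSqDegLe (degLeOne_pow_mono h ha) (degLeOne_pow_mono h hb))
    (zero_mem _) (fun _ _ => add_mem) ht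

/-- Only the two extreme terms of the coproduct can have a leg of full degree. Without them both
legs have degree at most n, where an induction hypothesis can be applied to both legs
simultaneously. -/
lemma comul_sub_mem_tensorSqDegLe {n : ℕ} {u : U K g} (h : u ∈ degLeOne K g ^ (n + 1)) :
    comul K g u - u ⊗ₜ[K] 1 - 1 ⊗ₜ[K] u ∈ tensorSqDegLe K g n := by
  induction n generalizing u with
  | zero =>
    rw [zero_add, pow_one] at h
    obtain ⟨c, x, rfl⟩ := mem_degLeOne h
    have e : comul K g (c • (1 : U K g) + ι K x) - (c • (1 : U K g) + ι K x) ⊗ₜ[K] 1 -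
        1 ⊗ₜ[K] (c • (1 : U K g) + ι K x) = (-c • (1 : U K g)) ⊗ₜ[K] 1 := by
      rw [map_add, comul_ι, map_smul, map_one, Algebra.TensorProduct.one_def,
        TensorProduct.add_tmul, TensorProduct.tmul_add, TensorProduct.tmul_smul,
        ← TensorProduct.smul_tmul', ← TensorProduct.smul_tmul', neg_smul]
      abel
    rw [e]
    exact tmul_mem_tensorSqDegLe (Submodule.smul_mem _ _ (one_mem_degLeOne_pow 0))
      (one_mem_degLeOne_pow 0)
  | succ n ih =>
    rw [pow_succ'] at h
    induction h using Submodule.mul_induction_on' with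
    | mem_mul_mem w hw v hv =>
      obtain ⟨c, x, rfl⟩ := mem_degLeOne hw
      obtain ⟨r, hr⟩ : ∃ r, r = comul K g v - v ⊗ₜ[K] 1 - 1 ⊗ₜ[K] v := ⟨_, rfl⟩
      have hrm : r ∈ tensorSqDegLe K g n := hr ▸ ih hv
      have hv' : comul K g v = r + v ⊗ₜ[K] 1 + 1 ⊗ₜ[K] v := by rw [hr]; abel
      have hx : ι K x ∈ degLeOne K g ^ (n + 1) :=
        degLeOne_pow_mono (by omega : 1 ≤ n + 1) (by rw [pow_one]; exact ι_mem_degLeOne x)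
      have e : comul K g ((c • (1 : U K g) + ι K x) * v)
            - ((c • (1 : U K g) + ι K x) * v) ⊗ₜ[K] 1
            - 1 ⊗ₜ[K] ((c • (1 : U K g) + ι K x) * v) =
          c • r + comul K g (ι K x) * r + ι K x ⊗ₜ[K] v + v ⊗ₜ[K] ι K x := by
        rw [map_mul, map_add, hv', map_smul, map_one, comul_ι]
        simp only [add_mul, mul_add, smul_mul_assoc, one_mul, Algebra.TensorProduct.tmul_mul_tmul,
          mul_one, TensorProduct.add_tmul, TensorProduct.tmul_add, TensorProduct.tmul_smul,
          ← TensorProduct.smul_tmul']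
        abel
      rw [e]
      refine add_mem (add_mem (add_mem
        (Submodule.smul_mem _ _ (tensorSqDegLe_mono (Nat.le_succ n) hrm)) ?_)
        (tmul_mem_tensorSqDegLe hx hv)) (tmul_mem_tensorSqDegLe hv hx)
      refine tensorSqDegLe_induction (p := fun r => comul K g (ι K x) * r ∈ _) ?_ ?_ ?_ hrm
      · intro a ha b hb
        rw [comul_ι, add_mul, Algebra.TensorProduct.tmul_mul_tmul,
          Algebra.TensorProduct.tmul_mul_tmul, one_mul, one_mul]
        exact add_mem
          (tmul_mem_tensorSqDegLe (ι_mul_mem x ha) (degLeOne_pow_mono (Nat.le_succ n) hb))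
          (tmul_mem_tensorSqDegLe (degLeOne_pow_mono (Nat.le_succ n) ha) (ι_mul_mem x hb))
      · rw [mul_zero]; exact zero_mem _
      · intro s t hs ht
        rw [mul_add]; exact add_mem hs ht
    | add a _ b _ ha hb =>
      have e : comul K g (a + b) - (a + b) ⊗ₜ[K] 1 - 1 ⊗ₜ[K] (a + b) =
          (comul K g a - a ⊗ₜ[K] 1 - 1 ⊗ₜ[K] a) + (comul K g b - b ⊗ₜ[K] 1 - 1 ⊗ₜ[K] b) := by
        rw [map_add, TensorProduct.add_tmul, TensorProduct.tmul_add]; abel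
      rw [e]; exact add_mem ha hb

variable {h : Type*} [LieRing h] [LieAlgebra K h]

lemma map_lift_comul (φ : h →ₗ⁅K⁆ U K g)
    (hφ : ∀ x, comul K g (φ x) = φ x ⊗ₜ[K] 1 + 1 ⊗ₜ[K] φ x) (u : U K h) :
    Algebra.TensorProduct.map (lift K φ) (lift K φ) (comul K h u) = comul K g (lift K φ u) := by
  have : (Algebra.TensorProduct.map (lift K φ) (lift K φ)).comp (comul K h) =
      (comul K g).comp (lift K φ) := by
    refine hom_ext K (LieHom.ext fun x => ?_)
    change Algebra.TensorProduct.map (lift K φ) (lift K φ) (comul K h (ι K x)) =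
      comul K g (lift K φ (ι K x))
    rw [comul_ι, map_add, Algebra.TensorProduct.map_tmul, Algebra.TensorProduct.map_tmul, map_one,
      lift_ι_apply, hφ]
  exact DFunLike.congr_fun this u

/-- An injective Lie homomorphism into the primitive elements of `U(g)` extends to an injective
homomorphism of the enveloping algebra. -/
theorem lift_injective [CharZero K] (φ : h →ₗ⁅K⁆ U K g)
    (hφ : ∀ x, comul K g (φ x) = φ x ⊗ₜ[K] 1 + 1 ⊗ₜ[K] φ x) (hε : ∀ x, counit K g (φ x) = 0)
    (hinj : Function.Injective φ) : Function.Injective (lift K φ) := by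
  have key : ∀ n, ∀ u ∈ degLeOne K h ^ (n + 1), lift K φ u = 0 → u = 0 := by
    intro n
    induction n with
    | zero =>
      intro u hu h0
      rw [zero_add, pow_one] at hu
      obtain ⟨c, x, rfl⟩ := mem_degLeOne hu
      have hc : c = 0 := by
        have := congrArg (counit K g) h0
        simpa [hε] using this
      subst hc
      rw [zero_smul, zero_add, lift_ι_apply] at h0
      rw [hinj (h0.trans (map_zero φ).symm), map_zero, zero_smul, add_zero]
    | succ n ih =>
      intro u hu h0
      -- The extension of φ is injective in degree at most n + 1 by induction, and over a field so
      -- is its tensor square. That tensor square kills the reduced coproduct of u, because u lies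
      -- in the kernel; hence u is primitive and comes from the Lie algebra.
      have hprim : comul K h u - u ⊗ₜ[K] 1 - 1 ⊗ₜ[K] u = 0 := by
        obtain ⟨s, hs⟩ := comul_sub_mem_tensorSqDegLe hu
        have hi : Function.Injective ((lift K φ).toLinearMap ∘ₗ (degLeOne K h ^ (n + 1)).subtype) := by
          rw [← LinearMap.ker_eq_bot, LinearMap.ker_eq_bot']
          intro v hv
          exact Subtype.ext (ih v v.2 hv)
        have hi2 := TensorProduct.map_injective_of_flat_flat _ _ hi hi
        have : s = 0 := by
          refine hi2 ?_
          rw [map_zero, TensorProduct.map_comp, LinearMap.comp_apply, hs, map_sub, map_sub]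
          have e := map_lift_comul φ hφ u
          rw [h0, map_zero] at e
          have e' : TensorProduct.map (lift K φ).toLinearMap (lift K φ).toLinearMap (comul K h u) = 0 := e
          rw [e', TensorProduct.map_tmul, TensorProduct.map_tmul, AlgHom.toLinearMap_apply, h0]
          simp
        rw [← hs, this, map_zero]
      obtain ⟨x, rfl⟩ := exists_ι_of_primitive (u := u) (by
        rw [sub_sub, sub_eq_zero] at hprim; exact hprim)
      rw [lift_ι_apply] at h0
      rw [hinj (h0.trans (map_zero φ).symm), map_zero]
  intro a b hab
  obtain ⟨n, hn⟩ := exists_mem_degLeOne_pow (a - b)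
  exact sub_eq_zero.1 (key n _ (degLeOne_pow_mono (Nat.le_succ n) hn) (by rw [map_sub, hab, sub_self]))

lemma comul_ι_comp_incl (L : LieSubalgebra K g) (x : L) :
    comul K g (((ι K).comp L.incl) x) =
      ((ι K).comp L.incl) x ⊗ₜ[K] 1 + 1 ⊗ₜ[K] ((ι K).comp L.incl) x := comul_ι _

lemma lift_incl_injective [CharZero K] (hι : Function.Injective (ι K : g → U K g))
    (L : LieSubalgebra K g) : Function.Injective (lift K ((ι K).comp L.incl)) :=
  lift_injective _ (comul_ι_comp_incl L) (fun _ => counit_ι _)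
    (hι.comp Subtype.val_injective)

/-- A preimage of ι x in U(L) is primitive, since U(L) ⊗ U(L) embeds into U(g) ⊗ U(g). By
Friedrichs' theorem it is an element of L. -/
lemma mem_of_ι_mem_range [CharZero K] (hι : Function.Injective (ι K : g → U K g))
    (L : LieSubalgebra K g) {x : g} (hx : ι K x ∈ (lift K ((ι K).comp L.incl)).range) : x ∈ L := by
  obtain ⟨u, hu⟩ := hx
  change lift K ((ι K).comp L.incl) u = _ at hu
  have hi := lift_incl_injective hι L
  have hi2 : Function.Injective (Algebra.TensorProduct.map (lift K ((ι K).comp L.incl))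
      (lift K ((ι K).comp L.incl))) :=
    TensorProduct.map_injective_of_flat_flat (lift K ((ι K).comp L.incl)).toLinearMap
      (lift K ((ι K).comp L.incl)).toLinearMap hi hi
  obtain ⟨l, rfl⟩ := exists_ι_of_primitive (u := u) (hi2 (by
    rw [map_lift_comul _ (comul_ι_comp_incl L), hu, comul_ι, map_add,
      Algebra.TensorProduct.map_tmul, Algebra.TensorProduct.map_tmul, map_one, hu]))
  rw [lift_ι_apply] at hu
  have := hι hu
  rw [← this]
  exact l.2

/-- If `∑ aᵢ ⊗ bᵢ` lies in `U(L) ⊗ U(L)`, with `aᵢ, bᵢ ∈ g` and the `bᵢ` linearly independent, then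
the `aᵢ` lie in `L`. -/
lemma mem_of_sum_tmul_mem_range [CharZero K] (hι : Function.Injective (ι K : g → U K g))
    (L : LieSubalgebra K g) {κ : Type*} [Fintype κ] {a b : κ → g} (hb : LinearIndependent K b)
    (h : ∑ i, ι K (a i) ⊗ₜ[K] ι K (b i) ∈ (Algebra.TensorProduct.map
      (lift K ((ι K).comp L.incl)) (lift K ((ι K).comp L.incl))).range) (i : κ) : a i ∈ L := by
  classical
  have hb' : LinearIndependent K (fun j => ι K (b j)) :=
    hb.map' (ι K : g →ₗ⁅K⁆ U K g).toLinearMap (LinearMap.ker_eq_bot.2 hι)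
  -- β is a functional on all of U(g) that is dual to `b i`. Then id ⊗ β extracts ι(a_i) from the
  -- sum and maps the image of U(L) ⊗ U(L) into that of U(L).
  obtain ⟨β, hβ⟩ := LinearMap.exists_extend ((Finsupp.lapply i : (κ →₀ K) →ₗ[K] K) ∘ₗ hb'.repr)
  have hβ' : ∀ j, β (ι K (b j)) = if j = i then 1 else 0 := by
    intro j
    have := DFunLike.congr_fun hβ ⟨ι K (b j), Submodule.subset_span ⟨j, rfl⟩⟩
    simp only [LinearMap.comp_apply, Submodule.subtype_apply, Finsupp.lapply_apply] at this
    rw [this, hb'.repr_eq_single j _ rfl, Finsupp.single_apply]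
  apply mem_of_ι_mem_range hι L
  obtain ⟨s, hs⟩ := h
  set P := (TensorProduct.rid K (U K g)).toLinearMap ∘ₗ TensorProduct.map LinearMap.id β with hP
  have h1 : P (∑ j, ι K (a j) ⊗ₜ[K] ι K (b j)) = ι K (a i) := by
    simp [hP, map_sum, hβ', -ι_apply]
  rw [← h1, ← hs]
  clear hs h1
  induction s using TensorProduct.induction_on with
  | zero => simp
  | tmul x y =>
    have : P (Algebra.TensorProduct.map (lift K ((ι K).comp L.incl))
      (lift K ((ι K).comp L.incl)) (x ⊗ₜ[K] y)) =
      β (lift K ((ι K).comp L.incl) y) • lift K ((ι K).comp L.incl) x := by simp [hP]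
    change P (Algebra.TensorProduct.map _ _ _) ∈ _
    rw [this]
    exact Subalgebra.smul_mem _ (AlgHom.mem_range_self _ x) _
  | add x y hx hy =>
    rw [map_add, map_add]
    exact add_mem hx hy

end Enveloping

/-! ### Families satisfying the commutation relations of the symplectic Lie algebra -/

section Relations

variable {K : Type*} [Field K]

variable (K) in
/-- The Kronecker symbol. -/
def kron {ι : Type*} [DecidableEq ι] (i j : ι) : K := if i = j then 1 else 0

section Kron

variable {ι : Type*} [DecidableEq ι]

@[simp] lemma kron_self (i : ι) : kron K i i = 1 := if_pos rfl

lemma kron_of_ne {i j : ι} (h : i ≠ j) : kron K i j = 0 := if_neg h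

lemma kron_comm (i j : ι) : kron K i j = kron K j i := by
  simp only [kron, eq_comm]

lemma sum_kron_smul {V : Type*} [AddCommGroup V] [Module K V] (s : Finset ι) {i : ι} (hi : i ∈ s)
    (f : ι → V) : ∑ m ∈ s, kron K m i • f m = f i := by
  simp [kron, ite_smul, hi]

lemma single_mul_single_kron {n : Type*} [Fintype n] [DecidableEq n] (i j l m : n) :
    Matrix.single i j (1 : K) * Matrix.single l m 1 = kron K j l • Matrix.single i m (1 : K) := by
  by_cases h : j = l
  · subst h; simp
  · simp [kron_of_ne h, Matrix.single_mul_single_of_ne, h]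

end Kron

variable {N : ℕ}

/-- The element `2 H_{ii}` for `i = j`, and the root vector of `e_i - e_j` otherwise. -/
def Gens.M {R : Type*} [Ring R] (G : Gens N R) (i j : Fin N) : R :=
  if i = j then 2 * G.H i else G.Em i j

lemma Gens.M_self {R : Type*} [Ring R] (G : Gens N R) (i : Fin N) : G.M i i = 2 * G.H i :=
  if_pos rfl

lemma Gens.M_of_ne {R : Type*} [Ring R] (G : Gens N R) {i j : Fin N} (h : i ≠ j) :
    G.M i j = G.Em i j := if_neg h

variable (K) in
/-- The generators with indices in `s` satisfy the commutation relations of `sp(N)`. -/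
structure IsSpFamily {R : Type*} [Ring R] [Algebra K R] (G : Gens N R) (s : Set (Fin N)) :
    Prop where
  Ep_symm : ∀ {i j}, i ∈ s → j ∈ s → G.Ep i j = G.Ep j i
  Fp_symm : ∀ {i j}, i ∈ s → j ∈ s → G.Fp i j = G.Fp j i
  lie_M_M : ∀ {i j l m}, i ∈ s → j ∈ s → l ∈ s → m ∈ s →
    ⁅G.M i j, G.M l m⁆ = kron K j l • G.M i m - kron K m i • G.M l j
  lie_M_Ep : ∀ {i j l m}, i ∈ s → j ∈ s → l ∈ s → m ∈ s →
    ⁅G.M i j, G.Ep l m⁆ = kron K j l • G.Ep i m + kron K j m • G.Ep i l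
  lie_M_Fp : ∀ {i j l m}, i ∈ s → j ∈ s → l ∈ s → m ∈ s →
    ⁅G.M i j, G.Fp l m⁆ = -(kron K i l • G.Fp j m + kron K i m • G.Fp j l)
  lie_Ep_Fp : ∀ {i j l m}, i ∈ s → j ∈ s → l ∈ s → m ∈ s →
    ⁅G.Ep i j, G.Fp l m⁆ = kron K j l • G.M i m + kron K j m • G.M i l
      + kron K i l • G.M j m + kron K i m • G.M j l
  lie_Ep_Ep : ∀ {i j l m}, i ∈ s → j ∈ s → l ∈ s → m ∈ s → ⁅G.Ep i j, G.Ep l m⁆ = 0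
  lie_Fp_Fp : ∀ {i j l m}, i ∈ s → j ∈ s → l ∈ s → m ∈ s → ⁅G.Fp i j, G.Fp l m⁆ = 0

/-! ### Commutation relations of the root vectors in the matrix algebra. -/

section Matrices

lemma coe_lie_sp (x y : sp K N) :
    ((⁅x, y⁆ : sp K N) : Matrix (Fin N ⊕ Fin N) (Fin N ⊕ Fin N) K) = x.1 * y.1 - y.1 * x.1 := by
  rw [LieSubalgebra.coe_bracket, LieRing.of_associative_ring_bracket]

lemma coe_smul_sp (c : K) (x : sp K N) :
    ((c • x : sp K N) : Matrix (Fin N ⊕ Fin N) (Fin N ⊕ Fin N) K) = c • x.1 := rfl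

lemma coe_add_sp (x y : sp K N) :
    ((x + y : sp K N) : Matrix (Fin N ⊕ Fin N) (Fin N ⊕ Fin N) K) = x.1 + y.1 := rfl

lemma coe_neg_sp (x : sp K N) :
    ((-x : sp K N) : Matrix (Fin N ⊕ Fin N) (Fin N ⊕ Fin N) K) = -x.1 := rfl

lemma rootEplus_comm (i j : Fin N) : rootEplus K i j = rootEplus K j i :=
  Subtype.ext (by simp only [rootEplus, add_comm])

lemma rootFplus_comm (i j : Fin N) : rootFplus K i j = rootFplus K j i :=
  Subtype.ext (by simp only [rootFplus, add_comm])

lemma two_smul_cartan [CharZero K] (i : Fin N) : (2 : K) • cartan K i = rootMinus K i i :=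
  Subtype.ext (by
    simp only [cartan, rootMinus, coe_smul_sp, Matrix.fromBlocks_smul, smul_neg,
      ← Matrix.transpose_smul, Matrix.smul_single, smul_zero]
    norm_num)

lemma lie_rootMinus_rootMinus (i j l m : Fin N) : ⁅rootMinus K i j, rootMinus K l m⁆ =
    kron K j l • rootMinus K i m - kron K m i • rootMinus K l j := by
  refine Subtype.ext ?_
  rw [coe_lie_sp]
  simp only [rootMinus, Matrix.fromBlocks_multiply, coe_smul_sp, coe_add_sp, coe_neg_sp,
    Matrix.fromBlocks_smul, sub_eq_add_neg, Matrix.fromBlocks_neg, Matrix.fromBlocks_add,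
    Matrix.transpose_single, mul_zero, zero_mul, add_zero, zero_add, mul_neg, neg_mul, neg_neg,
    single_mul_single_kron, neg_zero, smul_zero]
  congr 1
  rw [kron_comm i m, kron_comm l j]; module

lemma lie_rootMinus_rootEplus (i j l m : Fin N) : ⁅rootMinus K i j, rootEplus K l m⁆ =
    kron K j l • rootEplus K i m + kron K j m • rootEplus K i l := by
  refine Subtype.ext ?_
  rw [coe_lie_sp]
  simp only [rootMinus, rootEplus, Matrix.fromBlocks_multiply, coe_smul_sp,
    coe_add_sp, Matrix.fromBlocks_smul, sub_eq_add_neg, Matrix.fromBlocks_neg,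
    Matrix.fromBlocks_add, Matrix.transpose_single, Matrix.transpose_zero, mul_zero, zero_mul,
    add_zero, zero_add, mul_neg, neg_neg, mul_add, add_mul, single_mul_single_kron,
    neg_zero, smul_zero]
  congr 1
  rw [kron_comm l j, kron_comm m j]; module

lemma lie_rootMinus_rootFplus (i j l m : Fin N) : ⁅rootMinus K i j, rootFplus K l m⁆ =
    -(kron K i l • rootFplus K j m + kron K i m • rootFplus K j l) := by
  refine Subtype.ext ?_
  rw [coe_lie_sp]
  simp only [rootMinus, rootFplus, Matrix.fromBlocks_multiply, coe_smul_sp,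
    coe_add_sp, coe_neg_sp, Matrix.fromBlocks_smul, sub_eq_add_neg,
    Matrix.fromBlocks_neg, Matrix.fromBlocks_add, Matrix.transpose_single, Matrix.transpose_zero,
    mul_zero, zero_mul, add_zero, zero_add, mul_neg, neg_mul, mul_add, add_mul,
    single_mul_single_kron, neg_zero, smul_zero]
  congr 1
  rw [kron_comm l i, kron_comm m i]; module

lemma lie_rootEplus_rootFplus (i j l m : Fin N) : ⁅rootEplus K i j, rootFplus K l m⁆ =
    kron K j l • rootMinus K i m + kron K j m • rootMinus K i l
      + kron K i l • rootMinus K j m + kron K i m • rootMinus K j l := by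
  refine Subtype.ext ?_
  rw [coe_lie_sp]
  simp only [rootMinus, rootEplus, rootFplus, Matrix.fromBlocks_multiply, coe_smul_sp,
    coe_add_sp, Matrix.fromBlocks_smul, sub_eq_add_neg, Matrix.fromBlocks_neg,
    Matrix.fromBlocks_add, Matrix.transpose_single, Matrix.transpose_zero, mul_zero, zero_mul,
    add_zero, zero_add, mul_add, add_mul, single_mul_single_kron,
    neg_zero, smul_zero]
  congr 1
  · module
  · rw [kron_comm l i, kron_comm m i, kron_comm l j, kron_comm m j]; module

lemma lie_rootEplus_rootEplus (i j l m : Fin N) : ⁅rootEplus K i j, rootEplus K l m⁆ = 0 := by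
  refine Subtype.ext ?_
  rw [coe_lie_sp]
  simp [rootEplus, Matrix.fromBlocks_multiply]

lemma lie_rootFplus_rootFplus (i j l m : Fin N) : ⁅rootFplus K i j, rootFplus K l m⁆ = 0 := by
  refine Subtype.ext ?_
  rw [coe_lie_sp]
  simp [rootFplus, Matrix.fromBlocks_multiply]

lemma emb_lie (x y : sp K N) : ⁅emb K N x, emb K N y⁆ = emb K N ⁅x, y⁆ := by
  rw [emb, emb, emb, LieHom.map_lie, LieRing.of_associative_ring_bracket,
    LieRing.of_associative_ring_bracket, map_sub, map_mul, map_mul]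

variable (K N) in
/-- `emb` as a linear map. -/
def embLin : sp K N →ₗ[K] (U K (sp K N))⟦X⟧ where
  toFun := emb K N
  map_add' x y := by simp only [emb, map_add]
  map_smul' c x := by
    ext n
    simp only [emb, map_smul, RingHom.id_apply, PowerSeries.coeff_smul, PowerSeries.coeff_C]
    split_ifs <;> simp

lemma emb_add (x y : sp K N) : emb K N (x + y) = emb K N x + emb K N y :=
  map_add (embLin K N) x y

lemma emb_sub (x y : sp K N) : emb K N (x - y) = emb K N x - emb K N y :=
  map_sub (embLin K N) x y

lemma emb_neg (x : sp K N) : emb K N (-x) = -emb K N x := map_neg (embLin K N) x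

lemma emb_zero : emb K N 0 = 0 := map_zero (embLin K N)

lemma emb_smul (c : K) (x : sp K N) : emb K N (c • x) = c • emb K N x :=
  map_smul (embLin K N) c x

lemma gens₀_Ep (i j : Fin N) : (gens₀ K N).Ep i j = emb K N (rootEplus K i j) := rfl

lemma gens₀_Fp (i j : Fin N) : (gens₀ K N).Fp i j = emb K N (rootFplus K i j) := rfl

lemma gens₀_M [CharZero K] (i j : Fin N) : (gens₀ K N).M i j = emb K N (rootMinus K i j) := by
  by_cases h : i = j
  · subst h
    rw [Gens.M_self, ← two_smul_cartan, emb_smul, two_smul, two_mul]; rfl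
  · rw [Gens.M_of_ne _ h]; rfl

lemma isSpFamily_gens₀ [CharZero K] (s : Set (Fin N)) : IsSpFamily K (gens₀ K N) s where
  Ep_symm _ _ := by rw [gens₀_Ep, gens₀_Ep, rootEplus_comm]
  Fp_symm _ _ := by rw [gens₀_Fp, gens₀_Fp, rootFplus_comm]
  lie_M_M _ _ _ _ := by
    rw [gens₀_M, gens₀_M, gens₀_M, gens₀_M, emb_lie, lie_rootMinus_rootMinus, emb_sub, emb_smul,
      emb_smul]
  lie_M_Ep _ _ _ _ := by
    rw [gens₀_M, gens₀_Ep, gens₀_Ep, gens₀_Ep, emb_lie, lie_rootMinus_rootEplus, emb_add, emb_smul,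
      emb_smul]
  lie_M_Fp _ _ _ _ := by
    rw [gens₀_M, gens₀_Fp, gens₀_Fp, gens₀_Fp, emb_lie, lie_rootMinus_rootFplus, emb_neg, emb_add,
      emb_smul, emb_smul]
  lie_Ep_Fp _ _ _ _ := by
    rw [gens₀_M, gens₀_M, gens₀_M, gens₀_M, gens₀_Ep, gens₀_Fp, emb_lie, lie_rootEplus_rootFplus,
      emb_add, emb_add, emb_add, emb_smul, emb_smul, emb_smul, emb_smul]
  lie_Ep_Ep _ _ _ _ := by
    rw [gens₀_Ep, gens₀_Ep, emb_lie, lie_rootEplus_rootEplus, emb_zero]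
  lie_Fp_Fp _ _ _ _ := by
    rw [gens₀_Fp, gens₀_Fp, emb_lie, lie_rootFplus_rootFplus, emb_zero]

end Matrices

/-! ### Lie homomorphisms on `sp(n)` from families satisfying the relations. -/

section LieHom

variable {n : ℕ} {R : Type*} [Ring R] [Algebra K R]

lemma assoc_lie_smul (c : K) (a b : R) : ⁅a, c • b⁆ = c • ⁅a, b⁆ := by
  rw [Ring.lie_def, Ring.lie_def, mul_smul_comm, smul_mul_assoc, smul_sub]

lemma assoc_smul_lie (c : K) (a b : R) : ⁅c • a, b⁆ = c • ⁅a, b⁆ := by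
  rw [Ring.lie_def, Ring.lie_def, mul_smul_comm, smul_mul_assoc, smul_sub]

variable (K) in
/-- The linear map on matrices that sends the matrix unit with indices `i, j` to `f i j`. -/
def matSum (f : Fin n → Fin n → R) : Matrix (Fin n) (Fin n) K →ₗ[K] R where
  toFun A := ∑ i, ∑ j, A i j • f i j
  map_add' A B := by simp only [Matrix.add_apply, add_smul, Finset.sum_add_distrib]
  map_smul' c A := by
    simp only [Matrix.smul_apply, smul_eq_mul, mul_smul, Finset.smul_sum, RingHom.id_apply]

lemma matSum_single (f : Fin n → Fin n → R) (i j : Fin n) (c : K) :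
    matSum K f (Matrix.single i j c) = c • f i j := by
  simp only [matSum, LinearMap.coe_mk, AddHom.coe_mk, Matrix.single_apply]
  rw [Finset.sum_eq_single i, Finset.sum_eq_single j]
  · simp
  · intro b _ hb; simp [hb.symm]
  · simp
  · intro b _ hb; simp [hb.symm]
  · simp

/-- Two bilinear maps on matrices that agree on matrix units are equal. -/
lemma matrix_bilin_ext {F F' : Matrix (Fin n) (Fin n) K → Matrix (Fin n) (Fin n) K → R}
    (h1 : ∀ A B C, F (A + B) C - F' (A + B) C = (F A C - F' A C) + (F B C - F' B C))
    (h2 : ∀ (c : K) A C, F (c • A) C - F' (c • A) C = c • (F A C - F' A C))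
    (h3 : ∀ A B C, F A (B + C) - F' A (B + C) = (F A B - F' A B) + (F A C - F' A C))
    (h4 : ∀ (c : K) A C, F A (c • C) - F' A (c • C) = c • (F A C - F' A C))
    (h : ∀ i j l m, F (Matrix.single i j 1) (Matrix.single l m 1) =
      F' (Matrix.single i j 1) (Matrix.single l m 1)) (A B) : F A B = F' A B := by
  rw [← sub_eq_zero]
  induction A using Matrix.induction_on' with
  | h_zero => simpa using h2 0 0 B
  | h_add p q hp hq => rw [h1, hp, hq, add_zero]
  | h_std_basis i j x =>
    induction B using Matrix.induction_on' with
    | h_zero => simpa using h4 0 (Matrix.single i j x) 0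
    | h_add p q hp hq => rw [h3, hp, hq, add_zero]
    | h_std_basis l m y =>
      have e : ∀ (i j : Fin n) (x : K), Matrix.single i j x = x • Matrix.single i j 1 := by
        intro i j x; rw [Matrix.smul_single, smul_eq_mul, mul_one]
      rw [e i j x, e l m y, h2, h4, h, sub_self, smul_zero, smul_zero]

variable {G : Gens n R}

namespace IsSpFamily

variable (hG : IsSpFamily K G Set.univ)
include hG

lemma lie_matSum_M_M (A B : Matrix (Fin n) (Fin n) K) :
    ⁅matSum K G.M A, matSum K G.M B⁆ = matSum K G.M (A * B - B * A) := by
  revert A B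
  refine matrix_bilin_ext ?_ ?_ ?_ ?_ ?_
  · intro A B C; simp only [map_add, map_sub, add_lie, add_mul, mul_add]; abel
  · intro c A C; simp only [map_smul, map_sub, assoc_smul_lie, smul_mul_assoc, mul_smul_comm, smul_sub]
  · intro A B C; simp only [map_add, map_sub, lie_add, add_mul, mul_add]; abel
  · intro c A C; simp only [map_smul, map_sub, assoc_lie_smul, smul_mul_assoc, mul_smul_comm, smul_sub]
  · intro i j l m
    simp only [matSum_single, single_mul_single_kron, map_sub, map_smul, one_smul,
      hG.lie_M_M (Set.mem_univ i) (Set.mem_univ j) (Set.mem_univ l) (Set.mem_univ m)]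

lemma lie_matSum_M_Ep (A B : Matrix (Fin n) (Fin n) K) :
    ⁅matSum K G.M A, matSum K G.Ep B⁆ = matSum K G.Ep (A * B + B * A.transpose) := by
  revert A B
  refine matrix_bilin_ext ?_ ?_ ?_ ?_ ?_
  · intro A B C
    simp only [map_add, add_lie, add_mul, mul_add, Matrix.transpose_add]; abel
  · intro c A C
    simp only [map_smul, map_add, assoc_smul_lie, smul_mul_assoc, mul_smul_comm, smul_sub, smul_add,
      Matrix.transpose_smul]
  · intro A B C
    simp only [map_add, lie_add, add_mul, mul_add]; abel
  · intro c A C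
    simp only [map_smul, map_add, assoc_lie_smul, smul_mul_assoc, mul_smul_comm, smul_sub, smul_add]
  · intro i j l m
    simp only [matSum_single, single_mul_single_kron, map_add, map_smul, one_smul,
      Matrix.transpose_single,
      hG.lie_M_Ep (Set.mem_univ i) (Set.mem_univ j) (Set.mem_univ l) (Set.mem_univ m)]
    rw [kron_comm j m, hG.Ep_symm (Set.mem_univ i) (Set.mem_univ l)]

lemma lie_matSum_M_Fp (A B : Matrix (Fin n) (Fin n) K) :
    ⁅matSum K G.M A, matSum K G.Fp B⁆ = -matSum K G.Fp (A.transpose * B + B * A) := by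
  revert A B
  refine matrix_bilin_ext ?_ ?_ ?_ ?_ ?_
  · intro A B C
    simp only [map_add, add_lie, add_mul, mul_add, Matrix.transpose_add]; abel
  · intro c A C
    simp only [map_smul, map_add, assoc_smul_lie, smul_mul_assoc, mul_smul_comm, smul_sub, smul_add,
      Matrix.transpose_smul, smul_neg]
  · intro A B C
    simp only [map_add, lie_add, add_mul, mul_add]; abel
  · intro c A C
    simp only [map_smul, map_add, assoc_lie_smul, smul_mul_assoc, mul_smul_comm, smul_sub, smul_add,
      smul_neg]
  · intro i j l m
    simp only [matSum_single, single_mul_single_kron, map_add, map_smul, one_smul,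
      Matrix.transpose_single,
      hG.lie_M_Fp (Set.mem_univ i) (Set.mem_univ j) (Set.mem_univ l) (Set.mem_univ m)]
    rw [kron_comm i m, hG.Fp_symm (Set.mem_univ j) (Set.mem_univ l)]

/-- As Ep and Fp are symmetric in their indices, A and B enter only through their symmetrizations.
For symmetric blocks this produces a factor 4, which cancels the two halves in `spLin`. -/
lemma lie_matSum_Ep_Fp (A B : Matrix (Fin n) (Fin n) K) :
    ⁅matSum K G.Ep A, matSum K G.Fp B⁆ =
      matSum K G.M ((A + A.transpose) * (B + B.transpose)) := by
  revert A B
  refine matrix_bilin_ext ?_ ?_ ?_ ?_ ?_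
  · intro A B C
    simp only [map_add, add_lie, add_mul, mul_add, Matrix.transpose_add]; abel
  · intro c A C
    simp only [map_smul, assoc_smul_lie, smul_mul_assoc, ← smul_add, smul_sub, Matrix.transpose_smul]
  · intro A B C
    simp only [map_add, lie_add, add_mul, mul_add, Matrix.transpose_add]; abel
  · intro c A C
    simp only [map_smul, assoc_lie_smul, mul_smul_comm, ← smul_add, smul_sub, Matrix.transpose_smul]
  · intro i j l m
    simp only [matSum_single, single_mul_single_kron, map_add, map_smul, one_smul, add_mul, mul_add,
      Matrix.transpose_single,
      hG.lie_Ep_Fp (Set.mem_univ i) (Set.mem_univ j) (Set.mem_univ l) (Set.mem_univ m)]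
    abel

lemma lie_matSum_Ep_Ep (A B : Matrix (Fin n) (Fin n) K) :
    ⁅matSum K G.Ep A, matSum K G.Ep B⁆ = 0 := by
  revert A B
  refine matrix_bilin_ext (F' := fun _ _ => 0) ?_ ?_ ?_ ?_ ?_
  · intro A B C; simp only [map_add, add_lie, sub_zero]
  · intro c A C; simp only [map_smul, assoc_smul_lie, sub_zero]
  · intro A B C; simp only [map_add, lie_add, sub_zero]
  · intro c A C; simp only [map_smul, assoc_lie_smul, sub_zero]
  · intro i j l m
    simp only [matSum_single, one_smul,
      hG.lie_Ep_Ep (Set.mem_univ i) (Set.mem_univ j) (Set.mem_univ l) (Set.mem_univ m)]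

lemma lie_matSum_Fp_Fp (A B : Matrix (Fin n) (Fin n) K) :
    ⁅matSum K G.Fp A, matSum K G.Fp B⁆ = 0 := by
  revert A B
  refine matrix_bilin_ext (F' := fun _ _ => 0) ?_ ?_ ?_ ?_ ?_
  · intro A B C; simp only [map_add, add_lie, sub_zero]
  · intro c A C; simp only [map_smul, assoc_smul_lie, sub_zero]
  · intro A B C; simp only [map_add, lie_add, sub_zero]
  · intro c A C; simp only [map_smul, assoc_lie_smul, sub_zero]
  · intro i j l m
    simp only [matSum_single, one_smul,
      hG.lie_Fp_Fp (Set.mem_univ i) (Set.mem_univ j) (Set.mem_univ l) (Set.mem_univ m)]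

end IsSpFamily

lemma sp_eq_fromBlocks (x : sp K n) :
    ∃ A B C : Matrix (Fin n) (Fin n) K, B.transpose = B ∧ C.transpose = C ∧
      x.1 = Matrix.fromBlocks A B C (-A.transpose) := by
  have hx : x.1 ∈ skewAdjointMatricesSubmodule _ := x.2
  generalize x.1 = x at hx
  rw [mem_skewAdjointMatricesSubmodule] at hx
  obtain ⟨A, B, C, D, rfl⟩ : ∃ A B C D, x = Matrix.fromBlocks A B C D :=
    ⟨_, _, _, _, (Matrix.fromBlocks_toBlocks x).symm⟩
  simp only [Matrix.IsSkewAdjoint, Matrix.IsAdjointPair, Matrix.J, Matrix.fromBlocks_transpose,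
    Matrix.fromBlocks_multiply, Matrix.fromBlocks_neg, Matrix.fromBlocks_inj, mul_zero, zero_mul,
    mul_one, one_mul, mul_neg, neg_mul, neg_zero, add_zero, zero_add, neg_neg, neg_inj] at hx
  obtain ⟨h1, h2, h3, h4⟩ := hx
  exact ⟨A, B, C, h4, h1, by rw [h2]⟩

variable (K) in
/-- The linear map on `sp(n)` determined by the values `G` on the generators. -/
def spLin (G : Gens n R) : sp K n →ₗ[K] R where
  -- The sum over all pairs i, j meets every E_{i+j} with i ≠ j twice, and the block of E_{i+i} is
  -- 2e_{ii}; hence the halves.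
  toFun x := matSum K G.M x.1.toBlocks₁₁ + (2⁻¹ : K) • matSum K G.Ep x.1.toBlocks₁₂
    + (2⁻¹ : K) • matSum K G.Fp x.1.toBlocks₂₁
  map_add' x y := by
    have h1 : (x + y).1.toBlocks₁₁ = x.1.toBlocks₁₁ + y.1.toBlocks₁₁ := rfl
    have h2 : (x + y).1.toBlocks₁₂ = x.1.toBlocks₁₂ + y.1.toBlocks₁₂ := rfl
    have h3 : (x + y).1.toBlocks₂₁ = x.1.toBlocks₂₁ + y.1.toBlocks₂₁ := rfl
    rw [h1, h2, h3]; simp only [map_add, smul_add]; abel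
  map_smul' c x := by
    have h1 : (c • x).1.toBlocks₁₁ = c • x.1.toBlocks₁₁ := rfl
    have h2 : (c • x).1.toBlocks₁₂ = c • x.1.toBlocks₁₂ := rfl
    have h3 : (c • x).1.toBlocks₂₁ = c • x.1.toBlocks₂₁ := rfl
    rw [h1, h2, h3]; simp only [map_smul, RingHom.id_apply]; module

lemma spLin_apply (G : Gens n R) {x : sp K n} {A B C : Matrix (Fin n) (Fin n) K}
    (h : x.1 = Matrix.fromBlocks A B C (-A.transpose)) :
    spLin K G x = matSum K G.M A + (2⁻¹ : K) • matSum K G.Ep B + (2⁻¹ : K) • matSum K G.Fp C := by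
  simp only [spLin, LinearMap.coe_mk, AddHom.coe_mk]
  rw [h, Matrix.toBlocks_fromBlocks₁₁, Matrix.toBlocks_fromBlocks₁₂, Matrix.toBlocks_fromBlocks₂₁]

lemma IsSpFamily.spLin_lie [CharZero K] (hG : IsSpFamily K G Set.univ) (x y : sp K n) :
    spLin K G ⁅x, y⁆ = ⁅spLin K G x, spLin K G y⁆ := by
  obtain ⟨A, B, C, hB, hC, hx⟩ := sp_eq_fromBlocks x
  obtain ⟨A', B', C', hB', hC', hy⟩ := sp_eq_fromBlocks y
  have hxy : (⁅x, y⁆ : sp K n).1 = Matrix.fromBlocks (A * A' - A' * A + (B * C' - B' * C))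
      ((A * B' + B' * A.transpose) - (A' * B + B * A'.transpose))
      ((A'.transpose * C + C * A') - (A.transpose * C' + C' * A))
      (-(A * A' - A' * A + (B * C' - B' * C)).transpose) := by
    rw [coe_lie_sp, hx, hy]
    simp only [Matrix.fromBlocks_multiply, sub_eq_add_neg, Matrix.fromBlocks_neg,
      Matrix.fromBlocks_add, Matrix.transpose_add, Matrix.transpose_neg, Matrix.transpose_mul,
      hB, hC, hB', hC', mul_neg, neg_mul, neg_neg]
    congr 1 <;> abel
  have e1 : matSum K G.M ((B + B.transpose) * (C' + C'.transpose)) =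
      (4 : K) • matSum K G.M (B * C') := by
    rw [hB, hC', ← map_smul]
    congr 1
    rw [← two_smul K B, ← two_smul K C', smul_mul_assoc, mul_smul_comm, smul_smul]; norm_num
  have e2 : matSum K G.M ((B' + B'.transpose) * (C + C.transpose)) =
      (4 : K) • matSum K G.M (B' * C) := by
    rw [hB', hC, ← map_smul]
    congr 1
    rw [← two_smul K B', ← two_smul K C, smul_mul_assoc, mul_smul_comm, smul_smul]; norm_num
  rw [spLin_apply G hxy, spLin_apply G hx, spLin_apply G hy]
  simp only [add_lie, lie_add, assoc_smul_lie, assoc_lie_smul, hG.lie_matSum_M_M, hG.lie_matSum_M_Ep,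
    hG.lie_matSum_M_Fp, hG.lie_matSum_Ep_Fp, hG.lie_matSum_Ep_Ep, hG.lie_matSum_Fp_Fp]
  rw [← lie_skew (matSum K G.Ep B), ← lie_skew (matSum K G.Fp C) (matSum K G.M A'),
    ← lie_skew (matSum K G.Fp C) (matSum K G.Ep B'), hG.lie_matSum_M_Ep, hG.lie_matSum_M_Fp,
    hG.lie_matSum_Ep_Fp, e1, e2]
  simp only [map_add, map_sub]
  match_scalars <;> norm_num

/-- The Lie algebra homomorphism on `sp(n)` determined by the values `G` on the generators. -/
def IsSpFamily.spHom [CharZero K] (hG : IsSpFamily K G Set.univ) : sp K n →ₗ⁅K⁆ R :=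
  { spLin K G with map_lie' := fun {x y} => hG.spLin_lie x y }

lemma half_smul_add_self [CharZero K] {V : Type*} [AddCommGroup V] [Module K V] (v : V) :
    (2⁻¹ : K) • (v + v) = v := by
  rw [← two_smul K v, smul_smul, inv_mul_cancel₀ two_ne_zero, one_smul]

lemma spLin_rootMinus (G : Gens n R) (i j : Fin n) : spLin K G (rootMinus K i j) = G.M i j := by
  rw [spLin_apply G (x := rootMinus K i j) rfl, matSum_single]; simp

lemma IsSpFamily.spLin_rootEplus [CharZero K] (hG : IsSpFamily K G Set.univ) (i j : Fin n) :
    spLin K G (rootEplus K i j) = G.Ep i j := by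
  rw [spLin_apply G (x := rootEplus K i j) rfl, map_add, matSum_single, matSum_single,
    hG.Ep_symm (Set.mem_univ j) (Set.mem_univ i), one_smul, half_smul_add_self]; simp

lemma IsSpFamily.spLin_rootFplus [CharZero K] (hG : IsSpFamily K G Set.univ) (i j : Fin n) :
    spLin K G (rootFplus K i j) = G.Fp i j := by
  rw [spLin_apply G (x := rootFplus K i j) rfl, map_add, matSum_single, matSum_single,
    hG.Fp_symm (Set.mem_univ j) (Set.mem_univ i), one_smul, half_smul_add_self]; simp

lemma spLin_cartan [CharZero K] (G : Gens n R) (i : Fin n) :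
    spLin K G (cartan K i) = G.H i := by
  rw [spLin_apply G (x := cartan K i) rfl, matSum_single, Gens.M_self, two_mul, one_div,
    half_smul_add_self]; simp

end LieHom

end Relations

/-! ### The modified generators satisfy the relations -/

section Modify

open PowerSeries

section Ring

variable {R : Type*} [Ring R]

lemma assoc_lie_mul (a b c : R) : ⁅a, b * c⁆ = ⁅a, b⁆ * c + b * ⁅a, c⁆ := by
  simp only [Ring.lie_def]; noncomm_ring

lemma assoc_mul_lie (a b c : R) : ⁅a * b, c⁆ = a * ⁅b, c⁆ + ⁅a, c⁆ * b := by
  simp only [Ring.lie_def]; noncomm_ring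

lemma lie_eq_zero_of_commute {a b : R} (h : Commute a b) : ⁅a, b⁆ = 0 := by
  rw [Ring.lie_def, h.eq, sub_self]

lemma commute_of_lie_eq_zero {a b : R} (h : ⁅a, b⁆ = 0) : Commute a b := by
  rw [Ring.lie_def, sub_eq_zero] at h; exact h

lemma mul_eq_of_lie {a b c : R} (h : ⁅a, b⁆ = c) : a * b = b * a + c := by
  rw [← h, Ring.lie_def]; abel

lemma lie_X_mul (a b : R⟦X⟧) : ⁅a, X * b⁆ = X * ⁅a, b⁆ := by
  rw [assoc_lie_mul, lie_eq_zero_of_commute (commute_X a), zero_mul, zero_add]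

lemma X_mul_lie (a b : R⟦X⟧) : ⁅X * a, b⁆ = X * ⁅a, b⁆ := by
  rw [assoc_mul_lie, lie_eq_zero_of_commute (commute_X b).symm, zero_mul, add_zero]

end Ring

variable {K : Type*} [Field K] {N : ℕ} {A : Type*} [Ring A] [Algebra K A]

section Sigma

variable (G : Gens N A⟦X⟧) (o : Fin N)

lemma X_dvd_X_mul (a : A⟦X⟧) : (X : A⟦X⟧) ∣ X * a := dvd_mul_right _ _

lemma X_dvd_sigma : (X : A⟦X⟧) ∣ sigma K G o := X_dvd_flogOneAdd _

lemma X_dvd_smul_sigma (c : K) : (X : A⟦X⟧) ∣ c • sigma K G o := X_dvd_smul (X_dvd_sigma G o) c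

lemma expSigma_add [CharZero K] (c d : K) :
    expSigma K G o (c + d) = expSigma K G o c * expSigma K G o d := by
  rw [expSigma, expSigma, expSigma, add_smul, fexp_add (X_dvd_smul_sigma G o c)
    (X_dvd_smul_sigma G o d) (((Commute.refl _).smul_left c).smul_right d)]

lemma expSigma_one [CharZero K] : expSigma K G o (1 : K) = 1 + X * G.Ep o o := by
  rw [expSigma, one_smul, sigma, fexp_flogOneAdd (X_dvd_X_mul _)]

lemma expSigma_zero : expSigma K G o (0 : K) = 1 := by
  rw [expSigma, zero_smul, fexp_zero]

variable {G o}

lemma commute_sigma {z : A⟦X⟧} (h : Commute z (G.Ep o o)) : Commute z (sigma K G o) :=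
  semiconjBy_flogOneAdd (X_dvd_X_mul _) (X_dvd_X_mul _) (Commute.mul_right (commute_X z) h)

lemma commute_expSigma {z : A⟦X⟧} (h : Commute z (G.Ep o o)) (c : K) :
    Commute z (expSigma K G o c) :=
  semiconjBy_fexp (X_dvd_smul_sigma G o c) (X_dvd_smul_sigma G o c)
    ((commute_sigma h).smul_right c)

end Sigma

lemma modify_Ep (G : Gens N A⟦X⟧) (o i j : Fin N) : (modify K G o).Ep i j =
    G.Ep i j - X * (G.Ep o i * G.Ep o j * expSigma K G o (-1)) := rfl

lemma modify_Fp (G : Gens N A⟦X⟧) {o i j : Fin N} (hi : i ≠ o) (hj : j ≠ o) :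
    (modify K G o).Fp i j = G.Fp i j - X * (G.M o i * G.M o j) := by
  rw [G.M_of_ne hi.symm, G.M_of_ne hj.symm]; rfl

namespace IsSpFamily

variable {G : Gens N A⟦X⟧} {s : Set (Fin N)} (hG : IsSpFamily K G s) {o i j l m : Fin N}
  (ho : o ∈ s) (hi : i ∈ s) (hj : j ∈ s) (hl : l ∈ s) (hm : m ∈ s)
  (hio : i ≠ o) (hjo : j ≠ o) (hlo : l ≠ o) (hmo : m ≠ o)

include hG

include hi hj hl hm in
lemma commute_Ep_Ep : Commute (G.Ep i j) (G.Ep l m) :=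
  commute_of_lie_eq_zero (hG.lie_Ep_Ep hi hj hl hm)

include ho

include hi hj hio in
lemma commute_M_Ep_self : Commute (G.M j i) (G.Ep o o) :=
  commute_of_lie_eq_zero (by rw [hG.lie_M_Ep hj hi ho ho, kron_of_ne hio]; simp)

include hi hj hio hjo in
lemma commute_Fp_Ep_self : Commute (G.Fp i j) (G.Ep o o) :=
  (commute_of_lie_eq_zero (by
    rw [hG.lie_Ep_Fp ho ho hi hj, kron_of_ne hio.symm, kron_of_ne hjo.symm]; simp)).symm

include hi hj hl hjo in
lemma lie_M_Ep_left : ⁅G.M i j, G.Ep o l⁆ = kron K j l • G.Ep o i := by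
  rw [hG.lie_M_Ep hi hj ho hl, kron_of_ne hjo, hG.Ep_symm hi ho]; simp

include hi hl hio in
lemma lie_M_left_Ep_left : ⁅G.M o i, G.Ep o l⁆ = kron K i l • G.Ep o o := by
  rw [hG.lie_M_Ep ho hi ho hl, kron_of_ne hio]; simp

include hi hj hl hio hjo hlo in
lemma lie_M_M_left : ⁅G.M i j, G.M o l⁆ = -(kron K i l • G.M o j) := by
  rw [hG.lie_M_M hi hj ho hl, kron_of_ne hjo, kron_comm l i]; simp

include hi hl hio hlo in
lemma commute_M_left_M_left : Commute (G.M o i) (G.M o l) :=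
  commute_of_lie_eq_zero (by
    rw [hG.lie_M_M ho hi ho hl, kron_of_ne hio, kron_of_ne hlo]; simp)

include hi hj hl hio hjo in
lemma lie_Ep_left_Fp : ⁅G.Ep o l, G.Fp i j⁆ = kron K l i • G.M o j + kron K l j • G.M o i := by
  rw [hG.lie_Ep_Fp ho hl hi hj, kron_of_ne hio.symm, kron_of_ne hjo.symm]; simp

include hi hj hl hio hjo in
lemma commute_M_left_Fp : Commute (G.M o l) (G.Fp i j) :=
  commute_of_lie_eq_zero (by
    rw [hG.lie_M_Fp ho hl hi hj, kron_of_ne hio.symm, kron_of_ne hjo.symm]; simp)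

include hi hj hl in
lemma lie_M_left_Ep : ⁅G.M o l, G.Ep i j⁆ = kron K l i • G.Ep o j + kron K l j • G.Ep o i :=
  hG.lie_M_Ep ho hl hi hj

include hi hj hl hm hio hjo hlo hmo in
-- Write w_i = [E_{o+i}, F_{l+m}], Z = E_{o+i}w_j + w_iE_{o+j} and e = e^{-σ}. The two mixed
-- brackets are Ze and -Z, and the bracket of the two corrections is -ZeE_{o+o}. Together they
-- contribute X(Z - Ze - X ZeE_{o+o}), which is zero because (1 + X E_{o+o})e = 1. This cancellation
-- dictates the factor e^{-σ} in the modification.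
lemma lie_modify_Ep_modify_Fp [CharZero K] :
    ⁅(modify K G o).Ep i j, (modify K G o).Fp l m⁆ = ⁅G.Ep i j, G.Fp l m⁆ := by
  set e := expSigma K G o (-1 : K) with he
  have hpe : (1 + X * G.Ep o o) * e = 1 := by
    rw [he, ← expSigma_one (K := K), ← expSigma_add, add_neg_cancel, expSigma_zero]
  have eQ : Commute e (G.Fp l m) :=
    (commute_expSigma (hG.commute_Fp_Ep_self ho hl hm hlo hmo) _).symm
  have ey : ∀ {i}, i ∈ s → i ≠ o → Commute e (G.M o i) := fun h h' =>
    (commute_expSigma (hG.commute_M_Ep_self ho h ho h') _).symm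
  have ex : ∀ {i}, i ∈ s → Commute e (G.Ep o i) := fun h =>
    (commute_expSigma (hG.commute_Ep_Ep ho h ho ho) _).symm
  have py : ∀ {i}, i ∈ s → i ≠ o → Commute (G.Ep o o) (G.M o i) := fun h h' =>
    (hG.commute_M_Ep_self ho h ho h').symm
  have px : ∀ {i}, i ∈ s → Commute (G.Ep o o) (G.Ep o i) := fun h => hG.commute_Ep_Ep ho ho ho h
  set w : Fin N → A⟦X⟧ := fun i => kron K i l • G.M o m + kron K i m • G.M o l with hw
  have ew : ∀ i, Commute e (w i) := fun i =>
    ((ey hm hmo).smul_right _).add_right ((ey hl hlo).smul_right _)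
  have pw : ∀ i, Commute (G.Ep o o) (w i) := fun i =>
    ((py hm hmo).smul_right _).add_right ((py hl hlo).smul_right _)
  have h1 : ⁅G.Ep o i * G.Ep o j * e, G.Fp l m⁆ =
      (G.Ep o i * w j + w i * G.Ep o j) * e := by
    rw [assoc_mul_lie, lie_eq_zero_of_commute eQ, mul_zero, zero_add, assoc_mul_lie,
      hG.lie_Ep_left_Fp ho hl hm hj hlo hmo, hG.lie_Ep_left_Fp ho hl hm hi hlo hmo]
  have hxy : ∀ {i}, i ∈ s → ⁅G.Ep o i, G.M o l * G.M o m⁆ = -(w i * G.Ep o o) := by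
    intro i hi
    rw [assoc_lie_mul, ← lie_skew, ← lie_skew (G.Ep o i), hG.lie_M_left_Ep_left ho hl hi hlo,
      hG.lie_M_left_Ep_left ho hm hi hmo, hw]
    simp only [neg_mul, mul_neg, smul_mul_assoc, mul_smul_comm, add_mul, (py hm hmo).eq,
      kron_comm i l, kron_comm i m]
    module
  have h2 : ⁅G.Ep o i * G.Ep o j * e, G.M o l * G.M o m⁆ =
      -((G.Ep o i * w j + w i * G.Ep o j) * e * G.Ep o o) := by
    rw [assoc_mul_lie, lie_eq_zero_of_commute ((ey hl hlo).mul_right (ey hm hmo)), mul_zero,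
      zero_add, assoc_mul_lie, hxy hi, hxy hj, neg_mul, mul_neg, mul_assoc (w i),
      (px hj).eq, mul_assoc _ e, (ex ho).eq]
    noncomm_ring
  have h3 : ⁅G.Ep i j, G.M o l * G.M o m⁆ = -(G.Ep o i * w j + w i * G.Ep o j) := by
    rw [assoc_lie_mul, ← lie_skew, ← lie_skew (G.Ep i j), hG.lie_M_left_Ep ho hi hj hl,
      hG.lie_M_left_Ep ho hi hj hm]
    have c : ∀ {i l}, i ∈ s → l ∈ s → l ≠ o →
        G.M o l * G.Ep o i = G.Ep o i * G.M o l + kron K l i • G.Ep o o := fun hi hl hlo =>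
      mul_eq_of_lie (hG.lie_M_left_Ep_left ho hl hi hlo)
    simp only [hw, neg_mul, mul_neg, smul_mul_assoc, mul_smul_comm, add_mul, mul_add,
      c hj hm hmo, c hi hl hlo, c hj hl hlo, kron_comm i l, kron_comm i m,
      kron_comm j l, kron_comm j m]
    module
  rw [modify_Ep, modify_Fp G hlo hmo, sub_lie, lie_sub, lie_sub, lie_X_mul, X_mul_lie, X_mul_lie,
    lie_X_mul, h1, h2, h3]
  have hZ : ∀ Z : A⟦X⟧, Z = Z * e + X * (Z * e * G.Ep o o) := by
    intro Z
    conv_lhs => rw [← mul_one Z, ← hpe, add_mul, one_mul, mul_add, mul_assoc X, ← (ex ho).eq,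
      ← mul_assoc, (commute_X Z).eq, mul_assoc X, ← mul_assoc Z]
  have hZ' := hZ (G.Ep o i * w j + w i * G.Ep o j)
  generalize G.Ep o i * w j + w i * G.Ep o j = Z at hZ'
  conv_lhs => enter [1, 2, 2, 1]; rw [hZ']
  noncomm_ring

include hi hj hl hm hio hjo hlo hmo in
-- For i, j ≠ o the element M_{ij} commutes with σ and acts on the E_{o+l} as on a vector. The
-- correction, a product of two such vectors, obeys the same tensor law as E_{l+m} itself. For Fp
-- the same holds with the covectors M_{ol}.
lemma lie_M_modify_Ep : ⁅G.M i j, (modify K G o).Ep l m⁆ =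
    kron K j l • (modify K G o).Ep i m + kron K j m • (modify K G o).Ep i l := by
  have eM : Commute (G.M i j) (expSigma K G o (-1 : K)) :=
    commute_expSigma (hG.commute_M_Ep_self ho hj hi hjo) _
  rw [modify_Ep, lie_sub, lie_X_mul, assoc_lie_mul, assoc_lie_mul, lie_eq_zero_of_commute eM,
    mul_zero, add_zero, hG.lie_M_Ep hi hj hl hm, hG.lie_M_Ep_left ho hi hj hl hjo,
    hG.lie_M_Ep_left ho hi hj hm hjo, modify_Ep, modify_Ep, mul_smul_comm,
    (hG.commute_Ep_Ep ho hl ho hi).eq]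
  simp only [add_mul, mul_add, smul_mul_assoc, mul_smul_comm, smul_sub]
  abel

include hi hj hl hm hio hjo hlo hmo in
lemma lie_M_modify_Fp : ⁅G.M i j, (modify K G o).Fp l m⁆ =
    -(kron K i l • (modify K G o).Fp j m + kron K i m • (modify K G o).Fp j l) := by
  rw [modify_Fp G hlo hmo, modify_Fp G hjo hmo, modify_Fp G hjo hlo, lie_sub, lie_X_mul,
    assoc_lie_mul, hG.lie_M_Fp hi hj hl hm, hG.lie_M_M_left ho hi hj hl hio hjo hlo,
    hG.lie_M_M_left ho hi hj hm hio hjo hmo, mul_neg, mul_smul_comm,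
    (hG.commute_M_left_M_left ho hl hj hlo hjo).eq]
  simp only [neg_mul, mul_add, smul_mul_assoc, mul_smul_comm, smul_sub, mul_neg]
  abel

include hi hj hl hm in
lemma lie_modify_Ep_modify_Ep :
    ⁅(modify K G o).Ep i j, (modify K G o).Ep l m⁆ = 0 := by
  have key : ∀ {i j}, i ∈ s → j ∈ s → ∀ {z}, (∀ {a b}, a ∈ s → b ∈ s → Commute z (G.Ep a b)) →
      Commute z ((modify K G o).Ep i j) := fun hi hj z hz =>
    (hz hi hj).sub_right (Commute.mul_right (commute_X z) (((hz ho hi).mul_right (hz ho hj)).mul_right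
      (commute_expSigma (hz ho ho) _)))
  exact lie_eq_zero_of_commute (key hl hm fun ha hb =>
    (key hi hj fun hc hd => hG.commute_Ep_Ep ha hb hc hd).symm)

include hi hj hl hm hio hjo hlo hmo in
lemma lie_modify_Fp_modify_Fp :
    ⁅(modify K G o).Fp i j, (modify K G o).Fp l m⁆ = 0 := by
  have hFF : Commute (G.Fp i j) (G.Fp l m) := commute_of_lie_eq_zero (hG.lie_Fp_Fp hi hj hl hm)
  have hMF : ∀ {i j l}, i ∈ s → j ∈ s → l ∈ s → i ≠ o → j ≠ o → Commute (G.M o l) (G.Fp i j) :=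
    fun hi hj hl hio hjo => hG.commute_M_left_Fp ho hi hj hl hio hjo
  have hMM : ∀ {i l}, i ∈ s → l ∈ s → i ≠ o → l ≠ o → Commute (G.M o i) (G.M o l) :=
    fun hi hl hio hlo => hG.commute_M_left_M_left ho hi hl hio hlo
  rw [modify_Fp G hio hjo, modify_Fp G hlo hmo]
  refine lie_eq_zero_of_commute (Commute.sub_left (Commute.sub_right hFF
    (Commute.mul_right (commute_X _) ?_)) (Commute.mul_left (commute_X _).symm
    (Commute.sub_right ?_ (Commute.mul_right (commute_X _) ?_))))
  · exact ((hMF hi hj hl hio hjo).mul_left (hMF hi hj hm hio hjo)).symm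
  · exact (hMF hl hm hi hlo hmo).mul_left (hMF hl hm hj hlo hmo)
  · exact ((hMM hi hl hio hlo).mul_right (hMM hi hm hio hmo)).mul_left
      ((hMM hj hl hjo hlo).mul_right (hMM hj hm hjo hmo))

/-- The modified generators satisfy the commutation relations of a smaller symplectic algebra. -/
theorem modify [CharZero K] {t : Set (Fin N)} (ht : ∀ i ∈ t, i ∈ s ∧ i ≠ o) :
    IsSpFamily K (modify K G o) t where
  Ep_symm {i j} hi hj := by
    rw [modify_Ep, modify_Ep, hG.Ep_symm (ht i hi).1 (ht j hj).1,
      (hG.commute_Ep_Ep ho (ht i hi).1 ho (ht j hj).1).eq]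
  Fp_symm {i j} hi hj := by
    rw [modify_Fp G (ht i hi).2 (ht j hj).2, modify_Fp G (ht j hj).2 (ht i hi).2,
      hG.Fp_symm (ht i hi).1 (ht j hj).1, (hG.commute_M_left_M_left ho (ht i hi).1 (ht j hj).1
        (ht i hi).2 (ht j hj).2).eq]
  lie_M_M {i j l m} hi hj hl hm := hG.lie_M_M (ht i hi).1 (ht j hj).1 (ht l hl).1 (ht m hm).1
  lie_M_Ep {i j l m} hi hj hl hm := hG.lie_M_modify_Ep ho (ht i hi).1 (ht j hj).1 (ht l hl).1
    (ht m hm).1 (ht i hi).2 (ht j hj).2 (ht l hl).2 (ht m hm).2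
  lie_M_Fp {i j l m} hi hj hl hm := hG.lie_M_modify_Fp ho (ht i hi).1 (ht j hj).1 (ht l hl).1
    (ht m hm).1 (ht i hi).2 (ht j hj).2 (ht l hl).2 (ht m hm).2
  lie_Ep_Fp {i j l m} hi hj hl hm := by
    rw [hG.lie_modify_Ep_modify_Fp ho (ht i hi).1 (ht j hj).1 (ht l hl).1
      (ht m hm).1 (ht i hi).2 (ht j hj).2 (ht l hl).2 (ht m hm).2]
    exact hG.lie_Ep_Fp (ht i hi).1 (ht j hj).1 (ht l hl).1 (ht m hm).1
  lie_Ep_Ep {i j l m} hi hj hl hm := hG.lie_modify_Ep_modify_Ep ho (ht i hi).1 (ht j hj).1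
    (ht l hl).1 (ht m hm).1
  lie_Fp_Fp {i j l m} hi hj hl hm := hG.lie_modify_Fp_modify_Fp ho (ht i hi).1 (ht j hj).1
    (ht l hl).1 (ht m hm).1 (ht i hi).2 (ht j hj).2 (ht l hl).2 (ht m hm).2

end IsSpFamily

lemma gens_succ (k : Fin N) : gens K N (k + 1) = modify K (gens K N k) k := by
  rw [gens, dif_pos k.2]

/-- The `k` times modified generators satisfy the commutation relations. -/
theorem isSpFamily_gens [CharZero K] {k : ℕ} (hk : k ≤ N) :
    IsSpFamily K (gens K N k) {i | k ≤ i.val} := by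
  induction k with
  | zero => exact isSpFamily_gens₀ _
  | succ k ih =>
    rw [gens_succ ⟨k, hk⟩]
    refine (ih (by omega)).modify (by simp) fun i hi => ⟨?_, ?_⟩
    · simp only [Set.mem_ofPred_eq] at hi ⊢; omega
    · rintro rfl; simp at hi

end Modify

/-! ### Pairs of commuting embeddings and the twisting link -/

section LegPair

open PowerSeries

variable {K : Type*} [Field K] {N : ℕ} {A B C : Type*} [Ring A] [Algebra K A] [Ring B] [Algebra K B]
  [Ring C] [Algebra K C]

variable (K A B) in
/-- Two homomorphisms with commuting ranges, like `a ↦ a ⊗ 1` and `a ↦ 1 ⊗ a`. -/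
structure LegPair where
  fst : A⟦X⟧ →ₐ[K] B⟦X⟧
  snd : A⟦X⟧ →ₐ[K] B⟦X⟧
  fst_X : fst X = X
  snd_X : snd X = X
  commute : ∀ a b, Commute (fst a) (snd b)

namespace LegPair

variable (P : LegPair K A B)

/-- The image of `a ⊗ b`. -/
def t (a b : A⟦X⟧) : B⟦X⟧ := P.fst a * P.snd b

lemma t_mul_t (a b c d : A⟦X⟧) : P.t a b * P.t c d = P.t (a * c) (b * d) := by
  simp only [t, map_mul]
  rw [mul_assoc, ← mul_assoc (P.snd b), ← (P.commute c b).eq]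
  simp only [mul_assoc]

lemma t_add_left (a b c : A⟦X⟧) : P.t (a + b) c = P.t a c + P.t b c := by simp [t, add_mul]

lemma t_add_right (a b c : A⟦X⟧) : P.t a (b + c) = P.t a b + P.t a c := by simp [t, mul_add]

lemma t_sub_left (a b c : A⟦X⟧) : P.t (a - b) c = P.t a c - P.t b c := by simp [t, sub_mul]

lemma t_sub_right (a b c : A⟦X⟧) : P.t a (b - c) = P.t a b - P.t a c := by simp [t, mul_sub]

lemma t_neg_right (a c : A⟦X⟧) : P.t a (-c) = -P.t a c := by simp [t]

lemma t_smul_left (r : K) (a c : A⟦X⟧) : P.t (r • a) c = r • P.t a c := by simp [t]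

lemma t_smul_right (r : K) (a c : A⟦X⟧) : P.t a (r • c) = r • P.t a c := by simp [t]

lemma t_X_mul_left (a c : A⟦X⟧) : P.t (X * a) c = X * P.t a c := by
  simp [t, P.fst_X, mul_assoc]

lemma t_X_mul_right (a c : A⟦X⟧) : P.t a (X * c) = X * P.t a c := by
  simp only [t, map_mul, P.snd_X]
  rw [← mul_assoc, (commute_X _).eq, mul_assoc]

lemma t_zero_left (c : A⟦X⟧) : P.t 0 c = 0 := by simp [t]

lemma t_zero_right (c : A⟦X⟧) : P.t c 0 = 0 := by simp [t]

lemma t_one_right (a : A⟦X⟧) : P.t a 1 = P.fst a := by simp [t]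

lemma t_one_left (a : A⟦X⟧) : P.t 1 a = P.snd a := by simp [t]

lemma commute_t {a b c d : A⟦X⟧} (h : Commute a c) (h' : Commute b d) :
    Commute (P.t a b) (P.t c d) := by
  rw [Commute, SemiconjBy, t_mul_t, t_mul_t, h.eq, h'.eq]

lemma lie_t_of_commute_right {b d : A⟦X⟧} (a c : A⟦X⟧) (h : Commute b d) :
    ⁅P.t a b, P.t c d⁆ = P.t ⁅a, c⁆ (b * d) := by
  rw [Ring.lie_def, t_mul_t, t_mul_t, Ring.lie_def, t_sub_left, h.eq]

lemma lie_t_of_commute_left {a c : A⟦X⟧} (b d : A⟦X⟧) (h : Commute a c) :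
    ⁅P.t a b, P.t c d⁆ = P.t (a * c) ⁅b, d⁆ := by
  rw [Ring.lie_def, t_mul_t, t_mul_t, Ring.lie_def, t_sub_right, h.eq]

lemma X_dvd_t_right {b : A⟦X⟧} (h : (X : A⟦X⟧) ∣ b) (a : A⟦X⟧) : (X : B⟦X⟧) ∣ P.t a b := by
  obtain ⟨c, rfl⟩ := h
  exact ⟨P.t a c, P.t_X_mul_right a c⟩

/-- Composition with a further homomorphism. -/
def map (Ψ : B⟦X⟧ →ₐ[K] C⟦X⟧) (hΨ : Ψ X = X) : LegPair K A C where
  fst := Ψ.comp P.fst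
  snd := Ψ.comp P.snd
  fst_X := by simp [P.fst_X, hΨ]
  snd_X := by simp [P.snd_X, hΨ]
  commute a b := (P.commute a b).map Ψ

lemma map_t (Ψ : B⟦X⟧ →ₐ[K] C⟦X⟧) (hΨ : Ψ X = X) (a b : A⟦X⟧) :
    (P.map Ψ hΨ).t a b = Ψ (P.t a b) := by simp [t, map]

variable (G : Gens N A⟦X⟧) (o : Fin N) (J : Finset (Fin N))

/-- The exponent of the extension factor. -/
def extSum : B⟦X⟧ := ∑ m ∈ J, X * P.t (G.M o m) (G.Ep o m * expSigma K G o (-1 / 2 : K))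

/-- The extended jordanian twist on the legs of `P`, as a product of two exponentials. -/
def link : B⟦X⟧ := fexp K (P.extSum G o J) * fexp K (P.t (G.H o) (sigma K G o))

lemma X_dvd_extSum : (X : B⟦X⟧) ∣ P.extSum G o J :=
  Finset.dvd_sum fun _ _ => dvd_mul_right _ _

lemma X_dvd_t_sigma : (X : B⟦X⟧) ∣ P.t (G.H o) (sigma K G o) :=
  P.X_dvd_t_right (X_dvd_sigma G o) _

lemma isUnit_link [CharZero K] : IsUnit (P.link G o J) :=
  (isUnit_fexp (P.X_dvd_extSum G o J)).mul (isUnit_fexp (P.X_dvd_t_sigma G o))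

lemma map_link (Ψ : B⟦X⟧ →ₐ[K] C⟦X⟧) (hΨ : Ψ X = X) :
    (P.map Ψ hΨ).link G o J = Ψ (P.link G o J) := by
  rw [link, link, map_mul, map_fexp hΨ (P.X_dvd_extSum G o J), map_fexp hΨ (P.X_dvd_t_sigma G o),
    extSum, extSum, map_sum, map_t]
  simp only [map_mul, hΨ, map_t]

lemma lie_extSum_of_commute_right {d : A⟦X⟧} (c : A⟦X⟧)
    (h : ∀ m ∈ J, Commute (G.Ep o m * expSigma K G o (-1 / 2 : K)) d) :
    ⁅P.extSum G o J, P.t c d⁆ =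
      ∑ m ∈ J, X * P.t ⁅G.M o m, c⁆ (G.Ep o m * expSigma K G o (-1 / 2 : K) * d) := by
  rw [extSum, sum_lie]
  exact Finset.sum_congr rfl fun m hm => by rw [X_mul_lie, P.lie_t_of_commute_right _ _ (h m hm)]

lemma lie_extSum_of_commute_left {c : A⟦X⟧} (d : A⟦X⟧) (h : ∀ m ∈ J, Commute (G.M o m) c) :
    ⁅P.extSum G o J, P.t c d⁆ =
      ∑ m ∈ J, X * P.t (G.M o m * c) ⁅G.Ep o m * expSigma K G o (-1 / 2 : K), d⁆ := by
  rw [extSum, sum_lie]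
  exact Finset.sum_congr rfl fun m hm => by rw [X_mul_lie, P.lie_t_of_commute_left _ _ (h m hm)]

lemma commute_extSum {c d : A⟦X⟧} (h : ∀ m ∈ J, Commute (G.M o m) c)
    (h' : ∀ m ∈ J, Commute (G.Ep o m * expSigma K G o (-1 / 2 : K)) d) :
    Commute (P.extSum G o J) (P.t c d) :=
  Commute.sum_left _ _ _ fun m hm => Commute.mul_left (commute_X _).symm
    (P.commute_t (h m hm) (h' m hm))

variable {G o}

lemma fexp_t_sigma_mul_snd [CharZero K] {d : A⟦X⟧} (h : Commute d (G.Ep o o)) :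
    fexp K (P.t (G.H o) (sigma K G o)) * P.t 1 d =
      P.t 1 d * fexp K (P.t (G.H o) (sigma K G o)) :=
  (semiconjBy_fexp (P.X_dvd_t_sigma G o) (P.X_dvd_t_sigma G o)
    (P.commute_t (Commute.one_left _) (commute_sigma h))).eq.symm

/-- Since H c = c(H + r), the element c ⊗ 1 intertwines H ⊗ σ + r(1 ⊗ σ) with H ⊗ σ. The two
summands commute, so the exponential of the sum factors and releases 1 ⊗ e^{rσ}. -/
lemma fexp_t_sigma_mul_fst [CharZero K] {c : A⟦X⟧} {r : K} (h : ⁅G.H o, c⁆ = r • c) :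
    fexp K (P.t (G.H o) (sigma K G o)) * P.t c 1 =
      P.t c (expSigma K G o r) * fexp K (P.t (G.H o) (sigma K G o)) := by
  have hd : (X : B⟦X⟧) ∣ P.t 1 (r • sigma K G o) := P.X_dvd_t_right (X_dvd_smul_sigma G o r) _
  have hs : SemiconjBy (P.t c 1) (P.t 1 (r • sigma K G o) + P.t (G.H o) (sigma K G o))
      (P.t (G.H o) (sigma K G o)) := by
    have := mul_eq_of_lie h
    rw [SemiconjBy, mul_add, t_mul_t, t_mul_t, t_mul_t, this, t_add_left, t_smul_left]
    simp only [mul_one, one_mul, t_smul_right]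
    abel
  have h1 := (semiconjBy_fexp (K := K) (dvd_add hd (P.X_dvd_t_sigma G o)) (P.X_dvd_t_sigma G o) hs).eq
  rw [fexp_add hd (P.X_dvd_t_sigma G o) (P.commute_t (Commute.one_left _)
    (Commute.smul_left (Commute.refl _) r)), t_one_left, ← map_fexp P.snd_X
    (X_dvd_smul_sigma G o r)] at h1
  rw [← h1, ← mul_assoc]
  congr 1
  rw [t_one_right, t, expSigma]

end LegPair

end LegPair

/-! ### Conjugation of primitive coproducts by one link. -/

section Link

open PowerSeries

variable {K : Type*} [Field K] [CharZero K] {N : ℕ} {A B : Type*} [Ring A] [Algebra K A]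
  [Ring B] [Algebra K B]

namespace IsSpFamily

variable {G : Gens N A⟦X⟧} {s : Set (Fin N)} (hG : IsSpFamily K G s) {o i j : Fin N}
  (ho : o ∈ s)

omit [CharZero K] in
lemma two_smul_H (G : Gens N A⟦X⟧) (i : Fin N) : G.M i i = (2 : K) • G.H i := by
  rw [Gens.M_self, two_smul, two_mul]

lemma H_eq (G : Gens N A⟦X⟧) (i : Fin N) : G.H i = (2⁻¹ : K) • G.M i i := by
  rw [two_smul_H (K := K), smul_smul, inv_mul_cancel₀ two_ne_zero, one_smul]

include hG ho

lemma lie_H_Ep_self : ⁅G.H o, G.Ep o o⁆ = (1 : K) • G.Ep o o := by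
  rw [H_eq (K := K), assoc_smul_lie, hG.lie_M_Ep ho ho ho ho, kron_self, one_smul,
    half_smul_add_self]

lemma lie_H_Ep_left (hi : i ∈ s) (hio : i ≠ o) : ⁅G.H o, G.Ep o i⁆ = (1 / 2 : K) • G.Ep o i := by
  rw [H_eq (K := K), assoc_smul_lie, hG.lie_M_Ep ho ho ho hi, kron_self, kron_of_ne hio.symm]
  simp

lemma lie_H_M_left (hi : i ∈ s) (hio : i ≠ o) : ⁅G.H o, G.M o i⁆ = (1 / 2 : K) • G.M o i := by
  rw [H_eq (K := K), assoc_smul_lie, hG.lie_M_M ho ho ho hi, kron_self, kron_of_ne hio]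
  simp

lemma lie_H_M (hi : i ∈ s) (hio : i ≠ o) (hj : j ∈ s) (hjo : j ≠ o) :
    ⁅G.H o, G.M i j⁆ = (0 : K) • G.M i j := by
  rw [H_eq (K := K), assoc_smul_lie, hG.lie_M_M ho ho hi hj, kron_of_ne hio.symm, kron_of_ne hjo]
  simp

lemma lie_H_Ep (hi : i ∈ s) (hio : i ≠ o) (hj : j ∈ s) (hjo : j ≠ o) :
    ⁅G.H o, G.Ep i j⁆ = (0 : K) • G.Ep i j := by
  rw [H_eq (K := K), assoc_smul_lie, hG.lie_M_Ep ho ho hi hj, kron_of_ne hio.symm,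
    kron_of_ne hjo.symm]
  simp

lemma lie_H_Fp (hi : i ∈ s) (hio : i ≠ o) (hj : j ∈ s) (hjo : j ≠ o) :
    ⁅G.H o, G.Fp i j⁆ = (0 : K) • G.Fp i j := by
  rw [H_eq (K := K), assoc_smul_lie, hG.lie_M_Fp ho ho hi hj, kron_of_ne hio.symm,
    kron_of_ne hjo.symm]
  simp

variable (P : LegPair K A B) {J : Finset (Fin N)} (hJ : ∀ m ∈ J, m ∈ s ∧ m ≠ o)

omit [CharZero K] in
lemma commute_Ep_left_expSigma (hi : i ∈ s) (c : K) : Commute (G.Ep o i) (expSigma K G o c) :=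
  commute_expSigma (hG.commute_Ep_Ep ho hi ho ho) c

omit [CharZero K] in
lemma commute_M_left_expSigma (hi : i ∈ s) (hio : i ≠ o) (c : K) :
    Commute (G.M o i) (expSigma K G o c) :=
  commute_expSigma (hG.commute_M_Ep_self ho hi ho hio) c

omit [CharZero K] hG ho in
lemma commute_expSigma_expSigma (c d : K) : Commute (expSigma K G o c) (expSigma K G o d) :=
  (commute_expSigma (commute_expSigma (Commute.refl _) c).symm d)

omit [CharZero K] hG in
/-- An element commuting with all `E_{o+m}` commutes with the second legs. -/
lemma commute_second_leg {d : A⟦X⟧} (hd : ∀ m ∈ s, Commute (G.Ep o m) d) {m : Fin N} (hm : m ∈ s)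
    (c : K) : Commute (G.Ep o m * expSigma K G o c) d :=
  (hd m hm).mul_left (commute_expSigma (hd o ho).symm c).symm

include hJ

omit [CharZero K] hG ho hJ in
lemma sum_X_mul_t_kron (hi : i ∈ J) (z : A⟦X⟧) (f : Fin N → A⟦X⟧) :
    ∑ m ∈ J, X * P.t (kron K m i • z) (f m) = X * P.t z (f i) := by
  simp only [P.t_smul_left, mul_smul_comm]
  exact sum_kron_smul J hi (fun m => X * P.t z (f m))

omit hG ho hJ in
-- The jordanian factor acts before the extension factor: it turns z₀ into z, after which the
-- iterated brackets with the extension exponent are w, 2v and 0.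
lemma link_mul_of_lie {z₀ z w v : B⟦X⟧}
    (h₀ : fexp K (P.t (G.H o) (sigma K G o)) * z₀ = z * fexp K (P.t (G.H o) (sigma K G o)))
    (hz : ⁅P.extSum G o J, z⁆ = w) (hw : ⁅P.extSum G o J, w⁆ = 2 * v)
    (hv : ⁅P.extSum G o J, v⁆ = 0) :
    P.link G o J * z₀ = (z + w + v) * P.link G o J := by
  rw [LegPair.link, mul_assoc, h₀, ← mul_assoc, fexp_mul_of_lie (P.X_dvd_extSum G o J)
    (mul_eq_of_lie hz) (mul_eq_of_lie hw) (commute_of_lie_eq_zero hv), mul_assoc]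

lemma lie_extSum_eq_zero {c d : A⟦X⟧} (hc : ∀ m ∈ J, Commute (G.M o m) c)
    (hd : ∀ m ∈ s, Commute (G.Ep o m) d) : ⁅P.extSum G o J, P.t c d⁆ = 0 :=
  lie_eq_zero_of_commute (P.commute_extSum G o J hc
    fun m hm => IsSpFamily.commute_second_leg ho hd (hJ m hm).1 _)

lemma lie_extSum_Ep_left (hi : i ∈ J) {d : A⟦X⟧} (hd : ∀ m ∈ s, Commute (G.Ep o m) d) :
    ⁅P.extSum G o J, P.t (G.Ep o i) d⁆ =
      X * P.t (G.Ep o o) (G.Ep o i * expSigma K G o (-1 / 2 : K) * d) := by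
  rw [P.lie_extSum_of_commute_right G o J _
    fun m hm => IsSpFamily.commute_second_leg ho hd (hJ m hm).1 _]
  rw [← sum_X_mul_t_kron (K := K) P hi (G.Ep o o)
    (fun m => G.Ep o m * expSigma K G o (-1 / 2 : K) * d)]
  refine Finset.sum_congr rfl fun m hm => ?_
  rw [hG.lie_M_left_Ep_left ho (hJ m hm).1 (hJ i hi).1 (hJ m hm).2]

lemma lie_extSum_M_right (hi : i ∈ J) {c : A⟦X⟧} (hc : ∀ m ∈ J, Commute (G.M o m) c) (r : K) :
    ⁅P.extSum G o J, P.t c (G.M o i * expSigma K G o r)⁆ =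
      -(X * P.t (G.M o i * c) (G.Ep o o * expSigma K G o (-1 / 2 + r))) := by
  have hy := hG.commute_M_left_expSigma ho (hJ i hi).1 (hJ i hi).2 (-1 / 2 : K)
  rw [P.lie_extSum_of_commute_left G o J _ hc]
  have := sum_kron_smul (K := K) J hi (fun m => -(X * P.t (G.M o m * c)
    (G.Ep o o * expSigma K G o (-1 / 2 + r))))
  refine Eq.trans (Finset.sum_congr rfl fun m hm => ?_) this
  have h1 : ⁅G.Ep o m, G.M o i⁆ = -(kron K i m • G.Ep o o) := by
    rw [← lie_skew, hG.lie_M_left_Ep_left ho (hJ i hi).1 (hJ m hm).1 (hJ i hi).2]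
  rw [assoc_mul_lie, assoc_lie_mul, assoc_lie_mul, lie_eq_zero_of_commute hy.symm, h1,
    lie_eq_zero_of_commute (commute_expSigma_expSigma _ _),
    lie_eq_zero_of_commute (hG.commute_Ep_left_expSigma ho (hJ m hm).1 r), expSigma_add,
    (commute_expSigma_expSigma (-1 / 2 : K) r).eq, kron_comm i m]
  simp only [zero_mul, mul_zero, add_zero, zero_add, neg_mul, smul_mul_assoc, P.t_neg_right,
    P.t_smul_right, mul_neg, mul_smul_comm, smul_neg, mul_assoc]

/-- E_{o+o} has weight 1 under H and commutes with everything in the extension exponent, so only the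
jordanian factor acts. -/
lemma link_mul_Ep_self : P.link G o J * (P.t (G.Ep o o) 1 + P.t 1 (G.Ep o o)) =
    (P.t (G.Ep o o) (expSigma K G o (1 : K)) + P.t 1 (G.Ep o o)) * P.link G o J := by
  have hT : ⁅P.extSum G o J, P.t (G.Ep o o) (expSigma K G o (1 : K)) + P.t 1 (G.Ep o o)⁆ = 0 := by
    rw [lie_add, hG.lie_extSum_eq_zero ho P hJ
        (fun m hm => hG.commute_M_Ep_self ho (hJ m hm).1 ho (hJ m hm).2)
        (fun m hm => hG.commute_Ep_left_expSigma ho hm _),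
      hG.lie_extSum_eq_zero ho P hJ (fun m hm => Commute.one_right _)
        (fun m hm => hG.commute_Ep_Ep ho hm ho ho), add_zero]
  have := link_mul_of_lie (o := o) (J := J) P (z₀ := P.t (G.Ep o o) 1 + P.t 1 (G.Ep o o)) (v := 0)
    (by rw [mul_add, P.fexp_t_sigma_mul_fst (hG.lie_H_Ep_self ho),
      P.fexp_t_sigma_mul_snd (Commute.refl _), ← add_mul]) hT (by simp) (by simp)
  rwa [add_zero, add_zero] at this

/-- Weight 1/2 produces e^{σ/2}. The bracket with the extension exponent adds X E_{o+o} ⊗ E_{o+i},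
which completes 1 ⊗ E_{o+i} to e^σ ⊗ E_{o+i}. -/
lemma link_mul_Ep_left (hi : i ∈ J) : P.link G o J * (P.t (G.Ep o i) 1 + P.t 1 (G.Ep o i)) =
    (P.t (G.Ep o i) (expSigma K G o (1 / 2 : K)) + P.t (expSigma K G o (1 : K)) (G.Ep o i))
      * P.link G o J := by
  have his := (hJ i hi).1
  have hio := (hJ i hi).2
  have hT : ⁅P.extSum G o J, P.t (G.Ep o i) (expSigma K G o (1 / 2 : K)) + P.t 1 (G.Ep o i)⁆ =
      X * P.t (G.Ep o o) (G.Ep o i) := by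
    rw [lie_add, hG.lie_extSum_Ep_left ho P hJ hi
        (fun m hm => hG.commute_Ep_left_expSigma ho hm _),
      hG.lie_extSum_eq_zero ho P hJ (fun m hm => Commute.one_right _)
        (fun m hm => hG.commute_Ep_Ep ho hm ho his), add_zero, mul_assoc, ← expSigma_add,
      show (-1 / 2 + 1 / 2 : K) = 0 by norm_num, expSigma_zero, mul_one]
  have := link_mul_of_lie (o := o) (J := J) P (z₀ := P.t (G.Ep o i) 1 + P.t 1 (G.Ep o i)) (v := 0)
    (by rw [mul_add, P.fexp_t_sigma_mul_fst (hG.lie_H_Ep_left ho his hio),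
      P.fexp_t_sigma_mul_snd (hG.commute_Ep_Ep ho his ho ho), ← add_mul]) hT
    (by rw [lie_X_mul, hG.lie_extSum_eq_zero ho P hJ
        (fun m hm => hG.commute_M_Ep_self ho (hJ m hm).1 ho (hJ m hm).2)
        (fun m hm => hG.commute_Ep_Ep ho hm ho his)]; simp) (by simp)
  rw [this, expSigma_one, P.t_add_left, P.t_X_mul_left]
  congr 1
  abel

/-- The weight again gives e^{σ/2}, but now the bracket is subtracted in the second leg: e^{σ/2} - X
E_{o+o}e^{-σ/2} = e^{-σ/2}. -/
lemma link_mul_M_left (hi : i ∈ J) : P.link G o J * (P.t (G.M o i) 1 + P.t 1 (G.M o i)) =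
    (P.t (G.M o i) (expSigma K G o (-1 / 2 : K)) + P.t 1 (G.M o i)) * P.link G o J := by
  have his := (hJ i hi).1
  have hio := (hJ i hi).2
  have hMM : ∀ m ∈ J, Commute (G.M o m) (G.M o i) := fun m hm =>
    hG.commute_M_left_M_left ho (hJ m hm).1 his (hJ m hm).2 hio
  have hT : ⁅P.extSum G o J, P.t (G.M o i) (expSigma K G o (1 / 2 : K)) + P.t 1 (G.M o i)⁆ =
      -(X * P.t (G.M o i) (G.Ep o o * expSigma K G o (-1 / 2 : K))) := by
    have := hG.lie_extSum_M_right ho P hJ hi (c := 1) (fun m hm => Commute.one_right _) 0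
    simp only [expSigma_zero, mul_one, add_zero] at this
    rw [lie_add, hG.lie_extSum_eq_zero ho P hJ hMM
      (fun m hm => hG.commute_Ep_left_expSigma ho hm _), zero_add, this]
  have := link_mul_of_lie (o := o) (J := J) P (z₀ := P.t (G.M o i) 1 + P.t 1 (G.M o i)) (v := 0)
    (by rw [mul_add, P.fexp_t_sigma_mul_fst (hG.lie_H_M_left ho his hio),
      P.fexp_t_sigma_mul_snd (hG.commute_M_Ep_self ho his ho hio), ← add_mul]) hT
    (by rw [lie_neg, lie_X_mul, hG.lie_extSum_eq_zero ho P hJ hMM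
        (fun m hm => (hG.commute_Ep_Ep ho hm ho ho).mul_right
          (hG.commute_Ep_left_expSigma ho hm _))]; simp) (by simp)
  rw [this, show (1 / 2 : K) = 1 + -1 / 2 by norm_num, expSigma_add, expSigma_one, add_mul (1 : A⟦X⟧), one_mul,
    P.t_add_right, mul_assoc X, P.t_X_mul_right]
  congr 1
  abel

/-- E_{i+j} has weight 0, and M_{om} replaces one of its indices by o, which gives the two terms
linear in X. In each of them the remaining index is replaced by the second bracket, with equal
results; this is the 2 that `link_mul_of_lie` divides out. -/
lemma link_mul_Ep (hi : i ∈ J) (hj : j ∈ J) :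
    P.link G o J * (P.t (G.Ep i j) 1 + P.t 1 (G.Ep i j)) =
    (P.t (G.Ep i j) 1 + P.t 1 (G.Ep i j)
      + X * P.t (G.Ep o i) (G.Ep o j * expSigma K G o (-1 / 2 : K))
      + X * P.t (G.Ep o j) (G.Ep o i * expSigma K G o (-1 / 2 : K))
      + X ^ 2 * P.t (G.Ep o o) (G.Ep o i * G.Ep o j * expSigma K G o (-1 : K)))
      * P.link G o J := by
  obtain ⟨his, hio⟩ := hJ i hi
  obtain ⟨hjs, hjo⟩ := hJ j hj
  have hxs : ∀ {i}, i ∈ s → ∀ (c : K), ∀ m ∈ s, Commute (G.Ep o m) (G.Ep o i * expSigma K G o c) :=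
    fun hi c m hm => (hG.commute_Ep_Ep ho hm ho hi).mul_right
      (hG.commute_Ep_left_expSigma ho hm _)
  have hT : ⁅P.extSum G o J, P.t (G.Ep i j) 1 + P.t 1 (G.Ep i j)⁆ =
      X * P.t (G.Ep o j) (G.Ep o i * expSigma K G o (-1 / 2 : K)) +
      X * P.t (G.Ep o i) (G.Ep o j * expSigma K G o (-1 / 2 : K)) := by
    rw [lie_add, hG.lie_extSum_eq_zero ho P hJ (fun m hm => Commute.one_right _)
        (fun m hm => hG.commute_Ep_Ep ho hm his hjs), add_zero,
      P.lie_extSum_of_commute_right G o J _ fun m hm => Commute.one_right _,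
      ← sum_X_mul_t_kron (K := K) P hi (G.Ep o j)
        (fun m => G.Ep o m * expSigma K G o (-1 / 2 : K)),
      ← sum_X_mul_t_kron (K := K) P hj (G.Ep o i)
        (fun m => G.Ep o m * expSigma K G o (-1 / 2 : K)), ← Finset.sum_add_distrib]
    refine Finset.sum_congr rfl fun m hm => ?_
    rw [hG.lie_M_left_Ep ho his hjs (hJ m hm).1, P.t_add_left, mul_add, mul_one]
  have hss : ∀ {i j}, i ∈ J → j ∈ J →
      ⁅P.extSum G o J, P.t (G.Ep o j) (G.Ep o i * expSigma K G o (-1 / 2 : K))⁆ =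
      X * P.t (G.Ep o o) (G.Ep o i * G.Ep o j * expSigma K G o (-1 : K)) := by
    intro i j hi hj
    rw [hG.lie_extSum_Ep_left ho P hJ hj (hxs (hJ i hi).1 _), mul_assoc, ← mul_assoc (expSigma _ _ _ _),
      ← (hG.commute_Ep_left_expSigma ho (hJ i hi).1 _).eq, mul_assoc (G.Ep o i), ← expSigma_add,
      ← mul_assoc, (hG.commute_Ep_Ep ho (hJ i hi).1 ho (hJ j hj).1).eq]
    norm_num
  have := link_mul_of_lie (o := o) (J := J) P (z₀ := P.t (G.Ep i j) 1 + P.t 1 (G.Ep i j))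
    (v := X ^ 2 * P.t (G.Ep o o) (G.Ep o i * G.Ep o j * expSigma K G o (-1 : K)))
    (by rw [mul_add, P.fexp_t_sigma_mul_fst (hG.lie_H_Ep ho his hio hjs hjo), expSigma_zero,
      P.fexp_t_sigma_mul_snd (hG.commute_Ep_Ep his hjs ho ho), ← add_mul]) hT
    (by
      rw [lie_add, lie_X_mul, lie_X_mul, hss hi hj, hss hj hi,
        (hG.commute_Ep_Ep ho hjs ho his).eq, ← two_mul, ← mul_assoc X X, pow_two])
    (by
      rw [pow_two, mul_assoc, lie_X_mul, lie_X_mul, hG.lie_extSum_eq_zero ho P hJ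
        (fun m hm => hG.commute_M_Ep_self ho (hJ m hm).1 ho (hJ m hm).2)
        (fun m hm => ((hG.commute_Ep_Ep ho hm ho his).mul_right
          (hG.commute_Ep_Ep ho hm ho hjs)).mul_right (hG.commute_Ep_left_expSigma ho hm _))]
      simp)
  rw [this]
  congr 1
  abel

/-- Here the legs change roles: M_{om} commutes with F_{i+j}, and the second legs E_{o+m} act on it.
The second bracket runs through [E_{o+m}, M_{oi}], whose sign explains the minus in the quadratic
term. -/
lemma link_mul_Fp (hi : i ∈ J) (hj : j ∈ J) :
    P.link G o J * (P.t (G.Fp i j) 1 + P.t 1 (G.Fp i j)) =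
    (P.t (G.Fp i j) 1 + P.t 1 (G.Fp i j)
      + X * P.t (G.M o i) (G.M o j * expSigma K G o (-1 / 2 : K))
      + X * P.t (G.M o j) (G.M o i * expSigma K G o (-1 / 2 : K))
      - X ^ 2 * P.t (G.M o i * G.M o j) (G.Ep o o * expSigma K G o (-1 : K)))
      * P.link G o J := by
  obtain ⟨his, hio⟩ := hJ i hi
  obtain ⟨hjs, hjo⟩ := hJ j hj
  have hMM : ∀ {i}, i ∈ J → ∀ m ∈ J, Commute (G.M o m) (G.M o i) := fun hi m hm =>
    hG.commute_M_left_M_left ho (hJ m hm).1 (hJ _ hi).1 (hJ m hm).2 (hJ _ hi).2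
  have hT : ⁅P.extSum G o J, P.t (G.Fp i j) 1 + P.t 1 (G.Fp i j)⁆ =
      X * P.t (G.M o i) (G.M o j * expSigma K G o (-1 / 2 : K)) +
      X * P.t (G.M o j) (G.M o i * expSigma K G o (-1 / 2 : K)) := by
    rw [lie_add, hG.lie_extSum_eq_zero ho P hJ
        (fun m hm => hG.commute_M_left_Fp ho his hjs (hJ m hm).1 hio hjo)
        (fun m hm => Commute.one_right _), zero_add,
      P.lie_extSum_of_commute_left G o J _ fun m hm => Commute.one_right _,
      ← sum_kron_smul (K := K) J hi (fun m => X * P.t (G.M o m)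
        (G.M o j * expSigma K G o (-1 / 2 : K))),
      ← sum_kron_smul (K := K) J hj (fun m => X * P.t (G.M o m)
        (G.M o i * expSigma K G o (-1 / 2 : K))), ← Finset.sum_add_distrib]
    refine Finset.sum_congr rfl fun m hm => ?_
    rw [assoc_mul_lie, lie_eq_zero_of_commute
      (commute_expSigma (hG.commute_Fp_Ep_self ho his hjs hio hjo) _).symm,
      hG.lie_Ep_left_Fp ho his hjs (hJ m hm).1 hio hjo]
    simp only [mul_zero, zero_add, mul_one, add_mul, smul_mul_assoc, P.t_add_right, P.t_smul_right,
      mul_add, mul_smul_comm]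
  have hss : ∀ {i j}, i ∈ J → j ∈ J →
      ⁅P.extSum G o J, P.t (G.M o i) (G.M o j * expSigma K G o (-1 / 2 : K))⁆ =
      -(X * P.t (G.M o i * G.M o j) (G.Ep o o * expSigma K G o (-1 : K))) := by
    intro i j hi hj
    rw [hG.lie_extSum_M_right ho P hJ hj (hMM hi), (hMM hi j hj).eq]
    norm_num
  have := link_mul_of_lie (o := o) (J := J) P (z₀ := P.t (G.Fp i j) 1 + P.t 1 (G.Fp i j))
    (v := -(X ^ 2 * P.t (G.M o i * G.M o j) (G.Ep o o * expSigma K G o (-1 : K))))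
    (by rw [mul_add, P.fexp_t_sigma_mul_fst (hG.lie_H_Fp ho his hio hjs hjo), expSigma_zero,
      P.fexp_t_sigma_mul_snd (hG.commute_Fp_Ep_self ho his hjs hio hjo), ← add_mul]) hT
    (by
      rw [lie_add, lie_X_mul, lie_X_mul, hss hi hj, hss hj hi, (hMM hi j hj).eq, ← two_mul, mul_neg,
        ← mul_assoc X X, pow_two])
    (by
      rw [lie_neg, pow_two, mul_assoc, lie_X_mul, lie_X_mul, hG.lie_extSum_eq_zero ho P hJ
        (fun m hm => (hMM hi m hm).mul_right (hMM hj m hm))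
        (fun m hm => (hG.commute_Ep_Ep ho hm ho ho).mul_right
          (hG.commute_Ep_left_expSigma ho hm _))]
      simp)
  rw [this]
  congr 1
  abel

/-- The M_{om} transform as covectors and the E_{o+m} as vectors under M_{ij}, so the extension
exponent is an invariant pairing and the contributions of the two legs cancel. -/
lemma link_mul_M (hi : i ∈ J) (hj : j ∈ J) :
    P.link G o J * (P.t (G.M i j) 1 + P.t 1 (G.M i j)) =
      (P.t (G.M i j) 1 + P.t 1 (G.M i j)) * P.link G o J := by
  obtain ⟨his, hio⟩ := hJ i hi
  obtain ⟨hjs, hjo⟩ := hJ j hj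
  have hT : ⁅P.extSum G o J, P.t (G.M i j) 1 + P.t 1 (G.M i j)⁆ = 0 := by
    have e1 : ⁅P.extSum G o J, P.t (G.M i j) 1⁆ =
        X * P.t (G.M o j) (G.Ep o i * expSigma K G o (-1 / 2 : K)) := by
      rw [P.lie_extSum_of_commute_right G o J _ fun m hm => Commute.one_right _,
        ← sum_X_mul_t_kron (K := K) P hi (G.M o j)
          (fun m => G.Ep o m * expSigma K G o (-1 / 2 : K))]
      refine Finset.sum_congr rfl fun m hm => ?_
      rw [← lie_skew, hG.lie_M_M_left ho his hjs (hJ m hm).1 hio hjo (hJ m hm).2, neg_neg, mul_one,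
        kron_comm]
    have e2 : ⁅P.extSum G o J, P.t 1 (G.M i j)⁆ =
        -(X * P.t (G.M o j) (G.Ep o i * expSigma K G o (-1 / 2 : K))) := by
      rw [P.lie_extSum_of_commute_left G o J _ fun m hm => Commute.one_right _,
        ← sum_kron_smul (K := K) J hj (fun m => (X * P.t (G.M o m)
          (G.Ep o i * expSigma K G o (-1 / 2 : K)))), ← Finset.sum_neg_distrib]
      refine Finset.sum_congr rfl fun m hm => ?_
      rw [assoc_mul_lie, lie_eq_zero_of_commute
        (commute_expSigma (hG.commute_M_Ep_self ho hjs his hjo) _).symm, ← lie_skew,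
        hG.lie_M_Ep_left ho his hjs (hJ m hm).1 hjo, kron_comm]
      simp only [mul_zero, zero_add, mul_one, neg_mul, smul_mul_assoc, P.t_neg_right,
        P.t_smul_right, mul_neg, mul_smul_comm]
    rw [lie_add, e1, e2, add_neg_cancel]
  have := link_mul_of_lie (o := o) (J := J) P (z₀ := P.t (G.M i j) 1 + P.t 1 (G.M i j)) (v := 0)
    (by rw [mul_add, P.fexp_t_sigma_mul_fst (hG.lie_H_M ho his hio hjs hjo), expSigma_zero,
      P.fexp_t_sigma_mul_snd (hG.commute_M_Ep_self ho hjs his hjo), ← add_mul]) hT (by simp) (by simp)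
  rwa [add_zero, add_zero] at this

end IsSpFamily

end Link

/-! ### Twisted coproducts of the generators and the twist equation -/

section TwistStep

open PowerSeries

variable {K : Type*} [Field K] [CharZero K] {N : ℕ} {A B C : Type*} [Ring A] [Algebra K A]
  [Ring B] [Algebra K B] [Ring C] [Algebra K C]

namespace LegPair

variable (P : LegPair K A B)

/-- The primitive coproduct `a ⊗ 1 + 1 ⊗ a`. -/
def prim (a : A⟦X⟧) : B⟦X⟧ := P.t a 1 + P.t 1 a

omit [CharZero K] in
lemma prim_add (a b : A⟦X⟧) : P.prim (a + b) = P.prim a + P.prim b := by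
  rw [prim, prim, prim, t_add_left, t_add_right]; abel

omit [CharZero K] in
lemma prim_smul (c : K) (a : A⟦X⟧) : P.prim (c • a) = c • P.prim a := by
  rw [prim, prim, t_smul_left, t_smul_right, smul_add]

variable (G : Gens N A⟦X⟧) (o : Fin N)

lemma fexp_prim_sigma (c : K) : fexp K (c • P.prim (sigma K G o)) =
    P.t (expSigma K G o c) (expSigma K G o c) := by
  have h1 : (X : B⟦X⟧) ∣ P.fst (c • sigma K G o) := by
    have := X_dvd_map (Ψ := P.fst) (by rw [P.fst_X]) (n := 1)
      (by simpa using X_dvd_smul_sigma G o c)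
    simpa using this
  have h2 : (X : B⟦X⟧) ∣ P.snd (c • sigma K G o) := by
    have := X_dvd_map (Ψ := P.snd) (by rw [P.snd_X]) (n := 1)
      (by simpa using X_dvd_smul_sigma G o c)
    simpa using this
  rw [← prim_smul, prim, t_one_right, t_one_left, fexp_add h1 h2 (P.commute _ _),
    ← map_fexp P.fst_X (X_dvd_smul_sigma G o c), ← map_fexp P.snd_X (X_dvd_smul_sigma G o c)]
  rfl

/-- Adding 1 to X times the coproduct of E_{o+o} under the link gives e^σ ⊗ e^σ = exp(σ ⊗ 1 + 1 ⊗
σ), so σ itself becomes primitive. -/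
lemma flogOneAdd_coproduct : flogOneAdd K (X * (P.t (G.Ep o o) (expSigma K G o (1 : K))
    + P.t 1 (G.Ep o o))) = P.prim (sigma K G o) := by
  have h : X * (P.t (G.Ep o o) (expSigma K G o (1 : K)) + P.t 1 (G.Ep o o)) =
      fexp K (P.prim (sigma K G o)) - 1 := by
    have := P.fexp_prim_sigma G o 1
    rw [one_smul] at this
    rw [this]
    have h1 : ∀ y, P.t (expSigma K G o (1 : K)) y = P.t 1 y + X * P.t (G.Ep o o) y := fun y => by
      rw [expSigma_one, P.t_add_left, P.t_X_mul_left]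
    have h2 : P.t 1 (expSigma K G o (1 : K)) = 1 + X * P.t 1 (G.Ep o o) := by
      rw [expSigma_one, P.t_add_right, P.t_X_mul_right, P.t_one_right, map_one]
    rw [h1, h2, mul_add]
    abel
  rw [h, flogOneAdd_fexp_sub_one]
  exact dvd_add (by
    rw [t_one_right]
    simpa using X_dvd_map (Ψ := P.fst) (by rw [P.fst_X]) (n := 1) (by simpa using X_dvd_sigma G o))
    (P.X_dvd_t_right (X_dvd_sigma G o) _)

end LegPair

/-- The element `F` twists the coproduct `D` of the generators `G` with indices in `s` to the
primitive one. -/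
structure IsPrimitiveFamily (P : LegPair K A B) (D : A⟦X⟧ →ₐ[K] B⟦X⟧) (F : B⟦X⟧)
    (G : Gens N A⟦X⟧) (s : Set (Fin N)) : Prop where
  Ep : ∀ {i j}, i ∈ s → j ∈ s → SemiconjBy F (D (G.Ep i j)) (P.prim (G.Ep i j))
  Fp : ∀ {i j}, i ∈ s → j ∈ s → SemiconjBy F (D (G.Fp i j)) (P.prim (G.Fp i j))
  M : ∀ {i j}, i ∈ s → j ∈ s → SemiconjBy F (D (G.M i j)) (P.prim (G.M i j))

namespace IsPrimitiveFamily

variable {P : LegPair K A B} {D : A⟦X⟧ →ₐ[K] B⟦X⟧} {F : B⟦X⟧} {G : Gens N A⟦X⟧} {s : Set (Fin N)}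
  (hP : IsPrimitiveFamily P D F G s) (hG : IsSpFamily K G s) (hD : D X = X) {o i j : Fin N}
  (ho : o ∈ s) {J : Finset (Fin N)} (hJ : ∀ m ∈ J, m ∈ s ∧ m ≠ o)

omit [CharZero K] in
lemma semiconjBy_link {a : A⟦X⟧} {f : B⟦X⟧} (h : SemiconjBy F (D a) (P.prim a))
    (hf : P.link G o J * (P.t a 1 + P.t 1 a) = f * P.link G o J) :
    SemiconjBy (P.link G o J * F) (D a) f := by
  rw [SemiconjBy, mul_assoc, h.eq, ← mul_assoc, LegPair.prim, hf, mul_assoc]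

include hP hG hD ho hJ

lemma semiconjBy_sigma :
    SemiconjBy (P.link G o J * F) (D (sigma K G o)) (P.prim (sigma K G o)) := by
  have h := semiconjBy_link (hP.Ep ho ho) (hG.link_mul_Ep_self ho P hJ)
  rw [← P.flogOneAdd_coproduct, sigma, map_flogOneAdd hD (X_dvd_X_mul _), map_mul, hD]
  exact semiconjBy_flogOneAdd (X_dvd_X_mul _) (X_dvd_X_mul _)
    (SemiconjBy.mul_right (commute_X _) h)

lemma semiconjBy_expSigma (c : K) : SemiconjBy (P.link G o J * F) (D (expSigma K G o c))
    (P.t (expSigma K G o c) (expSigma K G o c)) := by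
  have h := hP.semiconjBy_sigma hG hD ho hJ
  have hd : (X : B⟦X⟧) ∣ D (c • sigma K G o) := by
    have := X_dvd_map (Ψ := D) (by rw [hD]) (n := 1) (a := c • sigma K G o)
      (by rw [pow_one]; exact X_dvd_smul_sigma G o c)
    rwa [pow_one] at this
  have hd' : (X : B⟦X⟧) ∣ c • P.prim (sigma K G o) := by
    refine X_dvd_smul (dvd_add ?_ (P.X_dvd_t_right (X_dvd_sigma G o) _)) _
    rw [P.t_one_right]
    simpa using X_dvd_map (Ψ := P.fst) (by rw [P.fst_X]) (n := 1) (by simpa using X_dvd_sigma G o)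
  rw [← P.fexp_prim_sigma, expSigma, map_fexp hD (X_dvd_smul_sigma G o c)]
  refine semiconjBy_fexp hd hd' ?_
  rw [map_smul]
  exact h.smul_right c

omit hD in
lemma semiconjBy_Ep_left (hi : i ∈ J) : SemiconjBy (P.link G o J * F) (D (G.Ep o i))
    (P.t (G.Ep o i) (expSigma K G o (1 / 2 : K)) + P.t (expSigma K G o (1 : K)) (G.Ep o i)) :=
  semiconjBy_link (hP.Ep ho (hJ i hi).1) (hG.link_mul_Ep_left ho P hJ hi)

omit hD in
lemma semiconjBy_M_left (hi : i ∈ J) : SemiconjBy (P.link G o J * F) (D (G.M o i))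
    (P.t (G.M o i) (expSigma K G o (-1 / 2 : K)) + P.t 1 (G.M o i)) :=
  semiconjBy_link (hP.M ho (hJ i hi).1) (hG.link_mul_M_left ho P hJ hi)

omit hD in
lemma semiconjBy_Ep (hi : i ∈ J) (hj : j ∈ J) : SemiconjBy (P.link G o J * F) (D (G.Ep i j))
    (P.t (G.Ep i j) 1 + P.t 1 (G.Ep i j)
      + X * P.t (G.Ep o i) (G.Ep o j * expSigma K G o (-1 / 2 : K))
      + X * P.t (G.Ep o j) (G.Ep o i * expSigma K G o (-1 / 2 : K))
      + X ^ 2 * P.t (G.Ep o o) (G.Ep o i * G.Ep o j * expSigma K G o (-1 : K))) :=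
  semiconjBy_link (hP.Ep (hJ i hi).1 (hJ j hj).1) (hG.link_mul_Ep ho P hJ hi hj)

omit hD in
lemma semiconjBy_Fp (hi : i ∈ J) (hj : j ∈ J) : SemiconjBy (P.link G o J * F) (D (G.Fp i j))
    (P.t (G.Fp i j) 1 + P.t 1 (G.Fp i j)
      + X * P.t (G.M o i) (G.M o j * expSigma K G o (-1 / 2 : K))
      + X * P.t (G.M o j) (G.M o i * expSigma K G o (-1 / 2 : K))
      - X ^ 2 * P.t (G.M o i * G.M o j) (G.Ep o o * expSigma K G o (-1 : K))) :=
  semiconjBy_link (hP.Fp (hJ i hi).1 (hJ j hj).1) (hG.link_mul_Fp ho P hJ hi hj)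

omit hD in
lemma semiconjBy_M (hi : i ∈ J) (hj : j ∈ J) :
    SemiconjBy (P.link G o J * F) (D (G.M i j)) (P.prim (G.M i j)) :=
  semiconjBy_link (hP.M (hJ i hi).1 (hJ j hj).1) (hG.link_mul_M ho P hJ hi hj)

/-- The coproduct of E_{o+i}E_{o+j}e^{-σ} is the product of the known coproducts of its factors. Its
mixed terms are E_{o+i} ⊗ E_{o+j}e^{-σ/2} and the same with i, j exchanged, and its last term has
first leg e^σ = 1 + X E_{o+o}. These are precisely the nonprimitive terms of the coproduct of
E_{i+j}. -/
lemma semiconjBy_modify_Ep (hi : i ∈ J) (hj : j ∈ J) : SemiconjBy (P.link G o J * F)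
    (D ((modify K G o).Ep i j)) (P.prim ((modify K G o).Ep i j)) := by
  have his := (hJ i hi).1
  have hjs := (hJ j hj).1
  have ex : ∀ {i}, i ∈ s → ∀ c : K, expSigma K G o c * G.Ep o i = G.Ep o i * expSigma K G o c :=
    fun hi c => (hG.commute_Ep_left_expSigma ho hi c).symm.eq
  have h := (hP.semiconjBy_Ep hG ho hJ hi hj).sub_right (SemiconjBy.mul_right
    (commute_X (P.link G o J * F)) (((hP.semiconjBy_Ep_left hG ho hJ hi).mul_right
      (hP.semiconjBy_Ep_left hG ho hJ hj)).mul_right (hP.semiconjBy_expSigma hG hD ho hJ (-1))))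
  rw [← map_mul, ← map_mul, ← hD, ← map_mul, ← map_sub, ← modify_Ep, hD] at h
  refine (congrArg (SemiconjBy _ _) ?_).mpr h
  have e1 : ∀ a b : A⟦X⟧, ∀ c d : K, a * expSigma K G o c * (b * expSigma K G o d) =
      a * (expSigma K G o c * b) * expSigma K G o d := fun a b c d => by noncomm_ring
  have e2 : ∀ a : A⟦X⟧, ∀ c d : K, a * expSigma K G o c * expSigma K G o d =
      a * expSigma K G o (c + d) := fun a c d => by rw [expSigma_add, mul_assoc]
  have e3 : ∀ a : A⟦X⟧, ∀ c d : K, expSigma K G o c * (expSigma K G o d * a) =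
      expSigma K G o (c + d) * a := fun a c d => by rw [expSigma_add, mul_assoc]
  simp only [add_mul, mul_add, P.t_mul_t]
  have f1 : expSigma K G o (1 / 2 : K) * expSigma K G o (1 / 2 : K) * expSigma K G o (-1 : K) = 1 := by
    rw [← expSigma_add, ← expSigma_add]; norm_num; exact expSigma_zero G o
  have f2 : expSigma K G o (1 : K) * G.Ep o j * expSigma K G o (-1 : K) = G.Ep o j := by
    rw [ex hjs, mul_assoc, ← expSigma_add]; norm_num; rw [expSigma_zero, mul_one]
  have f3 : G.Ep o i * expSigma K G o (1 / 2 : K) * expSigma K G o (-1 : K) =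
      G.Ep o i * expSigma K G o (-1 / 2 : K) := by
    rw [mul_assoc, ← expSigma_add]; norm_num
  have f4 : G.Ep o i * expSigma K G o (1 : K) * expSigma K G o (-1 : K) = G.Ep o i := by
    rw [mul_assoc, ← expSigma_add]; norm_num; rw [expSigma_zero, mul_one]
  have f5 : expSigma K G o (1 / 2 : K) * G.Ep o j * expSigma K G o (-1 : K) =
      G.Ep o j * expSigma K G o (-1 / 2 : K) := by
    rw [ex hjs, mul_assoc, ← expSigma_add]; norm_num
  have f6 : expSigma K G o (1 : K) * expSigma K G o (1 : K) * expSigma K G o (-1 : K) =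
      1 + X * G.Ep o o := by
    rw [← expSigma_one (K := K), ← expSigma_add, ← expSigma_add]; norm_num
  have f7 : expSigma K G o (1 : K) * G.Ep o j * expSigma K G o (-1 : K) = G.Ep o j := by
    rw [ex hjs, mul_assoc, ← expSigma_add]; norm_num; rw [expSigma_zero, mul_one]
  rw [f1, f2, f3, f4, f5, f6]
  rw [LegPair.prim, modify_Ep]
  simp only [P.t_sub_left, P.t_sub_right, P.t_add_left, P.t_X_mul_left, P.t_X_mul_right, mul_add,
    pow_two, mul_assoc]
  abel

/-- The product of the coproducts of M_{oi} and M_{oj} has the same mixed terms as the coproduct of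
F_{i+j}. In M_{oi}M_{oj} ⊗ e^{-σ} the relation e^{-σ} = 1 - X E_{o+o}e^{-σ} separates the primitive
part from the quadratic term. -/
lemma semiconjBy_modify_Fp (hi : i ∈ J) (hj : j ∈ J) : SemiconjBy (P.link G o J * F)
    (D ((modify K G o).Fp i j)) (P.prim ((modify K G o).Fp i j)) := by
  obtain ⟨his, hio⟩ := hJ i hi
  obtain ⟨hjs, hjo⟩ := hJ j hj
  have h := (hP.semiconjBy_Fp hG ho hJ hi hj).sub_right (SemiconjBy.mul_right
    (commute_X (P.link G o J * F)) ((hP.semiconjBy_M_left hG ho hJ hi).mul_right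
      (hP.semiconjBy_M_left hG ho hJ hj)))
  rw [← map_mul, ← hD, ← map_mul, ← map_sub, ← modify_Fp (K := K) G hio hjo, hD] at h
  refine (congrArg (SemiconjBy _ _) ?_).mpr h
  have f1 : expSigma K G o (-1 / 2 : K) * expSigma K G o (-1 / 2 : K) =
      1 - X * (G.Ep o o * expSigma K G o (-1 : K)) := by
    rw [← expSigma_add, eq_sub_iff_add_eq, show (-1 / 2 + -1 / 2 : K) = -1 by norm_num, ← mul_assoc]
    nth_rw 1 [← one_mul (expSigma K G o (-1 : K))]
    rw [← add_mul, ← expSigma_one (K := K), ← expSigma_add, add_neg_cancel, expSigma_zero]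
  have f2 : expSigma K G o (-1 / 2 : K) * G.M o j = G.M o j * expSigma K G o (-1 / 2 : K) :=
    (hG.commute_M_left_expSigma ho hjs hjo _).symm.eq
  simp only [add_mul, mul_add, P.t_mul_t, f1, f2, one_mul, mul_one]
  rw [LegPair.prim, modify_Fp G hio hjo]
  simp only [P.t_sub_left, P.t_sub_right, P.t_X_mul_left, P.t_X_mul_right, mul_sub,
    pow_two, mul_assoc]
  abel

/-- The link twists the coproduct of the modified generators to the primitive one. -/
theorem modify : IsPrimitiveFamily P D (P.link G o J * F) (modify K G o) J where
  Ep hi hj := hP.semiconjBy_modify_Ep hG hD ho hJ hi hj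
  Fp hi hj := hP.semiconjBy_modify_Fp hG hD ho hJ hi hj
  M hi hj := hP.semiconjBy_M hG ho hJ hi hj

end IsPrimitiveFamily

end TwistStep

/-! ### The twist equation for a product of links -/

section TripleLegs

open PowerSeries

variable {K : Type*} [Field K] {N : ℕ} {A B C : Type*} [Ring A] [Algebra K A]
  [Ring B] [Algebra K B] [Ring C] [Algebra K C]

/-- The maps between the tensor square and the tensor cube of a bialgebra that enter the twist
equation. -/
structure TripleLegs (P : LegPair K A B) (D : A⟦X⟧ →ₐ[K] B⟦X⟧) (C : Type*) [Ring C]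
    [Algebra K C] where
  -- In the model, `e12` and `e23` are the placements in legs 12 and 23, and `d1`, `d2` are D ⊗ id
  -- and id ⊗ D.
  e12 : B⟦X⟧ →ₐ[K] C⟦X⟧
  e23 : B⟦X⟧ →ₐ[K] C⟦X⟧
  d1 : B⟦X⟧ →ₐ[K] C⟦X⟧
  d2 : B⟦X⟧ →ₐ[K] C⟦X⟧
  e12_X : e12 X = X
  e23_X : e23 X = X
  d1_X : d1 X = X
  d2_X : d2 X = X
  e12_snd : ∀ a, e12 (P.snd a) = e23 (P.fst a)
  commute_snd : ∀ b a, Commute (e12 b) (e23 (P.snd a))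
  commute_fst : ∀ a b, Commute (e12 (P.fst a)) (e23 b)
  d1_fst : ∀ a, d1 (P.fst a) = e12 (D a)
  d1_snd : ∀ a, d1 (P.snd a) = e23 (P.snd a)
  d2_fst : ∀ a, d2 (P.fst a) = e12 (P.fst a)
  d2_snd : ∀ a, d2 (P.snd a) = e23 (D a)

namespace TripleLegs

variable {P : LegPair K A B} {D : A⟦X⟧ →ₐ[K] B⟦X⟧} (T : TripleLegs P D C)

/-- The first and second legs. -/
def legs12 : LegPair K A C := P.map T.e12 T.e12_X

/-- The second and third legs. -/
def legs23 : LegPair K A C := P.map T.e23 T.e23_X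

/-- The first and third legs. -/
def legs13 : LegPair K A C where
  fst := T.e12.comp P.fst
  snd := T.e23.comp P.snd
  fst_X := by simp [P.fst_X, T.e12_X]
  snd_X := by simp [P.snd_X, T.e23_X]
  commute a b := T.commute_snd _ _

/-- The twist equation. -/
def IsCocycle (F : B⟦X⟧) : Prop := T.e12 F * T.d1 F = T.e23 F * T.d2 F

lemma legs13_fst (a : A⟦X⟧) : T.legs13.fst a = T.legs12.fst a := rfl

lemma legs12_snd (a : A⟦X⟧) : T.legs12.snd a = T.legs23.fst a := T.e12_snd a

lemma commute_12_13 {a b c d : A⟦X⟧} (h : Commute a c) :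
    Commute (T.legs12.t a b) (T.legs13.t c d) := by
  rw [LegPair.t, LegPair.t]
  refine Commute.mul_right ?_ (Commute.mul_left (T.commute_snd _ _) (T.commute_snd _ _))
  exact Commute.mul_left (h.map T.legs12.fst) (T.legs12.commute c b).symm

lemma commute_13_23 {a b c d : A⟦X⟧} (h : Commute b d) :
    Commute (T.legs13.t a b) (T.legs23.t c d) := by
  rw [LegPair.t, LegPair.t]
  refine Commute.mul_left (Commute.mul_right (T.commute_fst _ _) (T.commute_fst _ _)) ?_
  exact Commute.mul_right (T.legs23.commute c b).symm (h.map T.legs23.snd)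

variable [CharZero K] {F : B⟦X⟧} {G : Gens N A⟦X⟧} {s : Set (Fin N)}
  (hP : IsPrimitiveFamily P D F G s) (hG : IsSpFamily K G s) (hD : D X = X) {o : Fin N}
  (ho : o ∈ s) {J : Finset (Fin N)} (hJ : ∀ m ∈ J, m ∈ s ∧ m ≠ o)

/-- The part of the exponent with three legs. -/
def extSum₃ (G : Gens N A⟦X⟧) (o : Fin N) (J : Finset (Fin N)) : C⟦X⟧ :=
  ∑ m ∈ J, X * (T.legs12.t (G.M o m) (expSigma K G o (1 / 2 : K)) *
    T.legs13.snd (G.Ep o m * expSigma K G o (-1 / 2 : K)))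

omit [CharZero K] in
lemma X_dvd_extSum₃ : X ∣ T.extSum₃ G o J := Finset.dvd_sum fun _ _ => dvd_mul_right _ _

include hG ho hJ

lemma commute_extSum_extSum :
    Commute (T.legs13.extSum G o J) (T.legs23.extSum G o J) := by
  refine Commute.sum_left _ _ _ fun m hm => Commute.sum_right _ _ _ fun n hn =>
    Commute.mul_left (commute_X _).symm (Commute.mul_right (commute_X _) (T.commute_13_23 ?_))
  refine IsSpFamily.commute_second_leg ho (fun l hl => ?_) (hJ m hm).1 _
  exact (hG.commute_Ep_Ep ho hl ho (hJ n hn).1).mul_right (hG.commute_Ep_left_expSigma ho hl _)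

lemma commute_sigma_extSum :
    Commute (T.legs13.t (G.H o) (sigma K G o)) (T.legs23.extSum G o J) := by
  refine Commute.sum_right _ _ _ fun n hn => Commute.mul_right (commute_X _) (T.commute_13_23 ?_)
  exact (commute_sigma ((IsSpFamily.commute_second_leg ho (fun l hl => hG.commute_Ep_Ep ho hl ho ho)
    (hJ n hn).1 _))).symm

lemma commute_extSum_extSum₃ : Commute (T.legs12.extSum G o J) (T.extSum₃ G o J) := by
  refine Commute.sum_left _ _ _ fun m hm => Commute.sum_right _ _ _ fun n hn =>
    Commute.mul_left (commute_X _).symm (Commute.mul_right (commute_X _) (Commute.mul_right ?_ ?_))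
  · refine T.legs12.commute_t (hG.commute_M_left_M_left ho (hJ m hm).1 (hJ n hn).1 (hJ m hm).2
      (hJ n hn).2) ?_
    exact IsSpFamily.commute_second_leg ho (fun l hl => hG.commute_Ep_left_expSigma ho hl _) (hJ m hm).1 _
  · rw [← LegPair.t_one_left]
    exact T.commute_12_13 (Commute.one_right _)

/-- M_{om} has weight 1/2, so moving exp(H ⊗ σ ⊗ 1) past it leaves e^{σ/2} in the middle leg, which
was empty before. -/
lemma fexp_sigma_mul_fexp_extSum :
    fexp K (T.legs12.t (G.H o) (sigma K G o)) * fexp K (T.legs13.extSum G o J) =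
      fexp K (T.extSum₃ G o J) * fexp K (T.legs12.t (G.H o) (sigma K G o)) := by
  refine (semiconjBy_fexp (T.legs13.X_dvd_extSum G o J) T.X_dvd_extSum₃ ?_).eq
  rw [SemiconjBy, LegPair.extSum, extSum₃, Finset.mul_sum, Finset.sum_mul]
  refine Finset.sum_congr rfl fun m hm => ?_
  have h := T.legs12.fexp_t_sigma_mul_fst (hG.lie_H_M_left ho (hJ m hm).1 (hJ m hm).2)
  have hc : Commute (fexp K (T.legs12.t (G.H o) (sigma K G o)))
      (T.legs13.snd (G.Ep o m * expSigma K G o (-1 / 2 : K))) := by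
    have hd := T.legs12.X_dvd_t_sigma (K := K) G o
    refine SemiconjBy.eq ?_ |>.symm
    refine semiconjBy_fexp hd hd ?_
    rw [← LegPair.t_one_left]
    exact (T.commute_12_13 (Commute.one_right _)).symm
  have ht : T.legs13.t (G.M o m) (G.Ep o m * expSigma K G o (-1 / 2 : K)) =
      T.legs12.t (G.M o m) 1 * T.legs13.snd (G.Ep o m * expSigma K G o (-1 / 2 : K)) := by
    rw [LegPair.t_one_right, LegPair.t, legs13_fst]
  rw [← mul_assoc, (commute_X _).eq, mul_assoc X, mul_assoc X, ht, ← mul_assoc (fexp K _), h, mul_assoc,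
    hc.eq, mul_assoc]

/-- The identity behind the twist equation of a single link. -/
lemma link_mul_fexp : T.e12 (P.link G o J) *
    (fexp K (T.legs13.extSum G o J + T.legs23.extSum G o J) *
      fexp K (T.legs13.t (G.H o) (sigma K G o) + T.legs23.t (G.H o) (sigma K G o))) =
    fexp K (T.legs12.extSum G o J + T.extSum₃ G o J) *
      fexp K (T.legs12.t (G.H o) (sigma K G o) + T.legs13.t (G.H o) (sigma K G o)) *
      T.e23 (P.link G o J) := by
  have x12 := T.legs12.X_dvd_t_sigma (K := K) G o
  have x13 := T.legs13.X_dvd_t_sigma (K := K) G o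
  have x23 := T.legs23.X_dvd_t_sigma (K := K) G o
  have y12 := T.legs12.X_dvd_extSum (K := K) G o J
  have y13 := T.legs13.X_dvd_extSum (K := K) G o J
  have y23 := T.legs23.X_dvd_extSum (K := K) G o J
  have hc : fexp K (T.legs23.extSum G o J) * fexp K (T.legs13.t (G.H o) (sigma K G o)) =
      fexp K (T.legs13.t (G.H o) (sigma K G o)) * fexp K (T.legs23.extSum G o J) :=
    (semiconjBy_fexp x13 x13 (semiconjBy_fexp y23 y23
      (T.commute_sigma_extSum hG ho hJ)).symm).eq
  rw [← P.map_link G o J T.e12 T.e12_X, ← P.map_link G o J T.e23 T.e23_X,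
    fexp_add y13 y23 (T.commute_extSum_extSum hG ho hJ),
    fexp_add x13 x23 (T.commute_13_23 (Commute.refl _)),
    fexp_add y12 T.X_dvd_extSum₃ (T.commute_extSum_extSum₃ hG ho hJ),
    fexp_add x12 x13 (T.commute_12_13 (Commute.refl _))]
  change fexp K (T.legs12.extSum G o J) * fexp K (T.legs12.t (G.H o) (sigma K G o)) * _ =
    _ * (fexp K (T.legs23.extSum G o J) * fexp K (T.legs23.t (G.H o) (sigma K G o)))
  have := T.fexp_sigma_mul_fexp_extSum hG ho hJ
  -- Two exchanges suffice: the jordanian factor in legs 12 with the extension in legs 13, which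
  -- creates `extSum₃`, and the extension in legs 23 with the jordanian factor in legs 13, which
  -- commute.
  calc _ = fexp K (T.legs12.extSum G o J) * (fexp K (T.legs12.t (G.H o) (sigma K G o)) *
        fexp K (T.legs13.extSum G o J)) * (fexp K (T.legs23.extSum G o J) *
        fexp K (T.legs13.t (G.H o) (sigma K G o))) * fexp K (T.legs23.t (G.H o) (sigma K G o)) := by
        simp only [mul_assoc]
    _ = _ := by rw [this, hc]; simp only [mul_assoc]

include hP

omit hP hJ ho hG [CharZero K] in
lemma semiconjBy_d1 {a b : A⟦X⟧} (h : SemiconjBy F (D a) (P.prim a)) :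
    SemiconjBy (T.e12 F) (T.d1 (P.t a b)) (T.legs13.t a b + T.legs23.t a b) := by
  have h1 : T.legs13.t a b + T.legs23.t a b = T.e12 (P.prim a) * T.e23 (P.snd b) := by
    rw [LegPair.prim, map_add, P.t_one_left, P.t_one_right, add_mul, T.e12_snd]; rfl
  rw [h1, LegPair.t, map_mul, T.d1_fst, T.d1_snd]
  exact (h.map T.e12).mul_right (T.commute_snd _ _)

omit hG in
-- The first legs M_{om} and H of the link belong to the family that F makes primitive. Each
-- exponent therefore splits into its copies in legs 13 and 23.
lemma e12_mul_d1_link : T.e12 F * T.d1 (P.link G o J) =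
    fexp K (T.legs13.extSum G o J + T.legs23.extSum G o J) *
      fexp K (T.legs13.t (G.H o) (sigma K G o) + T.legs23.t (G.H o) (sigma K G o)) * T.e12 F := by
  have hH : SemiconjBy F (D (G.H o)) (P.prim (G.H o)) := by
    rw [IsSpFamily.H_eq (K := K), map_smul, P.prim_smul]
    exact (hP.M ho ho).smul_right _
  have hd : ∀ {b : B⟦X⟧}, X ∣ b → X ∣ T.d1 b := fun {b} hb => by
    simpa using X_dvd_map (Ψ := T.d1) (by rw [T.d1_X]) (n := 1) (a := b) (by simpa using hb)
  rw [LegPair.link, map_mul, map_fexp T.d1_X (P.X_dvd_extSum G o J),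
    map_fexp T.d1_X (P.X_dvd_t_sigma G o)]
  refine SemiconjBy.mul_right ?_ ?_
  · refine semiconjBy_fexp (hd (P.X_dvd_extSum G o J))
      (dvd_add (T.legs13.X_dvd_extSum G o J) (T.legs23.X_dvd_extSum G o J)) ?_
    rw [LegPair.extSum, LegPair.extSum, LegPair.extSum, ← Finset.sum_add_distrib, map_sum,
      SemiconjBy, Finset.mul_sum, Finset.sum_mul]
    refine Finset.sum_congr rfl fun m hm => ?_
    rw [map_mul, T.d1_X, ← mul_add]
    exact (SemiconjBy.mul_right (commute_X (T.e12 F)) (T.semiconjBy_d1 (hP.M ho (hJ m hm).1))).eq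
  · exact semiconjBy_fexp (hd (P.X_dvd_t_sigma G o))
      (dvd_add (T.legs13.X_dvd_t_sigma G o) (T.legs23.X_dvd_t_sigma G o)) (T.semiconjBy_d1 hH)

include hD

/-- For the product of link and F, the second leg E_{o+m}e^{-σ/2} has coproduct E_{o+m}e^{-σ/2} ⊗ 1
+ e^{σ/2} ⊗ E_{o+m}e^{-σ/2}. The first term yields the exponent in legs 12 and the second yields
`extSum₃`. -/
lemma semiconjBy_d2_extSum : SemiconjBy (T.e23 (P.link G o J * F)) (T.d2 (P.extSum G o J))
    (T.legs12.extSum G o J + T.extSum₃ G o J) := by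
  rw [LegPair.extSum, LegPair.extSum, extSum₃, ← Finset.sum_add_distrib, map_sum, SemiconjBy,
    Finset.mul_sum, Finset.sum_mul]
  refine Finset.sum_congr rfl fun m hm => ?_
  rw [map_mul T.d2, T.d2_X, ← mul_add]
  refine (SemiconjBy.mul_right (commute_X (T.e23 (P.link G o J * F))) ?_).eq
  have h := ((hP.semiconjBy_Ep_left hG ho hJ hm).mul_right
    (hP.semiconjBy_expSigma hG hD ho hJ (-1 / 2))).map T.e23
  rw [← map_mul] at h
  have h2 := SemiconjBy.mul_right (T.commute_fst (G.M o m) (P.link G o J * F)).symm h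
  rw [← T.d2_fst, ← T.d2_snd, ← map_mul] at h2
  refine (congrArg (SemiconjBy _ _) ?_).mpr h2
  have f1 : expSigma K G o (1 / 2 : K) * expSigma K G o (-1 / 2 : K) = 1 := by
    rw [← expSigma_add, show (1 / 2 + -1 / 2 : K) = 0 by norm_num, expSigma_zero]
  have f2 : expSigma K G o (1 : K) * expSigma K G o (-1 / 2 : K) = expSigma K G o (1 / 2 : K) := by
    rw [← expSigma_add, show (1 + -1 / 2 : K) = 1 / 2 by norm_num]
  rw [add_mul, P.t_mul_t, P.t_mul_t, f1, f2, map_add, mul_add, T.d2_fst, LegPair.t, LegPair.t,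
    LegPair.t, LegPair.t, map_one, mul_one, map_mul T.e23, mul_assoc, legs12_snd, legs12_snd]
  rfl

lemma e23_mul_d2_link : T.e23 (P.link G o J * F) * T.d2 (P.link G o J) =
    fexp K (T.legs12.extSum G o J + T.extSum₃ G o J) *
      fexp K (T.legs12.t (G.H o) (sigma K G o) + T.legs13.t (G.H o) (sigma K G o)) *
      T.e23 (P.link G o J * F) := by
  have hd : ∀ {b : B⟦X⟧}, X ∣ b → X ∣ T.d2 b := fun {b} hb => by
    simpa using X_dvd_map (Ψ := T.d2) (by rw [T.d2_X]) (n := 1) (a := b) (by simpa using hb)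
  nth_rw 2 [LegPair.link]
  rw [map_mul T.d2, map_fexp T.d2_X (P.X_dvd_extSum G o J), map_fexp T.d2_X (P.X_dvd_t_sigma G o)]
  refine SemiconjBy.mul_right ?_ ?_
  · exact semiconjBy_fexp (hd (P.X_dvd_extSum G o J))
      (dvd_add (T.legs12.X_dvd_extSum G o J) T.X_dvd_extSum₃)
      (T.semiconjBy_d2_extSum hP hG hD ho hJ)
  · refine semiconjBy_fexp (hd (P.X_dvd_t_sigma G o))
      (dvd_add (T.legs12.X_dvd_t_sigma G o) (T.legs13.X_dvd_t_sigma G o)) ?_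
    have h2 := SemiconjBy.mul_right (T.commute_fst (G.H o) (P.link G o J * F)).symm
      ((hP.semiconjBy_sigma hG hD ho hJ).map T.e23)
    rw [← T.d2_fst, ← T.d2_snd, ← map_mul] at h2
    refine (congrArg (SemiconjBy _ _) ?_).mpr h2
    rw [LegPair.prim, P.t_one_left, P.t_one_right, map_add, mul_add, T.d2_fst, LegPair.t,
      legs12_snd]
    rfl

/-- Multiplication with a link preserves the twist equation. -/
theorem IsCocycle.link_mul (hF : T.IsCocycle F) : T.IsCocycle (P.link G o J * F) := by
  have h1 := T.e12_mul_d1_link hP ho hJ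
  have h2 := T.e23_mul_d2_link hP hG hD ho hJ
  have h3 := T.link_mul_fexp hG ho hJ
  -- `h2` moves F₂₃ to the right, `h3` exchanges the link in legs 23 for the one in legs 12, the
  -- equation for F replaces legs 23 by legs 12, and `h1` moves F₁₂ back to the left.
  rw [IsCocycle, map_mul T.d2, ← mul_assoc, h2, map_mul T.e23, ← mul_assoc, ← h3, mul_assoc _ (T.e23 F),
    ← hF, map_mul T.e12, map_mul T.d1, mul_assoc (T.e12 (P.link G o J)), ← mul_assoc (T.e12 F), h1]
  simp only [mul_assoc]

end TripleLegs

end TripleLegs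

/-! ### The legs of the tensor powers of an enveloping algebra -/

section Legs

open PowerSeries

variable {K : Type*} [Field K] {A B C : Type*} [Ring A] [Algebra K A] [Ring B] [Algebra K B]
  [Ring C] [Algebra K C]

lemma mapAlgHom_X (f : A →ₐ[K] B) : mapAlgHom f X = X := by
  rw [mapAlgHom_apply]; exact map_X _

lemma mapAlgHom_C (f : A →ₐ[K] B) (a : A) : mapAlgHom f (PowerSeries.C a) = PowerSeries.C (f a) := by
  rw [mapAlgHom_apply]; exact PowerSeries.map_C _ _

lemma coeff_mapAlgHom (f : A →ₐ[K] B) (n : ℕ) (a : A⟦X⟧) :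
    coeff n (mapAlgHom f a) = f (coeff n a) := by
  rw [mapAlgHom_apply]; exact coeff_map _ _ _

lemma mapAlgHom_comp_apply (f : B →ₐ[K] C) (g : A →ₐ[K] B) (a : A⟦X⟧) :
    mapAlgHom f (mapAlgHom g a) = mapAlgHom (f.comp g) a := by
  ext n; simp only [coeff_mapAlgHom, AlgHom.comp_apply]

lemma commute_mapAlgHom {f : A →ₐ[K] C} {g : B →ₐ[K] C} (h : ∀ a b, Commute (f a) (g b))
    (a : A⟦X⟧) (b : B⟦X⟧) : Commute (mapAlgHom f a) (mapAlgHom g b) := by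
  rw [Commute, SemiconjBy]
  ext n
  rw [coeff_mul, coeff_mul, ← Finset.Nat.sum_antidiagonal_swap]
  refine Finset.sum_congr rfl fun p _ => ?_
  rw [coeff_mapAlgHom, coeff_mapAlgHom, coeff_mapAlgHom, coeff_mapAlgHom]
  exact (h _ _).eq

variable (K A) in
/-- The embeddings `a ↦ a ⊗ 1` and `a ↦ 1 ⊗ a`. -/
def tensorLegs : LegPair K A (A ⊗[K] A) where
  fst := mapAlgHom Algebra.TensorProduct.includeLeft
  snd := mapAlgHom Algebra.TensorProduct.includeRight
  fst_X := mapAlgHom_X _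
  snd_X := mapAlgHom_X _
  commute := commute_mapAlgHom fun a b => by
    simp [Commute, SemiconjBy, Algebra.TensorProduct.tmul_mul_tmul]

lemma tens_eq (a b : A⟦X⟧) : tens K a b = (tensorLegs K A).t a b := rfl

variable (K) (g : Type*) [LieRing g] [LieAlgebra K g]

/-- The coproduct of `U(g)⟦X⟧`. -/
def comulSeries : (U K g)⟦X⟧ →ₐ[K] (U K g ⊗[K] U K g)⟦X⟧ := mapAlgHom (comul K g)

/-- The counit of `U(g)⟦X⟧`. -/
def counitSeries : (U K g)⟦X⟧ →ₐ[K] K⟦X⟧ := mapAlgHom (counit K g)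

lemma comulSeries_X : comulSeries K g X = X := mapAlgHom_X _

/-- The maps that enter the twist equation for `U(g)⟦X⟧`. -/
def tensorTriple : TripleLegs (tensorLegs K (U K g)) (comulSeries K g)
    ((U K g ⊗[K] U K g) ⊗[K] U K g) where
  e12 := mapAlgHom Algebra.TensorProduct.includeLeft
  e23 := mapAlgHom ((Algebra.TensorProduct.assoc K K K (U K g) (U K g) (U K g)).symm.toAlgHom.comp
          (Algebra.TensorProduct.includeRight :
            (U K g ⊗[K] U K g) →ₐ[K] U K g ⊗[K] (U K g ⊗[K] U K g)))
  d1 := mapAlgHom (Algebra.TensorProduct.map (comul K g) (AlgHom.id K (U K g)))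
  d2 := mapAlgHom ((Algebra.TensorProduct.assoc K K K (U K g) (U K g) (U K g)).symm.toAlgHom.comp
          (Algebra.TensorProduct.map (AlgHom.id K (U K g)) (comul K g)))
  e12_X := mapAlgHom_X _
  e23_X := mapAlgHom_X _
  d1_X := mapAlgHom_X _
  d2_X := mapAlgHom_X _
  e12_snd a := by
    rw [tensorLegs, mapAlgHom_comp_apply, mapAlgHom_comp_apply]; rfl
  commute_snd b a := by
    rw [tensorLegs, mapAlgHom_comp_apply]
    refine commute_mapAlgHom (fun b a => ?_) _ _
    have : Commute (b ⊗ₜ[K] (1 : U K g)) ((1 : U K g ⊗[K] U K g) ⊗ₜ[K] a) := by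
      simp [Commute, SemiconjBy, Algebra.TensorProduct.tmul_mul_tmul]
    exact this
  commute_fst a b := by
    rw [tensorLegs, mapAlgHom_comp_apply]
    refine commute_mapAlgHom (fun a b => ?_) _ _
    have : Commute (a ⊗ₜ[K] (1 : U K g ⊗[K] U K g)) ((1 : U K g) ⊗ₜ[K] b) := by
      simp [Commute, SemiconjBy, Algebra.TensorProduct.tmul_mul_tmul]
    exact this.map (Algebra.TensorProduct.assoc K K K (U K g) (U K g) (U K g)).symm.toAlgHom
  d1_fst a := by
    rw [tensorLegs, comulSeries, mapAlgHom_comp_apply, mapAlgHom_comp_apply]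
    congr 2
  d1_snd a := by
    rw [tensorLegs, mapAlgHom_comp_apply, mapAlgHom_comp_apply]
    congr 2; ext x; simp [Algebra.TensorProduct.one_def]
  d2_fst a := by
    rw [tensorLegs, mapAlgHom_comp_apply, mapAlgHom_comp_apply]
    congr 2; ext x; simp [Algebra.TensorProduct.one_def]
  d2_snd a := by
    rw [tensorLegs, comulSeries, mapAlgHom_comp_apply, mapAlgHom_comp_apply]
    congr 2

variable {K g}

lemma twistedComul_eq {F f : (U K g ⊗[K] U K g)⟦X⟧} {a : (U K g)⟦X⟧} (hF : IsUnit F)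
    (h : SemiconjBy F (comulSeries K g a) f) : twistedComul K g F a = f := by
  have h1 : PowerSeries.map (comul K g).toRingHom a = comulSeries K g a := rfl
  rw [twistedComul, h1, h.eq, mul_assoc, Ring.mul_inverse_cancel _ hF, mul_one]

lemma isPrimitiveFor_iff {F : (U K g ⊗[K] U K g)⟦X⟧} {a : (U K g)⟦X⟧} (hF : IsUnit F) :
    IsPrimitiveFor F a ↔ SemiconjBy F (comulSeries K g a) ((tensorLegs K (U K g)).prim a) := by
  refine ⟨fun h => ?_, fun h => twistedComul_eq hF h⟩
  have h1 : F * comulSeries K g a * Ring.inverse F = (tensorLegs K (U K g)).prim a := h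
  rw [SemiconjBy, ← h1, mul_assoc _ _ F, Ring.inverse_mul_cancel _ hF, mul_one]

end Legs

/-! ### The chain of twists -/

section ChainTwist

open PowerSeries

variable {K : Type*} [Field K] [CharZero K] {N : ℕ}

/-- The first legs E_{o-i} commute with each other, and so do the second legs; the ordered product
of exponentials is thus the exponential of a sum, and the order of the factors is immaterial. -/
lemma extJordanian_eq_link {A : Type*} [Ring A] [Algebra K A] {G : Gens N A⟦X⟧} {s : Set (Fin N)}
    (hG : IsSpFamily K G s) {o : Fin N} (ho : o ∈ s) (hs : ∀ m, o < m → m ∈ s) :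
    extJordanian K G o = (tensorLegs K A).link G o (Finset.Ioi o) := by
  set l := ((List.finRange N).filter (fun i => o < i)).reverse with hl
  have hmem : ∀ i ∈ l, o < i := fun i hi => by simpa [hl] using hi
  have hnd : l.Nodup := List.nodup_reverse.2 ((List.nodup_finRange N).filter _)
  have hset : l.toFinset = Finset.Ioi o := by ext i; simp [hl]
  rw [extJordanian, LegPair.link, ← hl, fexp_list_sum l _ (fun i => dvd_mul_right _ _),
    LegPair.extSum, ← hset, List.sum_toFinset _ hnd]
  · congr 3
    refine List.map_congr_left fun i hi => ?_
    rw [tens_eq, Gens.M_of_ne _ (hmem i hi).ne]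
  · intro i hi j hj
    have hi := hmem i hi
    have hj := hmem j hj
    refine Commute.mul_left (commute_X _).symm (Commute.mul_right (commute_X _) ?_)
    rw [tens_eq, tens_eq, ← Gens.M_of_ne _ hi.ne, ← Gens.M_of_ne _ hj.ne]
    refine (tensorLegs K A).commute_t (hG.commute_M_left_M_left ho (hs i hi) (hs j hj) hi.ne' hj.ne') ?_
    exact IsSpFamily.commute_second_leg ho (fun l hl => (hG.commute_Ep_Ep ho hl ho (hs j hj)).mul_right
      (hG.commute_Ep_left_expSigma ho hl _)) (hs i hi) _

lemma chain_succ (k : Fin N) : chain K N (k + 1) =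
    (tensorLegs K (U K (sp K N))).link (gens K N k) k (Finset.Ioi k) * chain K N k := by
  rw [chain, dif_pos k.2, extJordanian_eq_link (isSpFamily_gens k.2.le)]
  · simp
  · intro m hm
    exact hm.le

lemma isUnit_chain (k : ℕ) : IsUnit (chain K N k) := by
  induction k with
  | zero => exact isUnit_one
  | succ k ih =>
    by_cases h : k < N
    · rw [chain_succ ⟨k, h⟩]
      exact (LegPair.isUnit_link _ _ _ _).mul ih
    · rw [chain, dif_neg h]; exact ih

omit [CharZero K] in
lemma comulSeries_emb (x : sp K N) : comulSeries K (sp K N) (emb K N x) =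
    (tensorLegs K (U K (sp K N))).prim (emb K N x) := by
  rw [LegPair.prim, LegPair.t_one_left, LegPair.t_one_right, comulSeries, emb, mapAlgHom_C, comul_ι,
    tensorLegs, mapAlgHom_C, mapAlgHom_C, ← map_add]
  rfl

lemma mem_Ioi_gens (k : Fin N) : ∀ m ∈ Finset.Ioi k, m ∈ {i : Fin N | k.val ≤ i.val} ∧ m ≠ k :=
  fun m hm => by
    rw [Finset.mem_Ioi] at hm
    exact ⟨hm.le, hm.ne'⟩

omit [CharZero K] in
lemma IsPrimitiveFamily.mono {A B : Type*} [Ring A] [Algebra K A] [Ring B] [Algebra K B]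
    {P : LegPair K A B} {D : A⟦X⟧ →ₐ[K] B⟦X⟧} {F : B⟦X⟧} {G : Gens N A⟦X⟧} {s t : Set (Fin N)}
    (h : IsPrimitiveFamily P D F G s) (hts : t ⊆ s) : IsPrimitiveFamily P D F G t :=
  ⟨fun hi hj => h.Ep (hts hi) (hts hj), fun hi hj => h.Fp (hts hi) (hts hj),
    fun hi hj => h.M (hts hi) (hts hj)⟩

/-- The modified generators are primitive for the twisted coproduct. -/
theorem isPrimitiveFamily_gens {k : ℕ} (hk : k ≤ N) :
    IsPrimitiveFamily (tensorLegs K (U K (sp K N))) (comulSeries K (sp K N)) (chain K N k)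
      (gens K N k) {i | k ≤ i.val} := by
  induction k with
  | zero =>
    refine ⟨fun _ _ => ?_, fun _ _ => ?_, fun _ _ => ?_⟩
    · rw [chain, SemiconjBy, one_mul, mul_one, gens, gens₀_Ep, comulSeries_emb]
    · rw [chain, SemiconjBy, one_mul, mul_one, gens, gens₀_Fp, comulSeries_emb]
    · rw [chain, SemiconjBy, one_mul, mul_one, gens, gens₀_M, comulSeries_emb]
  | succ k ih =>
    rw [gens_succ ⟨k, hk⟩, chain_succ ⟨k, hk⟩]
    refine ((ih (by omega)).modify (isSpFamily_gens (by omega)) (comulSeries_X _ _) (by simp)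
      (mem_Ioi_gens ⟨k, hk⟩)).mono fun i hi => ?_
    simp only [Set.mem_ofPred_eq, Finset.coe_Ioi, Set.mem_Ioi, Fin.lt_def] at hi ⊢
    omega

theorem isCocycle_chain (k : ℕ) : (tensorTriple K (sp K N)).IsCocycle (chain K N k) := by
  induction k with
  | zero => rw [chain, TripleLegs.IsCocycle, map_one, map_one, map_one, map_one]
  | succ k ih =>
    by_cases h : k < N
    · rw [chain_succ ⟨k, h⟩]
      exact TripleLegs.IsCocycle.link_mul _ (isPrimitiveFamily_gens h.le) (isSpFamily_gens h.le)
        (comulSeries_X _ _) (by simp) (mem_Ioi_gens ⟨k, h⟩) ih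
    · rw [chain, dif_neg h]; exact ih

omit [CharZero K] in
lemma counitSeries_emb (x : sp K N) : counitSeries K (sp K N) (emb K N x) = 0 := by
  rw [counitSeries, emb, mapAlgHom_C, counit_ι, map_zero]

omit [CharZero K] in
lemma gens_Em (k : ℕ) (i j : Fin N) : (gens K N k).Em i j = emb K N (rootMinus K i j) := by
  induction k with
  | zero => rfl
  | succ k ih =>
    rw [gens]
    split_ifs
    · exact ih
    · exact ih

omit [CharZero K] in
lemma gens_H (k : ℕ) (i : Fin N) : (gens K N k).H i = emb K N (cartan K i) := by
  induction k with
  | zero => rfl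
  | succ k ih =>
    rw [gens]
    split_ifs
    · exact ih
    · exact ih

lemma gens_M (k : ℕ) (i j : Fin N) : (gens K N k).M i j = emb K N (rootMinus K i j) := by
  rw [← gens₀_M]
  simp only [Gens.M, gens_Em, gens_H]
  rfl

omit [CharZero K] in
lemma counitSeries_Ep (k : ℕ) (i j : Fin N) :
    counitSeries K (sp K N) ((gens K N k).Ep i j) = 0 := by
  induction k generalizing i j with
  | zero => exact counitSeries_emb _
  | succ k ih =>
    rw [gens]
    split_ifs with h
    · rw [modify_Ep, map_sub, map_mul, map_mul, map_mul, ih, ih]; simp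
    · exact ih i j

omit [CharZero K] in
lemma flogOneAdd_zero {A : Type*} [Ring A] [Algebra K A] : flogOneAdd K (0 : A⟦X⟧) = 0 := by
  ext n
  rw [flogOneAdd, coeff_mk]
  refine (Finset.sum_eq_zero fun k hk => ?_).trans (map_zero _).symm
  rw [zero_pow (by have := (Finset.mem_Icc.1 hk).1; omega), map_zero, smul_zero]

omit [CharZero K] in
lemma counitSeries_sigma (k : ℕ) (i : Fin N) :
    counitSeries K (sp K N) (sigma K (gens K N k) i) = 0 := by
  rw [sigma, map_flogOneAdd (Ψ := counitSeries K (sp K N)) (mapAlgHom_X _) (X_dvd_X_mul _), map_mul, counitSeries_Ep, mul_zero,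
    flogOneAdd_zero]

/-- This serves both counit conditions. In every exponent both legs lie in the kernel of ε, so a map
killing such tensors sends each exponential to exp 0 = 1. -/
lemma map_chain_eq_one {C : Type*} [Ring C] [Algebra K C]
    (Ψ : (U K (sp K N) ⊗[K] U K (sp K N))⟦X⟧ →ₐ[K] C⟦X⟧) (hX : Ψ X = X)
    (h : ∀ a b, counitSeries K (sp K N) a = 0 → counitSeries K (sp K N) b = 0 →
      Ψ ((tensorLegs K (U K (sp K N))).t a b) = 0) (k : ℕ) : Ψ (chain K N k) = 1 := by
  induction k with
  | zero => exact map_one Ψ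
  | succ k ih =>
    by_cases hk : k < N
    · rw [chain_succ ⟨k, hk⟩, map_mul, ih, mul_one, ← LegPair.map_link _ _ _ _ Ψ hX, LegPair.link,
        LegPair.map_t, h _ _ (by rw [gens_H, counitSeries_emb]) (counitSeries_sigma _ _),
        LegPair.extSum, Finset.sum_eq_zero, fexp_zero, mul_one]
      intro m _
      rw [LegPair.map_t, h _ _ (by rw [gens_M, counitSeries_emb])
        (by rw [map_mul, counitSeries_Ep, zero_mul]), mul_zero]
    · rw [chain, dif_neg hk]; exact ih

theorem isTwist_chain (k : ℕ) : IsTwist K (sp K N) (chain K N k) where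
  isUnit := isUnit_chain k
  cocycle := isCocycle_chain k
  counit_left := by
    refine map_chain_eq_one (mapAlgHom ((Algebra.TensorProduct.lid K (U K (sp K N))).toAlgHom.comp
      (Algebra.TensorProduct.map (counit K (sp K N)) (AlgHom.id K (U K (sp K N))))))
      (mapAlgHom_X _) (fun a b ha _ => ?_) k
    rw [LegPair.t, map_mul]
    refine mul_eq_zero_of_left ?_ _
    rw [tensorLegs, mapAlgHom_comp_apply]
    ext n
    have := congrArg (coeff n) ha
    rw [counitSeries, coeff_mapAlgHom] at this
    rw [coeff_mapAlgHom]
    simp [this]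
  counit_right := by
    refine map_chain_eq_one (mapAlgHom ((Algebra.TensorProduct.rid K K (U K (sp K N))).toAlgHom.comp
      (Algebra.TensorProduct.map (AlgHom.id K (U K (sp K N))) (counit K (sp K N)))))
      (mapAlgHom_X _) (fun a b _ hb => ?_) k
    rw [LegPair.t, map_mul]
    refine mul_eq_zero_of_right _ ?_
    rw [tensorLegs, mapAlgHom_comp_apply]
    ext n
    have := congrArg (coeff n) hb
    rw [counitSeries, coeff_mapAlgHom] at this
    rw [coeff_mapAlgHom]
    simp [this]

/-- The coproducts of the generators after a further link. -/
theorem hasStepCostructure_chain (k : Fin N) :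
    HasStepCostructure K (chain K N (k + 1)) (gens K N k) k := by
  have hP := isPrimitiveFamily_gens (K := K) k.2.le
  have hG := isSpFamily_gens (K := K) k.2.le
  have ho : k ∈ {i : Fin N | k.val ≤ i.val} := by simp
  have hJ := mem_Ioi_gens k
  have hu := isUnit_chain (K := K) (N := N) (k + 1)
  have key : ∀ {a f}, SemiconjBy ((tensorLegs K (U K (sp K N))).link (gens K N k) k (Finset.Ioi k)
      * chain K N k) (comulSeries K (sp K N) a) f →
      twistedComul K (sp K N) (chain K N (k + 1)) a = f := fun h =>
    twistedComul_eq hu (by rwa [chain_succ])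
  have hm : ∀ {i}, k < i → i ∈ Finset.Ioi k := fun h => Finset.mem_Ioi.2 h
  refine ⟨fun i hi => ?_, fun i j hi hij => ?_, fun i hi => ?_, fun i j hi hij => ?_,
    fun i j hi hj hij => ?_, fun i hi => ?_⟩
  · rw [key (hP.semiconjBy_Ep hG ho hJ (hm hi) (hm hi)), two_mul, pow_two ((gens K N k).Ep k i),
      ← add_assoc]
    rfl
  · exact key (hP.semiconjBy_Ep hG ho hJ (hm hi) (hm (hi.trans hij)))
  · rw [key (hP.semiconjBy_Fp hG ho hJ (hm hi) (hm hi)), two_mul, pow_two ((gens K N k).Em k i),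
      ← add_assoc, Gens.M_of_ne _ hi.ne]
    rfl
  · rw [key (hP.semiconjBy_Fp hG ho hJ (hm hi) (hm (hi.trans hij))), Gens.M_of_ne _ hi.ne,
      Gens.M_of_ne _ (hi.trans hij).ne]
    rfl
  · rw [← Gens.M_of_ne _ hij]
    exact key (hP.semiconjBy_M hG ho hJ (hm hi) (hm hj))
  · refine key ?_
    rw [IsSpFamily.H_eq (K := K), map_smul]
    refine (congrArg (SemiconjBy _ _) ?_).mpr
      ((hP.semiconjBy_M hG ho hJ (hm hi) (hm hi)).smul_right (2⁻¹ : K))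
    rw [← LegPair.prim_smul]
    rfl

end ChainTwist

/-! ### The continuous extension of an algebra map -/

section Extend

open PowerSeries

variable {K : Type*} [Field K] {A B : Type*} [Ring A] [Algebra K A] [Ring B] [Algebra K B]

/-- The series `∑ₙ Xⁿ cₙ`. -/
def sumX (c : ℕ → B⟦X⟧) : B⟦X⟧ :=
  PowerSeries.mk fun n => ∑ p ∈ Finset.HasAntidiagonal.antidiagonal n, coeff p.2 (c p.1)

lemma sumX_eq (c : ℕ → B⟦X⟧) : sumX c = c 0 + X * sumX fun n => c (n + 1) := by
  ext n
  rw [map_add, sumX, coeff_mk]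
  cases n with
  | zero => simp
  | succ n => rw [Finset.Nat.sum_antidiagonal_succ, coeff_succ_X_mul, sumX, coeff_mk]

lemma map_sumX (Ψ : A⟦X⟧ →ₐ[K] B⟦X⟧) (hΨ : Ψ X = X) (c : ℕ → A⟦X⟧) :
    Ψ (sumX c) = sumX fun n => Ψ (c n) := by
  refine ext_of_X_pow_dvd fun n => ?_
  induction n generalizing c with
  | zero => simp
  | succ n ih =>
    rw [sumX_eq c, sumX_eq fun n => Ψ (c n), map_add, map_mul, hΨ, add_sub_add_left_eq_sub,
      ← mul_sub, pow_succ']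
    exact mul_dvd_mul_left _ (ih _)

variable (f : A →ₐ[K] B⟦X⟧)

lemma extendSeries_eq (a : A⟦X⟧) : extendSeries f a = sumX fun n => f (coeff n a) := rfl

lemma extendSeries_C_add_X_mul (a : A) (b : A⟦X⟧) :
    extendSeries f (C a + X * b) = f a + X * extendSeries f b := by
  rw [extendSeries_eq, sumX_eq, extendSeries_eq]
  simp [coeff_succ_X_mul]

lemma extendSeries_add (a b : A⟦X⟧) :
    extendSeries f (a + b) = extendSeries f a + extendSeries f b := by
  ext n
  simp only [extendSeries, coeff_mk, map_add, Finset.sum_add_distrib]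

lemma extendSeries_C (a : A) : extendSeries f (C a) = f a := by
  have h0 : extendSeries f 0 = 0 := by
    have := extendSeries_add f 0 0
    rwa [add_zero, left_eq_add] at this
  have := extendSeries_C_add_X_mul f a 0
  rwa [mul_zero, add_zero, h0, mul_zero, add_zero] at this

lemma extendSeries_X_mul (a : A⟦X⟧) : extendSeries f (X * a) = X * extendSeries f a := by
  have := extendSeries_C_add_X_mul f 0 a
  rwa [map_zero, zero_add, map_zero, zero_add] at this

lemma exists_eq_C_add_X_mul (a : A⟦X⟧) : ∃ (c : A) (b : A⟦X⟧), a = C c + X * b := by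
  refine ⟨coeff 0 a, mk fun n => coeff (n + 1) a, ?_⟩
  ext n
  cases n with
  | zero => simp
  | succ n => simp [coeff_succ_X_mul]

/-- After splitting off constant terms, multiplicativity of f and centrality of X show that the
defect is X times a sum of two other defects. Hence it is divisible by every power of X. -/
lemma extendSeries_mul (a b : A⟦X⟧) :
    extendSeries f (a * b) = extendSeries f a * extendSeries f b := by
  refine ext_of_X_pow_dvd fun n => ?_
  induction n generalizing a b with
  | zero => simp
  | succ n ih =>
    obtain ⟨a₀, a, rfl⟩ := exists_eq_C_add_X_mul a
    obtain ⟨b₀, b, rfl⟩ := exists_eq_C_add_X_mul b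
    have e1 : (C a₀ + X * a) * (C b₀ + X * b) =
        C (a₀ * b₀) + X * (C a₀ * b + a * (C b₀ + X * b)) := by
      rw [add_mul, mul_add (C a₀), ← map_mul, ← mul_assoc (C a₀) X, (commute_X (C a₀)).eq,
        mul_assoc X, mul_assoc X, add_assoc, ← mul_add]
    have e2 : extendSeries f ((C a₀ + X * a) * (C b₀ + X * b)) -
        extendSeries f (C a₀ + X * a) * extendSeries f (C b₀ + X * b) =
        X * ((extendSeries f (C a₀ * b) - extendSeries f (C a₀) * extendSeries f b) +
          (extendSeries f (a * (C b₀ + X * b)) -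
            extendSeries f a * extendSeries f (C b₀ + X * b))) := by
      rw [e1, extendSeries_C_add_X_mul, extendSeries_C_add_X_mul, extendSeries_C_add_X_mul,
        extendSeries_add, extendSeries_C, add_mul (f a₀), mul_add (f a₀), map_mul f,
        ← mul_assoc (f a₀) X, (commute_X (f a₀)).eq]
      simp only [mul_add, mul_sub, mul_assoc]
      abel
    rw [e2, pow_succ']
    exact mul_dvd_mul_left _ (dvd_add (ih _ _) (ih _ _))

/-- The continuous extension, as a homomorphism. -/
def extendHom : A⟦X⟧ →ₐ[K] B⟦X⟧ where
  toFun := extendSeries f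
  map_one' := by
    have := extendSeries_C f 1
    rwa [map_one, map_one] at this
  map_mul' := extendSeries_mul f
  map_zero' := by
    have := extendSeries_C f 0
    rwa [map_zero, map_zero] at this
  map_add' := extendSeries_add f
  commutes' r := by
    rw [PowerSeries.algebraMap_apply, extendSeries_C, AlgHom.commutes]

lemma extendHom_apply (a : A⟦X⟧) : extendHom f a = extendSeries f a := rfl

lemma extendHom_X : extendHom f X = X := by
  have := extendSeries_X_mul f 1
  rw [← extendHom_apply, ← extendHom_apply, map_one, mul_one, mul_one] at this
  exact this

variable (K A) in
/-- The constant coefficient, as a homomorphism of algebras. -/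
def constCoeffHom : A⟦X⟧ →ₐ[K] A :=
  { constantCoeff with commutes' := fun r => by simp [PowerSeries.algebraMap_apply] }

/-- Injectivity modulo X is enough: a series in the kernel has constant term zero, and after
cancelling X the quotient is in the kernel again. -/
lemma extendSeries_injective (h : Function.Injective ((constCoeffHom K B).comp f)) :
    Function.Injective (extendSeries f) := by
  have key : ∀ n, ∀ a : A⟦X⟧, extendHom f a = 0 → X ^ n ∣ a := by
    intro n
    induction n with
    | zero => simp
    | succ n ih =>
      intro a ha
      obtain ⟨c, b, rfl⟩ := exists_eq_C_add_X_mul a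
      rw [extendHom_apply, extendSeries_C_add_X_mul] at ha
      have hc : c = 0 := by
        refine h ?_
        have := congrArg (constCoeffHom K B) ha
        rw [map_add, map_mul] at this
        simpa [constCoeffHom] using this
      rw [hc, map_zero, zero_add] at ha
      rw [hc, map_zero, zero_add, pow_succ']
      refine mul_dvd_mul_left _ (ih b ?_)
      ext n
      have := congrArg (coeff (n + 1)) ha
      rwa [coeff_succ_X_mul, map_zero] at this
  intro a b hab
  refine ext_of_X_pow_dvd fun n => key n _ ?_
  rw [map_sub, sub_eq_zero]
  exact hab

/-- Preimages are chosen for the coefficients one by one and summed X-adically; the continuous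
extension respects such sums. -/
lemma range_extendSeries_subset {A' : Type*} [Ring A'] [Algebra K A'] (f' : A' →ₐ[K] B⟦X⟧)
    (h : ∀ a, f' a ∈ (extendHom f).range) :
    Set.range (extendSeries f') ⊆ Set.range (extendSeries f) := by
  rintro _ ⟨b, rfl⟩
  choose c hc using h
  refine ⟨sumX fun n => c (coeff n b), ?_⟩
  rw [← extendHom_apply, map_sumX _ (extendHom_X f), extendSeries_eq]
  congr 1
  funext n
  exact hc _

end Extend

/-! ### The copies of the smaller symplectic algebras -/

section Copies

open PowerSeries

variable {K : Type*} [Field K] {N : ℕ}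

lemma spLin_mem {n : ℕ} {R : Type*} [Ring R] [Algebra K R] {G : Gens n R} (S : Submodule K R)
    (hM : ∀ i j, G.M i j ∈ S) (hE : ∀ i j, G.Ep i j ∈ S) (hF : ∀ i j, G.Fp i j ∈ S) (x : sp K n) :
    spLin K G x ∈ S := by
  have h : ∀ (f : Fin n → Fin n → R), (∀ i j, f i j ∈ S) → ∀ A, matSum K f A ∈ S := fun f hf A =>
    S.sum_mem (t := Finset.univ) (f := fun i => ∑ j, A i j • f i j) fun i _ =>
      Submodule.sum_mem _ fun j _ => S.smul_mem _ (hf i j)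
  exact add_mem (add_mem (h _ hM _) (S.smul_mem _ (h _ hE _))) (S.smul_mem _ (h _ hF _))

variable [CharZero K]

variable (K N) in
/-- The `k` times modified generators, indexed like the generators of `sp(N - k)`. -/
def shiftGens (k : ℕ) : Gens (N - k) (U K (sp K N))⟦X⟧ where
  Ep i j := (gens K N k).Ep (shift k i) (shift k j)
  Fp i j := (gens K N k).Fp (shift k i) (shift k j)
  Em i j := (gens K N k).Em (shift k i) (shift k j)
  H i := (gens K N k).H (shift k i)

omit [CharZero K] in
lemma shift_inj {k : ℕ} {i j : Fin (N - k)} : shift k i = shift k j ↔ i = j := by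
  simp [shift, Fin.ext_iff]

omit [CharZero K] in
lemma kron_shift {k : ℕ} (i j : Fin (N - k)) : kron K (shift k i) (shift k j) = kron K i j := by
  simp [kron, shift_inj]

omit [CharZero K] in
lemma shiftGens_M (k : ℕ) (i j : Fin (N - k)) :
    (shiftGens K N k).M i j = (gens K N k).M (shift k i) (shift k j) := by
  simp [Gens.M, shift_inj, shiftGens]

omit [CharZero K] in
lemma shift_mem {k : ℕ} (i : Fin (N - k)) : shift k i ∈ {i : Fin N | k ≤ i.val} := by
  simp [shift]

omit [CharZero K] in
lemma shiftGens_Ep (k : ℕ) (i j : Fin (N - k)) :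
    (shiftGens K N k).Ep i j = (gens K N k).Ep (shift k i) (shift k j) := rfl

omit [CharZero K] in
lemma shiftGens_Fp (k : ℕ) (i j : Fin (N - k)) :
    (shiftGens K N k).Fp i j = (gens K N k).Fp (shift k i) (shift k j) := rfl

lemma isSpFamily_shiftGens {k : ℕ} (hk : k ≤ N) : IsSpFamily K (shiftGens K N k) Set.univ := by
  have h := isSpFamily_gens (K := K) hk
  refine ⟨fun _ _ => h.Ep_symm (shift_mem _) (shift_mem _),
    fun _ _ => h.Fp_symm (shift_mem _) (shift_mem _), ?_, ?_, ?_, ?_,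
    fun _ _ _ _ => h.lie_Ep_Ep (shift_mem _) (shift_mem _) (shift_mem _) (shift_mem _),
    fun _ _ _ _ => h.lie_Fp_Fp (shift_mem _) (shift_mem _) (shift_mem _) (shift_mem _)⟩ <;>
    intros <;> simp only [shiftGens_M, ← kron_shift (K := K)]
  · exact h.lie_M_M (shift_mem _) (shift_mem _) (shift_mem _) (shift_mem _)
  · exact h.lie_M_Ep (shift_mem _) (shift_mem _) (shift_mem _) (shift_mem _)
  · exact h.lie_M_Fp (shift_mem _) (shift_mem _) (shift_mem _) (shift_mem _)
  · exact h.lie_Ep_Fp (shift_mem _) (shift_mem _) (shift_mem _) (shift_mem _)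

variable (K N) in
/-- The copy of `sp(N - k)` spanned by the `k` times modified generators. -/
def copyHom (k : ℕ) : sp K (N - k) →ₗ⁅K⁆ (U K (sp K N))⟦X⟧ :=
  -- For k > N the truncated difference N - k is 0; the value 0 is only a default.
  if hk : k ≤ N then (isSpFamily_shiftGens hk).spHom else 0

lemma copyHom_apply {k : ℕ} (hk : k ≤ N) (x : sp K (N - k)) :
    copyHom K N k x = spLin K (shiftGens K N k) x := by
  rw [copyHom, dif_pos hk]; rfl

lemma copyHom_rootEplus {k : ℕ} (hk : k ≤ N) (i j : Fin (N - k)) :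
    copyHom K N k (rootEplus K i j) = (gens K N k).Ep (shift k i) (shift k j) := by
  rw [copyHom_apply hk, (isSpFamily_shiftGens hk).spLin_rootEplus]; rfl

lemma copyHom_rootFplus {k : ℕ} (hk : k ≤ N) (i j : Fin (N - k)) :
    copyHom K N k (rootFplus K i j) = (gens K N k).Fp (shift k i) (shift k j) := by
  rw [copyHom_apply hk, (isSpFamily_shiftGens hk).spLin_rootFplus]; rfl

lemma copyHom_rootMinus {k : ℕ} (hk : k ≤ N) (i j : Fin (N - k)) :
    copyHom K N k (rootMinus K i j) = (gens K N k).M (shift k i) (shift k j) := by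
  rw [copyHom_apply hk, spLin_rootMinus, shiftGens_M]

lemma copyHom_cartan {k : ℕ} (hk : k ≤ N) (i : Fin (N - k)) :
    copyHom K N k (cartan K i) = (gens K N k).H (shift k i) := by
  rw [copyHom_apply hk, spLin_cartan]; rfl

lemma isPrimitiveFor_copyHom {k : ℕ} (hk : k ≤ N) (x : sp K (N - k)) :
    IsPrimitiveFor (chain K N k) (copyHom K N k x) := by
  rw [isPrimitiveFor_iff (isUnit_chain k), copyHom_apply hk]
  let S : Submodule K (U K (sp K N))⟦X⟧ :=
    { carrier := {a | SemiconjBy (chain K N k) (comulSeries K (sp K N) a)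
        ((tensorLegs K (U K (sp K N))).prim a)}
      add_mem' := fun {a b} ha hb => by
        simp only [Set.mem_ofPred_eq, map_add, LegPair.prim_add] at *
        exact ha.add_right hb
      zero_mem' := by
        have : (tensorLegs K (U K (sp K N))).prim 0 = 0 := by
          rw [LegPair.prim, LegPair.t_zero_left, LegPair.t_zero_right, add_zero]
        simp only [Set.mem_ofPred_eq, map_zero, this]
        exact SemiconjBy.zero_right _
      smul_mem' := fun c a ha => by
        simp only [Set.mem_ofPred_eq, map_smul, LegPair.prim_smul] at *
        exact ha.smul_right c }
  have hP := isPrimitiveFamily_gens (K := K) hk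
  refine spLin_mem S (fun i j => ?_) (fun i j => ?_) (fun i j => ?_) x
  · rw [shiftGens_M]; exact hP.M (shift_mem i) (shift_mem j)
  · exact hP.Ep (shift_mem i) (shift_mem j)
  · exact hP.Fp (shift_mem i) (shift_mem j)

omit [CharZero K] in
-- All corrections are multiples of X. Modulo X the copy of `sp(N - k)` is therefore the standard
-- one inside `sp(N)`, which is how its injectivity is tested.
lemma constCoeff_Ep (k : ℕ) (i j : Fin N) :
    constCoeffHom K _ ((gens K N k).Ep i j) = UniversalEnvelopingAlgebra.ι K (rootEplus K i j) := by
  induction k generalizing i j with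
  | zero => exact constantCoeff_C _
  | succ k ih =>
    rw [gens]
    split_ifs with h
    · rw [modify_Ep, map_sub, map_mul, ih, show constCoeffHom K (U K (sp K N)) X = 0 from
        constantCoeff_X, zero_mul, sub_zero]
    · exact ih i j

omit [CharZero K] in
lemma constCoeff_Fp (k : ℕ) (i j : Fin N) :
    constCoeffHom K _ ((gens K N k).Fp i j) = UniversalEnvelopingAlgebra.ι K (rootFplus K i j) := by
  induction k generalizing i j with
  | zero => exact constantCoeff_C _
  | succ k ih =>
    rw [gens]
    split_ifs with h
    · have : (modify K (gens K N k) ⟨k, h⟩).Fp i j = (gens K N k).Fp i j -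
        X * ((gens K N k).Em ⟨k, h⟩ i * (gens K N k).Em ⟨k, h⟩ j) := rfl
      rw [this, map_sub, map_mul, ih, show constCoeffHom K (U K (sp K N)) X = 0 from
        constantCoeff_X, zero_mul, sub_zero]
    · exact ih i j

lemma constCoeff_M (k : ℕ) (i j : Fin N) :
    constCoeffHom K _ ((gens K N k).M i j) = UniversalEnvelopingAlgebra.ι K (rootMinus K i j) := by
  rw [gens_M]; exact constantCoeff_C _

variable (K N) in
/-- The defining representation of `sp(N)`. -/
def stdRep : U K (sp K N) →ₐ[K] Matrix (Fin N ⊕ Fin N) (Fin N ⊕ Fin N) K :=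
  UniversalEnvelopingAlgebra.lift K (sp K N).incl

omit [CharZero K] in
lemma stdRep_ι (x : sp K N) : stdRep K N (UniversalEnvelopingAlgebra.ι K x) = x.1 := by
  rw [stdRep, UniversalEnvelopingAlgebra.lift_ι_apply]; rfl

omit [CharZero K] in
lemma ι_sp_injective :
    Function.Injective (UniversalEnvelopingAlgebra.ι K : sp K N → U K (sp K N)) := fun x y h => by
  have := congrArg (stdRep K N) h
  rw [stdRep_ι, stdRep_ι] at this
  exact Subtype.ext this

omit [CharZero K] in
lemma map_spLin {n : ℕ} {R S : Type*} [Ring R] [Algebra K R] [AddCommGroup S] [Module K S]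
    (f : R →ₗ[K] S) (G : Gens n R) {x : sp K n} {A B C : Matrix (Fin n) (Fin n) K}
    (h : x.1 = Matrix.fromBlocks A B C (-A.transpose)) :
    f (spLin K G x) = (∑ i, ∑ j, A i j • f (G.M i j)) +
      (2⁻¹ : K) • (∑ i, ∑ j, B i j • f (G.Ep i j)) +
      (2⁻¹ : K) • (∑ i, ∑ j, C i j • f (G.Fp i j)) := by
  rw [spLin_apply G h]
  simp only [matSum, LinearMap.coe_mk, AddHom.coe_mk, map_add, map_smul, map_sum]

/-- The matrix x can be read off at the shifted positions of its image modulo X. Three blocks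
suffice, because the fourth is determined by the first. -/
lemma stdRep_copyHom {k : ℕ} (hk : k ≤ N) (x : sp K (N - k)) (a b : Fin (N - k)) :
    stdRep K N (constCoeffHom K _ (copyHom K N k x)) (Sum.inl (shift k a)) (Sum.inl (shift k b)) =
      x.1 (Sum.inl a) (Sum.inl b) ∧
    stdRep K N (constCoeffHom K _ (copyHom K N k x)) (Sum.inl (shift k a)) (Sum.inr (shift k b)) =
      x.1 (Sum.inl a) (Sum.inr b) ∧
    stdRep K N (constCoeffHom K _ (copyHom K N k x)) (Sum.inr (shift k a)) (Sum.inl (shift k b)) =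
      x.1 (Sum.inr a) (Sum.inl b) := by
  obtain ⟨A, B, C, hB, hC, hx⟩ := sp_eq_fromBlocks x
  rw [copyHom_apply hk, hx]
  have hM : ∀ i j, stdRep K N (constCoeffHom K _ ((shiftGens K N k).M i j)) =
      (rootMinus K (shift k i) (shift k j)).1 := fun i j => by
    rw [shiftGens_M, constCoeff_M, stdRep_ι]
  have hE : ∀ i j, stdRep K N (constCoeffHom K _ ((shiftGens K N k).Ep i j)) =
      (rootEplus K (shift k i) (shift k j)).1 := fun i j => by
    rw [shiftGens_Ep, constCoeff_Ep, stdRep_ι]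
  have hF : ∀ i j, stdRep K N (constCoeffHom K _ ((shiftGens K N k).Fp i j)) =
      (rootFplus K (shift k i) (shift k j)).1 := fun i j => by
    rw [shiftGens_Fp, constCoeff_Fp, stdRep_ι]
  have h := map_spLin ((stdRep K N).comp (constCoeffHom K _)).toLinearMap (shiftGens K N k) hx
  simp only [AlgHom.toLinearMap_apply, AlgHom.comp_apply, hM, hE, hF] at h
  rw [h]
  have hB' : B b a = B a b := congrFun (congrFun hB a) b
  have hC' : C b a = C a b := congrFun (congrFun hC a) b
  have h2 : ∀ c : K, 2⁻¹ * (c + c) = c := fun c => by rw [← two_mul, ← mul_assoc, inv_mul_cancel₀ two_ne_zero, one_mul]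
  simp only [rootMinus, rootEplus, rootFplus, Matrix.add_apply, Matrix.sum_apply, Matrix.smul_apply,
    Matrix.fromBlocks_apply₁₁, Matrix.fromBlocks_apply₁₂, Matrix.fromBlocks_apply₂₁,
    Matrix.zero_apply, Finset.sum_const_zero, add_zero, zero_add, Matrix.single_apply,
    shift_inj, smul_eq_mul, mul_add, Finset.sum_add_distrib, mul_ite, mul_one, mul_zero,
    ite_and, Finset.sum_ite_eq', Finset.mem_univ, if_true]
  have key : ∀ D : Matrix (Fin (N - k)) (Fin (N - k)) K,
      (∑ i, ∑ j, if i = a then if j = b then D i j else 0 else 0) = D a b := fun D => by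
    rw [Finset.sum_eq_single a] <;> simp +contextual
  rw [key, key, key, hB', hC', ← mul_add, ← mul_add, h2, h2]
  exact ⟨rfl, rfl, rfl⟩

lemma constCoeff_copyHom_injective {k : ℕ} (hk : k ≤ N) :
    Function.Injective fun x => constCoeffHom K _ (copyHom K N k x) := by
  intro x y h
  have h' := congrArg (stdRep K N) h
  obtain ⟨A, B, C, -, -, hx⟩ := sp_eq_fromBlocks x
  obtain ⟨A', B', C', -, -, hy⟩ := sp_eq_fromBlocks y
  refine Subtype.ext ?_
  have hxa := stdRep_copyHom hk x
  have hya := stdRep_copyHom hk y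
  simp only [hx, hy, Matrix.fromBlocks_apply₁₁, Matrix.fromBlocks_apply₁₂,
    Matrix.fromBlocks_apply₂₁] at hxa hya h'
  have e : A = A' ∧ B = B' ∧ C = C' := by
    refine ⟨?_, ?_, ?_⟩ <;> ext a b
    · rw [← (hxa a b).1, ← (hya a b).1, h']
    · rw [← (hxa a b).2.1, ← (hya a b).2.1, h']
    · rw [← (hxa a b).2.2, ← (hya a b).2.2, h']
  rw [hx, hy, e.1, e.2.1, e.2.2]

lemma exists_constCoeff_copyHom {k : ℕ} (hk : k ≤ N) (x : sp K (N - k)) :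
    ∃ y : sp K N, constCoeffHom K _ (copyHom K N k x) = UniversalEnvelopingAlgebra.ι K y := by
  rw [copyHom_apply hk]
  have := spLin_mem (G := shiftGens K N k) ((LinearMap.range
    (UniversalEnvelopingAlgebra.ι K : sp K N →ₗ⁅K⁆ U K (sp K N)).toLinearMap).comap
    (constCoeffHom K _).toLinearMap)
    (fun i j => ⟨_, by rw [shiftGens_M]; exact (constCoeff_M k _ _).symm⟩)
    (fun i j => ⟨_, (constCoeff_Ep k _ _).symm⟩) (fun i j => ⟨_, (constCoeff_Fp k _ _).symm⟩) x
  obtain ⟨y, hy⟩ := this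
  exact ⟨y, hy.symm⟩

/-- The copy of `sp(N - k)` generates a copy of its enveloping algebra. -/
theorem extendSeries_copyHom_injective {k : ℕ} (hk : k ≤ N) :
    Function.Injective (extendSeries (UniversalEnvelopingAlgebra.lift K (copyHom K N k))) := by
  refine extendSeries_injective _ ?_
  -- ψ is the reduction of the copy modulo X. It takes values in `sp(N)`, whose elements are
  -- primitive for the untwisted coproduct, so `lift_injective` applies to it.
  let ψ : sp K (N - k) →ₗ⁅K⁆ U K (sp K N) :=
    { (constCoeffHom K (U K (sp K N))).toLinearMap ∘ₗ (copyHom K N k).toLinearMap with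
      map_lie' := fun {x y} => by
        change constCoeffHom K _ (copyHom K N k ⁅x, y⁆) =
          ⁅constCoeffHom K _ (copyHom K N k x), constCoeffHom K _ (copyHom K N k y)⁆
        rw [LieHom.map_lie, Ring.lie_def, Ring.lie_def, map_sub, map_mul, map_mul] }
  have hψ : ∀ x, ψ x = constCoeffHom K _ (copyHom K N k x) := fun _ => rfl
  have : (constCoeffHom K _).comp (UniversalEnvelopingAlgebra.lift K (copyHom K N k)) =
      UniversalEnvelopingAlgebra.lift K ψ := by
    ext x
    simp only [LieHom.comp_apply, AlgHom.coe_toLieHom, AlgHom.comp_apply,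
      UniversalEnvelopingAlgebra.lift_ι_apply, hψ]
  rw [this]
  refine lift_injective ψ (fun x => ?_) (fun x => ?_) (constCoeff_copyHom_injective hk)
  · obtain ⟨y, hy⟩ := exists_constCoeff_copyHom hk x
    rw [hψ, hy, comul_ι]
  · obtain ⟨y, hy⟩ := exists_constCoeff_copyHom hk x
    rw [hψ, hy, counit_ι]

omit [CharZero K] in
lemma lift_mem_of_forall {g A : Type*} [LieRing g] [LieAlgebra K g] [Ring A] [Algebra K A]
    (φ : g →ₗ⁅K⁆ A) (S : Subalgebra K A) (h : ∀ x, φ x ∈ S) (u : U K g) :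
    UniversalEnvelopingAlgebra.lift K φ u ∈ S := by
  induction mem_adjoin_range_ι u using Algebra.adjoin_induction with
  | mem x hx =>
    obtain ⟨y, rfl⟩ := hx
    rw [UniversalEnvelopingAlgebra.lift_ι_apply]; exact h y
  | algebraMap r => rw [AlgHom.commutes]; exact S.algebraMap_mem r
  | add x y _ _ hx hy => rw [map_add]; exact add_mem hx hy
  | mul x y _ _ hx hy => rw [map_mul]; exact mul_mem hx hy

/-- The copy of `U(sp(N - k - 1))` is contained in the copy of `U(sp(N - k))`. -/
theorem range_extendSeries_copyHom_subset {k : ℕ} (hk : k < N) :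
    Set.range (extendSeries (UniversalEnvelopingAlgebra.lift K (copyHom K N (k + 1)))) ⊆
      Set.range (extendSeries (UniversalEnvelopingAlgebra.lift K (copyHom K N k))) := by
  refine range_extendSeries_subset _ _ fun a => lift_mem_of_forall _ _ (fun x => ?_) a
  set Φ := extendHom (UniversalEnvelopingAlgebra.lift K (copyHom K N k)) with hΦ
  have hX : Φ X = X := extendHom_X _
  have hemb : ∀ x, Φ (emb K (N - k) x) = copyHom K N k x := fun x => by
    rw [hΦ, extendHom_apply, emb, extendSeries_C, UniversalEnvelopingAlgebra.lift_ι_apply]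
  have hsh : ∀ i : Fin (N - (k + 1)), ∃ i' : Fin (N - k), shift k i' = shift (k + 1) i := fun i =>
    ⟨⟨i + 1, by omega⟩, by simp [shift, Fin.ext_iff]; omega⟩
  set o : Fin (N - k) := ⟨0, by omega⟩ with ho
  have hok : shift k o = ⟨k, hk⟩ := by simp [shift, ho]
  have hXm : (X : (U K (sp K N))⟦X⟧) ∈ Φ.range := ⟨X, hX⟩
  have hE : ∀ i j, (gens K N k).Ep (shift k i) (shift k j) ∈ Φ.range := fun i j =>
    ⟨_, (hemb _).trans (copyHom_rootEplus hk.le i j)⟩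
  have hF : ∀ i j, (gens K N k).Fp (shift k i) (shift k j) ∈ Φ.range := fun i j =>
    ⟨_, (hemb _).trans (copyHom_rootFplus hk.le i j)⟩
  have hM : ∀ i j, (gens K N k).M (shift k i) (shift k j) ∈ Φ.range := fun i j =>
    ⟨_, (hemb _).trans (copyHom_rootMinus hk.le i j)⟩
  -- The exponential is the image of the one formed from the unmodified generators of `sp(N - k)` at
  -- its lowest index.
  have hexp : ∀ c : K, expSigma K (gens K N k) ⟨k, hk⟩ c ∈ Φ.range := fun c => by
    refine ⟨expSigma K (gens₀ K (N - k)) o c, ?_⟩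
    change Φ _ = _
    rw [expSigma, map_fexp hX (X_dvd_smul_sigma _ _ _), map_smul, sigma,
      map_flogOneAdd hX (X_dvd_X_mul _), map_mul, hX, gens₀_Ep, hemb, copyHom_rootEplus hk.le, hok]
    rfl
  rw [copyHom_apply hk]
  refine spLin_mem (Subalgebra.toSubmodule Φ.range) (fun i j => ?_) (fun i j => ?_)
    (fun i j => ?_) x <;> obtain ⟨i', hi⟩ := hsh i <;> obtain ⟨j', hj⟩ := hsh j <;>
    rw [Subalgebra.mem_toSubmodule]
  -- The elements M are never modified, so those of steps k + 1 and k coincide.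
  · rw [shiftGens_M, ← hi, ← hj, gens_M, ← gens_M k]
    exact hM i' j'
  · rw [shiftGens_Ep, ← hi, ← hj, gens_succ ⟨k, hk⟩, modify_Ep]
    refine sub_mem (hE _ _) (mul_mem hXm (mul_mem (mul_mem ?_ ?_) (hexp _)))
    · rw [← hok]; exact hE _ _
    · rw [← hok]; exact hE _ _
  · rw [shiftGens_Fp, ← hi, ← hj, gens_succ ⟨k, hk⟩, modify_Fp]
    · refine sub_mem (hF _ _) (mul_mem hXm (mul_mem ?_ ?_))
      · rw [← hok]; exact hM _ _
      · rw [← hok]; exact hM _ _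
    · rw [hi]; simp [shift, Fin.ext_iff]; omega
    · rw [hj]; simp [shift, Fin.ext_iff]; omega

end Copies

/-! ### Coefficients in a subalgebra -/

section SeriesSub

open PowerSeries

variable {K : Type*} [Field K] {A : Type*} [Ring A] [Algebra K A]

/-- The series with coefficients in a subalgebra. -/
def seriesSub (S : Subalgebra K A) : Subalgebra K A⟦X⟧ where
  carrier := {a | ∀ n, coeff n a ∈ S}
  mul_mem' ha hb n := by
    rw [coeff_mul]; exact S.sum_mem fun p _ => S.mul_mem (ha _) (hb _)
  add_mem' ha hb n := by rw [map_add]; exact S.add_mem (ha n) (hb n)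
  algebraMap_mem' r n := by
    rw [PowerSeries.algebraMap_apply, coeff_C]
    split_ifs
    · exact S.algebraMap_mem r
    · exact S.zero_mem

variable {S : Subalgebra K A}

lemma C_mem_seriesSub {a : A} (h : a ∈ S) : PowerSeries.C a ∈ seriesSub S := fun n => by
  rw [coeff_C]
  split_ifs
  · exact h
  · exact S.zero_mem

lemma X_mem_seriesSub : X ∈ seriesSub S := fun n => by
  rw [coeff_X]
  split_ifs
  · exact S.one_mem
  · exact S.zero_mem

lemma fexp_mem_seriesSub {a : A⟦X⟧} (h : a ∈ seriesSub S) : fexp K a ∈ seriesSub S := fun n => by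
  rw [fexp, coeff_mk]
  exact S.sum_mem fun k _ => S.smul_mem (pow_mem h k n) _

lemma flogOneAdd_mem_seriesSub {a : A⟦X⟧} (h : a ∈ seriesSub S) :
    flogOneAdd K a ∈ seriesSub S := fun n => by
  rw [flogOneAdd, coeff_mk]
  exact S.sum_mem fun k _ => S.smul_mem (pow_mem h k n) _

variable {N : ℕ} {G : Gens N A⟦X⟧} {o : Fin N}

lemma sigma_mem_seriesSub (h : G.Ep o o ∈ seriesSub S) : sigma K G o ∈ seriesSub S :=
  flogOneAdd_mem_seriesSub (mul_mem X_mem_seriesSub h)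

lemma expSigma_mem_seriesSub (h : G.Ep o o ∈ seriesSub S) (c : K) :
    expSigma K G o c ∈ seriesSub S :=
  fexp_mem_seriesSub (Subalgebra.smul_mem _ (sigma_mem_seriesSub h) c)

lemma coeff_zero_fexp (a : A⟦X⟧) : coeff 0 (fexp K a) = 1 := by simp [fexp]

lemma coeff_one_fexp (a : A⟦X⟧) : coeff 1 (fexp K a) = coeff 1 a := by
  simp [fexp, Finset.sum_range_succ, coeff_one]

lemma coeff_one_X_mul (a : A⟦X⟧) : coeff 1 (X * a) = coeff 0 a := coeff_succ_X_mul 0 a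

lemma coeff_one_sigma (G : Gens N A⟦X⟧) (o : Fin N) :
    coeff 1 (sigma K G o) = coeff 0 (G.Ep o o) := by
  simp [sigma, flogOneAdd]

lemma coeff_one_mul (a b : A⟦X⟧) :
    coeff 1 (a * b) = coeff 0 a * coeff 1 b + coeff 1 a * coeff 0 b := by
  rw [coeff_mul, show (1 : ℕ) = 0 + 1 from rfl, Finset.Nat.sum_antidiagonal_succ]
  simp

lemma coeff_zero_mul' (a b : A⟦X⟧) : coeff 0 (a * b) = coeff 0 a * coeff 0 b := by
  simp [coeff_mul]

lemma coeff_zero_tensorLegs_t (a b : A⟦X⟧) :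
    coeff 0 ((tensorLegs K A).t a b) = coeff 0 a ⊗ₜ[K] coeff 0 b := by
  rw [LegPair.t, coeff_zero_mul', tensorLegs, coeff_mapAlgHom, coeff_mapAlgHom]
  simp

lemma coeff_one_tensorLegs_t (a b : A⟦X⟧) : coeff 1 ((tensorLegs K A).t a b) =
    coeff 0 a ⊗ₜ[K] coeff 1 b + coeff 1 a ⊗ₜ[K] coeff 0 b := by
  rw [LegPair.t, coeff_one_mul, tensorLegs, coeff_mapAlgHom, coeff_mapAlgHom, coeff_mapAlgHom,
    coeff_mapAlgHom]
  simp

end SeriesSub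

/-! ### The carrier of the chain -/

section Carrier

open PowerSeries UniversalEnvelopingAlgebra

variable {K : Type*} [Field K] {N : ℕ}

/-- The image of `U(L)` in `U(g)`. -/
def uSub {g : Type*} [LieRing g] [LieAlgebra K g] (L : LieSubalgebra K g) : Subalgebra K (U K g) :=
  (lift K ((ι K).comp L.incl)).range

/-- The image of `U(L) ⊗ U(L)` in `U(g) ⊗ U(g)`. -/
def uSubTensor {g : Type*} [LieRing g] [LieAlgebra K g] (L : LieSubalgebra K g) :
    Subalgebra K (U K g ⊗[K] U K g) :=
  (Algebra.TensorProduct.map (lift K ((ι K).comp L.incl)) (lift K ((ι K).comp L.incl))).range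

lemma ι_mem_uSub {g : Type*} [LieRing g] [LieAlgebra K g] {L : LieSubalgebra K g} {x : g}
    (h : x ∈ L) : ι K x ∈ uSub L :=
  ⟨ι K ⟨x, h⟩, by
    change lift K ((ι K).comp L.incl) _ = _
    rw [lift_ι_apply]; rfl⟩

lemma tensorLegs_t_mem {g : Type*} [LieRing g] [LieAlgebra K g] {L : LieSubalgebra K g}
    {a b : (U K g)⟦X⟧} (ha : a ∈ seriesSub (uSub L)) (hb : b ∈ seriesSub (uSub L)) :
    (tensorLegs K (U K g)).t a b ∈ seriesSub (uSubTensor L) := by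
  refine mul_mem (fun n => ?_) (fun n => ?_)
  · obtain ⟨u, hu⟩ := ha n
    refine ⟨u ⊗ₜ[K] 1, ?_⟩
    rw [tensorLegs, coeff_mapAlgHom, ← hu]
    simp
  · obtain ⟨u, hu⟩ := hb n
    refine ⟨1 ⊗ₜ[K] u, ?_⟩
    rw [tensorLegs, coeff_mapAlgHom, ← hu]
    simp

lemma rootEplus_mem_borelPlus (i j : Fin N) : rootEplus K i j ∈ borelPlus K N := by
  rcases le_total i j with h | h
  · exact LieSubalgebra.subset_lieSpan (Or.inl (Or.inl ⟨i, j, h, rfl⟩))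
  · rw [rootEplus_comm]
    exact LieSubalgebra.subset_lieSpan (Or.inl (Or.inl ⟨j, i, h, rfl⟩))

lemma rootMinus_mem_borelPlus {i j : Fin N} (h : i < j) : rootMinus K i j ∈ borelPlus K N :=
  LieSubalgebra.subset_lieSpan (Or.inl (Or.inr ⟨i, j, h, rfl⟩))

lemma cartan_mem_borelPlus (i : Fin N) : cartan K i ∈ borelPlus K N :=
  LieSubalgebra.subset_lieSpan (Or.inr ⟨i, rfl⟩)

lemma gens_Ep_mem (k : ℕ) (i j : Fin N) :
    (gens K N k).Ep i j ∈ seriesSub (uSub (borelPlus K N)) := by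
  induction k generalizing i j with
  | zero => exact C_mem_seriesSub (ι_mem_uSub (rootEplus_mem_borelPlus i j))
  | succ k ih =>
    rw [gens]
    split_ifs
    · rw [modify_Ep]
      exact sub_mem (ih i j) (mul_mem X_mem_seriesSub
        (mul_mem (mul_mem (ih _ _) (ih _ _)) (expSigma_mem_seriesSub (ih _ _) _)))
    · exact ih i j

variable [CharZero K]

/-- The chain is defined over the Borel subalgebra. -/
theorem isDefinedOver_chain (k : ℕ) : IsDefinedOver (chain K N k) (borelPlus K N) := by
  change chain K N k ∈ seriesSub (uSubTensor (borelPlus K N))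
  induction k with
  | zero => exact one_mem _
  | succ k ih =>
    by_cases h : k < N
    · rw [chain_succ ⟨k, h⟩]
      refine mul_mem (mul_mem (fexp_mem_seriesSub (sum_mem fun m hm => mul_mem X_mem_seriesSub
        (tensorLegs_t_mem ?_ (mul_mem (gens_Ep_mem _ _ _)
          (expSigma_mem_seriesSub (gens_Ep_mem _ _ _) _))))) (fexp_mem_seriesSub
        (tensorLegs_t_mem ?_ (sigma_mem_seriesSub (gens_Ep_mem _ _ _))))) ih
      · rw [gens_M]
        exact C_mem_seriesSub (ι_mem_uSub (rootMinus_mem_borelPlus (Finset.mem_Ioi.1 hm)))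
      · rw [gens_H]
        exact C_mem_seriesSub (ι_mem_uSub (cartan_mem_borelPlus _))
    · rw [chain, dif_neg h]; exact ih

variable (K) in
/-- The first legs of the coefficient of `X` in the chain. -/
def firstLeg (i j : Fin N) : sp K N := if i = j then cartan K i else rootMinus K i j

omit [CharZero K] in
lemma coeff_zero_link {A : Type*} [Ring A] [Algebra K A] (G : Gens N A⟦X⟧) (o : Fin N)
    (J : Finset (Fin N)) : coeff 0 ((tensorLegs K A).link G o J) = 1 := by
  rw [LegPair.link, coeff_zero_mul', coeff_zero_fexp, coeff_zero_fexp, one_mul]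

lemma coeff_zero_chain (k : ℕ) : coeff 0 (chain K N k) = 1 := by
  induction k with
  | zero => simp [chain]
  | succ k ih =>
    by_cases h : k < N
    · rw [chain_succ ⟨k, h⟩, coeff_zero_mul', ih, coeff_zero_link, one_mul]
    · rw [chain, dif_neg h]; exact ih

omit [CharZero K] in
lemma coeff_zero_emb (x : sp K N) : coeff 0 (emb K N x) = ι K x := coeff_zero_C _

omit [CharZero K] in
lemma coeff_zero_gens_Ep (k : ℕ) (i j : Fin N) :
    coeff 0 ((gens K N k).Ep i j) = ι K (rootEplus K i j) := by
  rw [coeff_zero_eq_constantCoeff]; exact constCoeff_Ep k i j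

lemma coeff_zero_tensorLegs_gens (k : ℕ) (o m : Fin N) :
    coeff 0 ((tensorLegs K (U K (sp K N))).t ((gens K N k).M o m)
      ((gens K N k).Ep o m * expSigma K (gens K N k) o (-1 / 2 : K))) =
      ι K (rootMinus K o m) ⊗ₜ[K] ι K (rootEplus K o m) := by
  rw [coeff_zero_tensorLegs_t, coeff_zero_mul', coeff_zero_gens_Ep, expSigma, coeff_zero_fexp,
    mul_one, gens_M, coeff_zero_emb]

lemma coeff_one_tensorLegs_sigma (k : ℕ) (o : Fin N) :
    coeff 1 ((tensorLegs K (U K (sp K N))).t ((gens K N k).H o) (sigma K (gens K N k) o)) =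
      ι K (cartan K o) ⊗ₜ[K] ι K (rootEplus K o o) := by
  have h0 : coeff 0 (sigma K (gens K N k) o) = 0 := by
    rw [coeff_zero_eq_constantCoeff]; exact X_dvd_iff.1 (X_dvd_sigma _ _)
  rw [coeff_one_tensorLegs_t, h0, TensorProduct.tmul_zero, add_zero, coeff_one_sigma,
    coeff_zero_gens_Ep, gens_H, coeff_zero_emb]

/-- To first order the exponentials are additive. The term m = o comes from H ⊗ σ, the terms m > o
from the extension, and e^{-σ/2} and the modifications do not contribute. -/
lemma coeff_one_link (k : ℕ) (o : Fin N) :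
    coeff 1 ((tensorLegs K (U K (sp K N))).link (gens K N k) o (Finset.Ioi o)) =
      ∑ m ∈ Finset.Ici o, ι K (firstLeg K o m) ⊗ₜ[K] ι K (rootEplus K o m) := by
  rw [LegPair.link, coeff_one_mul, coeff_zero_fexp, coeff_zero_fexp, coeff_one_fexp, coeff_one_fexp,
    one_mul, mul_one, coeff_one_tensorLegs_sigma, LegPair.extSum, map_sum, ← Finset.Ioi_insert,
    Finset.sum_insert Finset.notMem_Ioi_self]
  congr 1
  · rw [firstLeg, if_pos rfl]
  · refine Finset.sum_congr rfl fun m hm => ?_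
    rw [coeff_one_X_mul, coeff_zero_tensorLegs_gens, firstLeg, if_neg (Finset.mem_Ioi.1 hm).ne]

lemma coeff_one_chain : coeff 1 (chain K N N) =
    ∑ p : (o : Fin N) × {m // m ∈ Finset.Ici o},
      ι K (firstLeg K p.1 p.2) ⊗ₜ[K] ι K (rootEplus K p.1 p.2.1) := by
  have key : ∀ k ≤ N, coeff 1 (chain K N k) = ∑ i ∈ Finset.range k, if h : i < N then
      ∑ m ∈ Finset.Ici (⟨i, h⟩ : Fin N),
        ι K (firstLeg K ⟨i, h⟩ m) ⊗ₜ[K] ι K (rootEplus K ⟨i, h⟩ m) else 0 := by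
    intro k hk
    induction k with
    | zero => simp [chain, coeff_one]
    | succ k ih =>
      rw [chain_succ ⟨k, hk⟩, coeff_one_mul, coeff_zero_chain, coeff_zero_link, one_mul, mul_one,
        coeff_one_link, ih (Nat.le_of_succ_le hk), Finset.sum_range_succ,
        dif_pos (Nat.lt_of_succ_le hk)]
  rw [key N le_rfl, Finset.sum_range, Fintype.sum_sigma]
  refine Finset.sum_congr rfl fun o _ => ?_
  rw [dif_pos o.2]
  exact (Finset.sum_coe_sort (Finset.Ici o)
    fun m => ι K (firstLeg K o m) ⊗ₜ[K] ι K (rootEplus K o m)).symm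

omit [CharZero K] in
lemma linearIndependent_of_functionals {κ V : Type*} [Fintype κ] [AddCommGroup V] [Module K V]
    {v : κ → V} (l : κ → V →ₗ[K] K) (h : ∀ i j, j ≠ i → l i (v j) = 0) (h' : ∀ i, l i (v i) ≠ 0) :
    LinearIndependent K v := by
  rw [Fintype.linearIndependent_iff]
  intro c hc i
  have := congrArg (l i) hc
  rw [map_sum, map_zero, Finset.sum_eq_single i (fun j _ hj => by rw [map_smul, h i j hj, smul_zero])
    (by simp), map_smul, smul_eq_mul] at this
  exact (mul_eq_zero.1 this).resolve_right (h' i)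

variable (K N) in
/-- The matrix entries as functionals on `sp(N)`. -/
def entry (p q : Fin N ⊕ Fin N) : sp K N →ₗ[K] K where
  toFun x := x.1 p q
  map_add' _ _ := rfl
  map_smul' _ _ := rfl

omit [CharZero K] in
lemma entry_rootEplus (a b i j : Fin N) : entry K N (Sum.inl a) (Sum.inr b) (rootEplus K i j) =
    (if i = a ∧ j = b then 1 else 0) + (if j = a ∧ i = b then 1 else 0) := by
  change (rootEplus K i j).1 _ _ = _
  simp [rootEplus, Matrix.single_apply]

omit [CharZero K] in
lemma entry_rootMinus (a b i j : Fin N) : entry K N (Sum.inl a) (Sum.inl b) (rootMinus K i j) =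
    if i = a ∧ j = b then 1 else 0 := by
  change (rootMinus K i j).1 _ _ = _
  simp [rootMinus, Matrix.single_apply]

omit [CharZero K] in
lemma entry_cartan (a b i : Fin N) : entry K N (Sum.inl a) (Sum.inl b) (cartan K i) =
    if i = a ∧ i = b then 1 / 2 else 0 := by
  change (cartan K i).1 _ _ = _
  simp [cartan, Matrix.single_apply]

omit [CharZero K] in
lemma entry_rootMinus_inr (a b i j : Fin N) :
    entry K N (Sum.inl a) (Sum.inr b) (rootMinus K i j) = 0 := by
  change (rootMinus K i j).1 _ _ = _
  simp [rootMinus]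

omit [CharZero K] in
lemma entry_cartan_inr (a b i : Fin N) :
    entry K N (Sum.inl a) (Sum.inr b) (cartan K i) = 0 := by
  change (cartan K i).1 _ _ = _
  simp [cartan]

omit [CharZero K] in
lemma entry_rootEplus_inl (a b i j : Fin N) :
    entry K N (Sum.inl a) (Sum.inl b) (rootEplus K i j) = 0 := by
  change (rootEplus K i j).1 _ _ = _
  simp [rootEplus]

lemma linearIndependent_rootEplus : LinearIndependent K
    fun p : (o : Fin N) × {m // m ∈ Finset.Ici o} => rootEplus K p.1 p.2.1 := by
  refine linearIndependent_of_functionals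
    (fun p => entry K N (Sum.inl p.1) (Sum.inr p.2.1)) ?_ ?_
  · rintro ⟨o, m, hm⟩ ⟨o', m', hm'⟩ h
    have hm : o ≤ m := Finset.mem_Ici.1 hm
    have hm' : o' ≤ m' := Finset.mem_Ici.1 hm'
    rw [entry_rootEplus, if_neg, if_neg, add_zero]
    · rintro ⟨h1 : m' = o, h2 : o' = m⟩
      subst h1 h2
      have := le_antisymm hm hm'
      subst this
      exact h rfl
    · rintro ⟨h1 : o' = o, h2 : m' = m⟩
      subst h1 h2
      exact h rfl
  · rintro ⟨o, m, hm⟩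
    rw [entry_rootEplus, if_pos ⟨rfl, rfl⟩]
    split_ifs
    · norm_num
    · simp

lemma linearIndependent_firstLeg : LinearIndependent K
    fun p : (o : Fin N) × {m // m ∈ Finset.Ici o} => firstLeg K p.1 p.2.1 := by
  refine linearIndependent_of_functionals
    (fun p => entry K N (Sum.inl p.1) (Sum.inl p.2.1)) ?_ ?_
  · rintro ⟨o, m, hm⟩ ⟨o', m', hm'⟩ h
    have hne : ¬ (o' = o ∧ m' = m) := by
      rintro ⟨rfl, rfl⟩; exact h rfl
    simp only [firstLeg]
    split_ifs with h'
    · subst h'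
      rw [entry_cartan, if_neg hne]
    · rw [entry_rootMinus, if_neg hne]
  · rintro ⟨o, m, hm⟩
    simp only [firstLeg]
    split_ifs with h'
    · subst h'
      rw [entry_cartan, if_pos ⟨rfl, rfl⟩]; norm_num
    · rw [entry_rootMinus, if_pos ⟨rfl, rfl⟩]; exact one_ne_zero

omit [CharZero K] in
-- The flip allows `mem_of_sum_tmul_mem_range` to be used for the second legs as well.
lemma comm_mem_uSubTensor {g : Type*} [LieRing g] [LieAlgebra K g] {L : LieSubalgebra K g}
    {t : U K g ⊗[K] U K g} (h : t ∈ uSubTensor L) :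
    Algebra.TensorProduct.comm K (U K g) (U K g) t ∈ uSubTensor L := by
  obtain ⟨s, rfl⟩ := h
  refine ⟨Algebra.TensorProduct.comm K (U K L) (U K L) s, ?_⟩
  induction s using TensorProduct.induction_on with
  | zero => simp
  | tmul a b => simp
  | add a b ha hb => simp only [map_add, ha, hb]

/-- The chain is not defined over subalgebras that do not contain the Borel subalgebra. -/
theorem borelPlus_le_of_isDefinedOver {L : LieSubalgebra K (sp K N)}
    (hL : IsDefinedOver (chain K N N) L) : borelPlus K N ≤ L := by
  have h : coeff 1 (chain K N N) ∈ uSubTensor L := hL 1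
  have hc := comm_mem_uSubTensor h
  rw [coeff_one_chain] at h hc
  rw [map_sum] at hc
  simp only [Algebra.TensorProduct.comm_tmul] at hc
  -- Independence of the second legs puts the first legs into L, and conversely after the flip.
  have h1 := mem_of_sum_tmul_mem_range ι_sp_injective L linearIndependent_rootEplus h
  have h2 := mem_of_sum_tmul_mem_range ι_sp_injective L linearIndependent_firstLeg hc
  refine LieSubalgebra.lieSpan_le.2 ?_
  rintro x ((⟨i, j, hij, rfl⟩ | ⟨i, j, hij, rfl⟩) | ⟨i, rfl⟩)
  · exact h2 ⟨i, j, Finset.mem_Ici.2 hij⟩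
  · have := h1 ⟨i, j, Finset.mem_Ici.2 hij.le⟩
    rwa [firstLeg, if_neg hij.ne] at this
  · have := h1 ⟨i, i, Finset.mem_Ici.2 le_rfl⟩
    rwa [firstLeg, if_pos rfl] at this

theorem isCarrier_chain : IsCarrier (chain K N N) (borelPlus K N) :=
  ⟨isDefinedOver_chain N, fun _ hL => borelPlus_le_of_isDefinedOver hL⟩

theorem isFull_chain : IsFull K (chain K N N) :=
  ⟨_, isCarrier_chain, LieSubalgebra.lieSpan_mono Set.subset_union_left⟩

variable (K) in
/-- Linearly independent elements of the Borel subalgebra. -/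
def borelFamily (o : Fin N) : Option (Fin N × Fin N) → sp K N
  | none => cartan K o
  -- Pairs with p.1 ≥ p.2 stand for the E_{i+j}, so the N² pairs and one Cartan element give N² + 1
  -- elements; the other Cartan elements are not needed.
  | some p => if p.1 < p.2 then rootMinus K p.1 p.2 else rootEplus K p.1 p.2

omit [CharZero K] in
lemma borelFamily_mem (o : Fin N) (p : Option (Fin N × Fin N)) :
    borelFamily K o p ∈ borelPlus K N := by
  rcases p with _ | p
  · exact cartan_mem_borelPlus o
  · rw [borelFamily]
    split_ifs with h
    · exact rootMinus_mem_borelPlus h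
    · exact rootEplus_mem_borelPlus _ _

lemma linearIndependent_borelFamily (o : Fin N) : LinearIndependent K (borelFamily K o) := by
  refine linearIndependent_of_functionals (fun
    | none => entry K N (Sum.inl o) (Sum.inl o)
    | some p => if p.1 < p.2 then entry K N (Sum.inl p.1) (Sum.inl p.2) else
        entry K N (Sum.inl p.1) (Sum.inr p.2)) ?_ ?_
  · rintro (_ | ⟨a, b⟩) (_ | ⟨c, d⟩) h
    · exact absurd rfl h
    · simp only [borelFamily]
      split_ifs with h1
      · rw [entry_rootMinus, if_neg]
        rintro ⟨rfl, rfl⟩; exact lt_irrefl _ h1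
      · exact entry_rootEplus_inl _ _ _ _
    · simp only [borelFamily]
      split_ifs with h1
      · rw [entry_cartan, if_neg]
        rintro ⟨rfl, rfl⟩; exact lt_irrefl _ h1
      · exact entry_cartan_inr _ _ _
    · have hne : ¬ (c = a ∧ d = b) := by
        rintro ⟨rfl, rfl⟩; exact h rfl
      simp only [borelFamily]
      split_ifs with h1 h2 h2
      · rw [entry_rootMinus, if_neg hne]
      · exact entry_rootEplus_inl _ _ _ _
      · exact entry_rootMinus_inr _ _ _ _
      · rw [entry_rootEplus, if_neg hne, if_neg, add_zero]
        rintro ⟨rfl, rfl⟩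
        exact hne (by have := le_antisymm (not_lt.1 h1) (not_lt.1 h2); exact ⟨this, this.symm⟩)
  · rintro (_ | ⟨a, b⟩)
    · simp only [borelFamily]
      rw [entry_cartan, if_pos ⟨rfl, rfl⟩]; norm_num
    · simp only [borelFamily]
      split_ifs with h1
      · rw [entry_rootMinus, if_pos ⟨rfl, rfl⟩]; exact one_ne_zero
      · rw [entry_rootEplus, if_pos ⟨rfl, rfl⟩]
        split_ifs
        · norm_num
        · simp

/-- A subalgebra over which the chain is defined contains the Borel subalgebra and has dimension at
least N² + 1, whereas `sl(N)` lies in the N × N matrices. The hypothesis on N supplies the index of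
a Cartan element. -/
theorem isProper_chain (hN : 1 ≤ N) : IsProper K (chain K N N) := by
  rintro M ⟨e⟩ hM
  have hle := borelPlus_le_of_isDefinedOver hM
  let o : Fin N := ⟨0, hN⟩
  let v : Option (Fin N × Fin N) → M := fun p => ⟨borelFamily K o p, hle (borelFamily_mem o p)⟩
  have hv : LinearIndependent K v :=
    LinearIndependent.of_comp M.toSubmodule.subtype (linearIndependent_borelFamily o)
  have h1 := hv.fintype_card_le_finrank
  rw [e.toLinearEquiv.finrank_eq] at h1
  have h2 := Submodule.finrank_le (LieAlgebra.SpecialLinear.sl (Fin N) K).toSubmodule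
  rw [Module.finrank_matrix, Module.finrank_self, mul_one, Fintype.card_fin] at h2
  rw [Fintype.card_option, Fintype.card_prod, Fintype.card_fin] at h1
  have h3 : Module.finrank K (LieAlgebra.SpecialLinear.sl (Fin N) K) ≤ N * N := h2
  omega

end Carrier

end SpChain

end

theorem mainTheorem3 (K : Type*) [Field K] [CharZero K] (N : ℕ) (hN : 1 ≤ N) :
    -- every step reproduces the costructure on the successively modified generators
    (∀ k : Fin N, SpChain.HasStepCostructure K (SpChain.chain K N (k + 1))
      (SpChain.gens K N k) k) ∧
    -- the `k` times modified generators span a primitive copy of `sp(N - k)`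
    (∃ φ : ∀ k : ℕ, SpChain.sp K (N - k) →ₗ⁅K⁆ (SpChain.U K (SpChain.sp K N))⟦X⟧,
      (∀ k ≤ N,
        (∀ i j : Fin (N - k),
          φ k (SpChain.rootEplus K i j) =
            (SpChain.gens K N k).Ep (SpChain.shift k i) (SpChain.shift k j) ∧
          φ k (SpChain.rootFplus K i j) =
            (SpChain.gens K N k).Fp (SpChain.shift k i) (SpChain.shift k j)) ∧
        (∀ i j : Fin (N - k), i ≠ j →
          φ k (SpChain.rootMinus K i j) =
            (SpChain.gens K N k).Em (SpChain.shift k i) (SpChain.shift k j)) ∧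
        (∀ i : Fin (N - k),
          φ k (SpChain.cartan K i) = (SpChain.gens K N k).H (SpChain.shift k i)) ∧
        (∀ x, SpChain.IsPrimitiveFor (SpChain.chain K N k) (φ k x)) ∧
        Function.Injective
          (SpChain.extendSeries (UniversalEnvelopingAlgebra.lift K (φ k)))) ∧
      ∀ k < N,
        Set.range (SpChain.extendSeries (UniversalEnvelopingAlgebra.lift K (φ (k + 1)))) ⊆
          Set.range (SpChain.extendSeries (UniversalEnvelopingAlgebra.lift K (φ k)))) ∧
    -- all the partial products, in particular the full chain, solve the twist equation
    (∀ k ≤ N, SpChain.IsTwist K (SpChain.sp K N) (SpChain.chain K N k)) ∧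
    -- the carrier of the full chain is the Borel subalgebra, and the chain is full and proper
    SpChain.IsCarrier (SpChain.chain K N N) (SpChain.borelPlus K N) ∧
    SpChain.IsFull K (SpChain.chain K N N) ∧
    SpChain.IsProper K (SpChain.chain K N N) := by
  refine ⟨SpChain.hasStepCostructure_chain, ⟨SpChain.copyHom K N, fun k hk => ⟨fun i j =>
      ⟨SpChain.copyHom_rootEplus hk i j, SpChain.copyHom_rootFplus hk i j⟩, fun i j hij => ?_,
      SpChain.copyHom_cartan hk, SpChain.isPrimitiveFor_copyHom hk,
      SpChain.extendSeries_copyHom_injective hk⟩,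
    fun k hk => SpChain.range_extendSeries_copyHom_subset hk⟩,
    fun k _ => SpChain.isTwist_chain k, SpChain.isCarrier_chain, SpChain.isFull_chain,
    SpChain.isProper_chain hN⟩
  rw [SpChain.copyHom_rootMinus hk, SpChain.Gens.M_of_ne _ (SpChain.shift_inj.not.2 hij)]
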